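/- Let $k=\mathbb R$ or $\mathbb C$. Let $(\mathcal M,Q)$ be an $NQ$-manifold and $\mathcal E\to\mathcal M$ a $Q$-equivariant graded vector bundle of finite rank, given over an open cover by fibre coordinates $\zeta_\alpha$ of degree $\alpha$, with lift $\hat Q\zeta_\alpha=(-1)^\beta\zeta_\beta T^\beta{}_\alpha$, $\hat Q^2=0$ (equivalently $(-1)^\beta QT^\beta{}_\alpha+(-1)^\gamma T^\beta{}_\gamma T^\gamma{}_\alpha=0$), and with transition matrices $\Omega$, $\tilde\zeta_\alpha=\zeta_\beta\Omega^\beta{}_\alpha$, compatible with $\hat Q$; $\zeta^\alpha$ denotes the dual fibre coordinates. Let $(\mathcal L,d^y)$ be any $NQ$-manifold (the test manifold). For a super-curve $\boldsymbol x(t,\theta,y):T[1][0,1]\times\mathcal L\to\mathcal M$ (a morphism of $NQ$-manifolds, where $T[1][0,1]$ carries $D=\theta\partial_t$) lying in one patch of $\mathcal E$, the Wilson line is $U_C=\zeta_\alpha U^\alpha{}_\beta(1,0)\zeta^\beta$ with $$U(1,0)=\mathbb P\exp\Big(-\int_0^1 dt\,d\theta\; T(\boldsymbol x(t,\theta,y))\Big)$$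 (the sum of the iterated integrals, later times to the left). In general one subdivides $[0,1]$ so that each piece lies in one patch, and $U(1,0)$ is the product of the Wilson lines of the pieces and of the transition matrices $\Omega$ (at $\theta=0$) at the connecting points. For a super-loop $T[1]S^1\times\mathcal L\to\mathcal M$, closed up by the transition matrix from the last to the first patch if these differ, the Wilson loop is $U_{\rm O}=\sum_\alpha(-1)^\alpha U^\alpha{}_\alpha(1,0)$. A homotopy is a morphism of $NQ$-manifolds $T[1][0,1]_{(t,\theta)}\times\mathcal L\times T[1][0,1]_{(s,\vartheta)}\to\mathcal M$ (with $S^1$ in place of the first $[0,1]$ for loops), written $\boldsymbol x(t,\theta,y,s)+\vartheta\,\bar{\boldsymbol x}(t,\theta,y,s)$; equivalently, every $\boldsymbol x(\cdot,s)$ is a super-curve and $\partial_s\boldsymbol x^A=\iota_{\bar x}Q^A(\boldsymbol x)+(D+d^y)\bar{\boldsymbol x}^A$. Here $\iota_{\bar x}=\bar{\boldsymbol x}^A\partial/\partial x^A$ is the first variation: $F[\boldsymbol x+\vartheta\bar{\boldsymbol x}]=F[\boldsymbol x]+\vartheta\,\iota_{\bar x}F$. Write $T(0)$, $T(1)$ for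 $T$ over the initial and the final point, at $\theta=0$ and in the first and the last patch. 1. For every homotopy of super-curves, every $s\in[0,1]$, every point $y$ of the body of $\mathcal L$, and every subdivision with a choice of patches adapted to the curve at $(s,y)$, the entries $U^\alpha{}_\beta$ and $\iota_{\bar x}U^\alpha{}_\beta$ are functions on $\mathcal L$ near $y$ of degrees $\beta-\alpha$ and $\beta-\alpha-1$, and at $(s,y)$ $$\partial_sU^\alpha{}_\beta=d^y\,\iota_{\bar x}U^\alpha{}_\beta+\iota_{\bar x}\Big(-T^\alpha{}_\delta(1)U^\delta{}_\beta(1,0)+(-1)^{\alpha+\gamma}U^\alpha{}_\gamma(1,0)T^\gamma{}_\beta(0)\Big).$$ Equivalently $$\partial_sU_C=d^y\big((-1)^\alpha\zeta_\alpha(\iota_{\bar x}U^\alpha{}_\beta)\zeta^\beta\big),$$ where $d^y\zeta_\alpha=(-1)^\beta\zeta_\beta T^\beta{}_\alpha(1)$, $d^y\zeta^\alpha=-T^\alpha{}_\beta(0)\zeta^\beta$, $\partial_s\zeta_\alpha=\zeta_\beta\,\iota_{\bar x}T^\beta{}_\alpha(1)$ and $\partial_s\zeta^\alpha=-(\iota_{\bar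 x}T^\alpha{}_\beta(0))\zeta^\beta$. Thus the change of the Wilson line is exact for the differential of the test manifold. 2. For every homotopy of super-loops, $\partial_sU_{\rm O}=0$ at every $(s,y)$, for every subdivision with patches adapted at $(s,y)$. 3. Wilson loops are homotopy invariant: if two super-loops are the restrictions to $s=0$, $\vartheta=0$ and to $s=1$, $\vartheta=0$ of one homotopy $T[1]S^1\times\mathcal L\times T[1][0,1]\to\mathcal M$, then their Wilson loops are equal at every point of the body of $\mathcal L$, whatever adapted subdivisions and patches are used to compute them. -/

import Mathlib

open Set Filter Topology
open scoped ContDiff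

set_option linter.unusedSectionVars false
set_option linter.unusedSimpArgs false

noncomputable section

namespace NQ

/-! ### Graded algebras with coordinates -/

/-- An `ℕ`-graded `𝕜`-algebra whose elements are arbitrary families of coefficients with respect
to a homogeneous (topological) basis `Idx`.  `par` is the parity involution `a ↦ (-1)^{deg a} a`. -/
class GrAlg (𝕜 : Type) [RCLike 𝕜] (R : Type) [Ring R] [Algebra 𝕜 R] where
  Idx : Type
  deg : Idx → ℕ
  coeff : R ≃ₗ[𝕜] (Idx → 𝕜)
  par : R →ₐ[𝕜] R
  coeff_par : ∀ a i, coeff (par a) i = (-1) ^ deg i * coeff a i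

section Coefficientwise

variable (𝕜 : Type) [RCLike 𝕜] {R : Type} [Ring R] [Algebra 𝕜 R] [GrAlg 𝕜 R]

/-- `a` is homogeneous of degree `p` (there is only `0` in negative degree). -/
def IsHomog (p : ℤ) (a : R) : Prop :=
  ∀ i, GrAlg.coeff (𝕜 := 𝕜) a i ≠ 0 → (GrAlg.deg (𝕜 := 𝕜) i : ℤ) = p

/-- Coefficientwise integral `∫_a^b f(t) dt`. -/
def integ (a b : ℝ) (f : ℝ → R) : R :=
  (GrAlg.coeff (𝕜 := 𝕜)).symm fun i => ∫ t in a..b, GrAlg.coeff (𝕜 := 𝕜) (f t) i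

/-- Coefficientwise sum of a series. -/
def series (u : ℕ → R) : R :=
  (GrAlg.coeff (𝕜 := 𝕜)).symm fun i => ∑' q, GrAlg.coeff (𝕜 := 𝕜) (u q) i

/-- Coefficientwise derivative of `f` at `t` within `S`. -/
def dWithin (S : Set ℝ) (f : ℝ → R) (t : ℝ) : R :=
  (GrAlg.coeff (𝕜 := 𝕜)).symm fun i => derivWithin (fun u => GrAlg.coeff (𝕜 := 𝕜) (f u) i) S t

/-- `f` is differentiable at `t` within `S`, coefficientwise, with derivative `f'`. -/
def HasDWithin (f : ℝ → R) (f' : R) (S : Set ℝ) (t : ℝ) : Prop :=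
  ∀ i, HasDerivWithinAt (fun u => GrAlg.coeff (𝕜 := 𝕜) (f u) i) (GrAlg.coeff (𝕜 := 𝕜) f' i) S t

/-- Coefficientwise partial derivative `∂g/∂z^a`. -/
def pderiv {n : ℕ} (a : Fin n) (g : EuclideanSpace ℝ (Fin n) → R)
    (z : EuclideanSpace ℝ (Fin n)) : R :=
  (GrAlg.coeff (𝕜 := 𝕜)).symm fun i =>
    fderiv ℝ (fun w => GrAlg.coeff (𝕜 := 𝕜) (g w) i) z (EuclideanSpace.single a 1)

/-- `q`-fold iterated integrals
`(-1)^q ∫_{a ≤ t_q ≤ ⋯ ≤ t_1 ≤ t} A(t_1) A(t_2) ⋯ A(t_q)` of a matrix valued function. -/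
def iterInt {N : ℕ} (A : ℝ → Matrix (Fin N) (Fin N) R) (a : ℝ) :
    ℕ → ℝ → Matrix (Fin N) (Fin N) R
  | 0, _ => 1
  | q + 1, t => Matrix.of fun α β => - integ 𝕜 a t fun u => (A u * iterInt A a q u) α β

/-- The path ordered exponential `P exp (-∫_a^b A(t) dt)`, later times standing to the left. -/
def pexp {N : ℕ} (A : ℝ → Matrix (Fin N) (Fin N) R) (b a : ℝ) : Matrix (Fin N) (Fin N) R :=
  Matrix.of fun α β => series 𝕜 fun q => iterInt 𝕜 A a q b α β

end Coefficientwise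

/-! ### The free graded commutative algebra on finitely many generators -/

section Free

variable {r : ℕ}

/-- Exponents of monomials: odd generators occur at most once. -/
def Adm (d : Fin r → ℕ) (m : Fin r →₀ ℕ) : Prop := ∀ j, Odd (d j) → m j ≤ 1

/-- Monomials in generators `ξ_j` of degree `d j`, ordered as `ξ_0^{m 0} ξ_1^{m 1} ⋯`. -/
abbrev Mon (d : Fin r → ℕ) : Type := {m : Fin r →₀ ℕ // Adm d m}

/-- Degree of a monomial. -/
def wt (d : Fin r → ℕ) (m : Fin r →₀ ℕ) : ℕ := ∑ j, m j * d j

/-- Exponent of the sign in `ξ^a ξ^b = ± ξ^{a+b}`: every `ξ_j` of `b` is moved to the left past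
the `ξ_i` of `a` with `j < i`. -/
def signExp (d : Fin r → ℕ) (a b : Fin r →₀ ℕ) : ℕ :=
  ∑ i, ∑ j ∈ Finset.univ.filter (fun j => j < i), (a i * d i) * (b j * d j)

/-- The free graded commutative `𝕜`-algebra on generators of degrees `d`, as coefficient families
on monomials.  When all degrees are positive a homogeneous element is a polynomial. -/
def Gca (𝕜 : Type) (d : Fin r → ℕ) : Type := Mon d → 𝕜

variable {𝕜 : Type} [RCLike 𝕜] {d : Fin r → ℕ}

namespace Gca

instance : AddCommGroup (Gca 𝕜 d) := inferInstanceAs (AddCommGroup (Mon d → 𝕜))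
instance : Module 𝕜 (Gca 𝕜 d) := inferInstanceAs (Module 𝕜 (Mon d → 𝕜))

open Classical in
/-- Coefficient at an arbitrary exponent (zero when the monomial vanishes). -/
def ex (f : Gca 𝕜 d) (m : Fin r →₀ ℕ) : 𝕜 := if h : Adm d m then f ⟨m, h⟩ else 0

instance : Mul (Gca 𝕜 d) :=
  ⟨fun f g m => ∑ p ∈ Finset.HasAntidiagonal.antidiagonal m.1,
    (-1) ^ signExp d p.1 p.2 * (ex f p.1 * ex g p.2)⟩

open Classical in
instance : One (Gca 𝕜 d) := ⟨fun m => if m.1 = 0 then 1 else 0⟩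

@[ext] theorem ext' {f g : Gca 𝕜 d} (h : ∀ m, f m = g m) : f = g := funext h

theorem add_apply (f g : Gca 𝕜 d) (m : Mon d) : (f + g) m = f m + g m := rfl
theorem zero_apply (m : Mon d) : (0 : Gca 𝕜 d) m = 0 := rfl
theorem smul_apply (c : 𝕜) (f : Gca 𝕜 d) (m : Mon d) : (c • f) m = c * f m := rfl
theorem mul_apply (f g : Gca 𝕜 d) (m : Mon d) :
    (f * g) m = ∑ p ∈ Finset.HasAntidiagonal.antidiagonal m.1,
      (-1) ^ signExp d p.1 p.2 * (ex f p.1 * ex g p.2) := rfl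

theorem ex_add (f g : Gca 𝕜 d) (m) : ex (f + g) m = ex f m + ex g m := by
  unfold ex; split_ifs <;> simp [add_apply]
theorem ex_zero (m) : ex (0 : Gca 𝕜 d) m = 0 := by
  unfold ex; split_ifs <;> simp [zero_apply]
theorem ex_smul (c : 𝕜) (f : Gca 𝕜 d) (m) : ex (c • f) m = c * ex f m := by
  unfold ex; split_ifs <;> simp [smul_apply]
theorem ex_coe (f : Gca 𝕜 d) (m : Mon d) : ex f m.1 = f m := by
  unfold ex; rw [dif_pos m.2]

open Classical in
theorem ex_one (m) : ex (1 : Gca 𝕜 d) m = if m = 0 then 1 else 0 := by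
  unfold ex
  by_cases h : m = 0
  · subst h
    have : Adm d 0 := fun j _ => Nat.zero_le 1
    rw [dif_pos this, if_pos rfl]; exact if_pos rfl
  · split_ifs with h'
    · exact if_neg h
    · rfl

theorem adm_of_add {a b : Fin r →₀ ℕ} (h : Adm d (a + b)) : Adm d a ∧ Adm d b :=
  ⟨fun j hj => le_trans (Nat.le_add_right _ _) (h j hj),
   fun j hj => le_trans (Nat.le_add_left _ _) (h j hj)⟩

theorem ex_mul (f g : Gca 𝕜 d) {m : Fin r →₀ ℕ} (h : Adm d m) :
    ex (f * g) m = ∑ p ∈ Finset.HasAntidiagonal.antidiagonal m,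
      (-1) ^ signExp d p.1 p.2 * (ex f p.1 * ex g p.2) := by
  unfold ex
  rw [dif_pos h]
  rfl

theorem signExp_add_left (a b c : Fin r →₀ ℕ) :
    signExp d (a + b) c = signExp d a c + signExp d b c := by
  simp [signExp, add_mul, Finset.sum_add_distrib]

theorem signExp_add_right (a b c : Fin r →₀ ℕ) :
    signExp d a (b + c) = signExp d a b + signExp d a c := by
  simp [signExp, add_mul, mul_add, Finset.sum_add_distrib]

theorem signExp_zero_left (a : Fin r →₀ ℕ) : signExp d 0 a = 0 := by simp [signExp]
theorem signExp_zero_right (a : Fin r →₀ ℕ) : signExp d a 0 = 0 := by simp [signExp]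

theorem wt_add (a b : Fin r →₀ ℕ) : wt d (a + b) = wt d a + wt d b := by
  simp [wt, add_mul, Finset.sum_add_distrib]

protected theorem mul_assoc' (f g h : Gca 𝕜 d) : f * g * h = f * (g * h) := by
  ext m
  rw [mul_apply, mul_apply]
  have h1 : ∀ p ∈ Finset.HasAntidiagonal.antidiagonal m.1,
      (-1 : 𝕜) ^ signExp d p.1 p.2 * (ex (f * g) p.1 * ex h p.2) =
      ∑ q ∈ Finset.HasAntidiagonal.antidiagonal p.1, (-1) ^ signExp d p.1 p.2 *
        (((-1) ^ signExp d q.1 q.2 * (ex f q.1 * ex g q.2)) * ex h p.2) := by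
    intro p hp
    rw [Finset.HasAntidiagonal.mem_antidiagonal] at hp
    rw [ex_mul f g (adm_of_add (hp ▸ m.2)).1, Finset.sum_mul, Finset.mul_sum]
  have h2 : ∀ p ∈ Finset.HasAntidiagonal.antidiagonal m.1,
      (-1 : 𝕜) ^ signExp d p.1 p.2 * (ex f p.1 * ex (g * h) p.2) =
      ∑ q ∈ Finset.HasAntidiagonal.antidiagonal p.2, (-1) ^ signExp d p.1 p.2 *
        (ex f p.1 * ((-1) ^ signExp d q.1 q.2 * (ex g q.1 * ex h q.2))) := by
    intro p hp
    rw [Finset.HasAntidiagonal.mem_antidiagonal] at hp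
    rw [ex_mul g h (adm_of_add (hp ▸ m.2)).2, Finset.mul_sum, Finset.mul_sum]
  rw [Finset.sum_congr rfl h1, Finset.sum_congr rfl h2, Finset.sum_sigma', Finset.sum_sigma']
  refine Finset.sum_nbij' (fun x => ⟨(x.2.1, x.2.2 + x.1.2), (x.2.2, x.1.2)⟩)
    (fun x => ⟨(x.1.1 + x.2.1, x.2.2), (x.1.1, x.2.1)⟩) ?_ ?_ ?_ ?_ ?_
  · rintro ⟨⟨i, j⟩, ⟨k, l⟩⟩ hx
    simp only [Finset.mem_sigma, Finset.HasAntidiagonal.mem_antidiagonal] at hx ⊢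
    exact ⟨by rw [← hx.1, ← hx.2, add_assoc], trivial⟩
  · rintro ⟨⟨i, j⟩, ⟨k, l⟩⟩ hx
    simp only [Finset.mem_sigma, Finset.HasAntidiagonal.mem_antidiagonal] at hx ⊢
    exact ⟨by rw [← hx.1, ← hx.2, add_assoc], trivial⟩
  · rintro ⟨⟨i, j⟩, ⟨k, l⟩⟩ hx
    simp only [Finset.mem_sigma, Finset.HasAntidiagonal.mem_antidiagonal] at hx
    obtain ⟨-, rfl⟩ := hx
    rfl
  · rintro ⟨⟨i, j⟩, ⟨k, l⟩⟩ hx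
    simp only [Finset.mem_sigma, Finset.HasAntidiagonal.mem_antidiagonal] at hx
    obtain ⟨-, rfl⟩ := hx
    rfl
  · rintro ⟨⟨i, j⟩, ⟨k, l⟩⟩ hx
    simp only [Finset.mem_sigma, Finset.HasAntidiagonal.mem_antidiagonal] at hx
    obtain ⟨-, rfl⟩ := hx
    simp only [signExp_add_left, signExp_add_right, pow_add]
    ring

protected theorem one_mul' (f : Gca 𝕜 d) : 1 * f = f := by
  ext m
  rw [mul_apply, Finset.sum_eq_single (0, m.1)]
  · simp [ex_one, signExp_zero_left, ex_coe]
  · rintro ⟨a, b⟩ hp hne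
    rw [Finset.HasAntidiagonal.mem_antidiagonal] at hp
    have : a ≠ 0 := by
      rintro rfl
      exact hne (by simpa using hp)
    simp [ex_one, this]
  · intro h
    exact absurd (by simp) h

protected theorem mul_one' (f : Gca 𝕜 d) : f * 1 = f := by
  ext m
  rw [mul_apply, Finset.sum_eq_single (m.1, 0)]
  · simp [ex_one, signExp_zero_right, ex_coe]
  · rintro ⟨a, b⟩ hp hne
    rw [Finset.HasAntidiagonal.mem_antidiagonal] at hp
    have : b ≠ 0 := by
      rintro rfl
      exact hne (by simpa using hp)
    simp [ex_one, this]
  · intro h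
    exact absurd (by simp) h

instance : Ring (Gca 𝕜 d) where
  __ := (inferInstance : AddCommGroup (Gca 𝕜 d))
  mul := (· * ·)
  one := 1
  mul_assoc := Gca.mul_assoc'
  one_mul := Gca.one_mul'
  mul_one := Gca.mul_one'
  zero_mul f := by ext m; simp [mul_apply, ex_zero, zero_apply]
  mul_zero f := by ext m; simp [mul_apply, ex_zero, zero_apply]
  left_distrib f g h := by
    ext m; simp [mul_apply, ex_add, add_apply, mul_add, Finset.sum_add_distrib]
  right_distrib f g h := by
    ext m; simp [mul_apply, ex_add, add_apply, mul_add, add_mul, Finset.sum_add_distrib]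

instance : Algebra 𝕜 (Gca 𝕜 d) :=
  Algebra.ofModule
    (fun c f g => by
      ext m
      simp only [mul_apply, smul_apply, ex_smul, Finset.mul_sum]
      exact Finset.sum_congr rfl fun _ _ => by ring)
    (fun c f g => by
      ext m
      simp only [mul_apply, smul_apply, ex_smul, Finset.mul_sum]
      exact Finset.sum_congr rfl fun _ _ => by ring)

/-- The map `f ↦ (-1)^{deg f} f`. -/
def parFun (f : Gca 𝕜 d) : Gca 𝕜 d := fun m => (-1) ^ wt d m.1 * f m

theorem parFun_apply (f : Gca 𝕜 d) (m : Mon d) : parFun f m = (-1) ^ wt d m.1 * f m := rfl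

theorem ex_parFun (f : Gca 𝕜 d) (a : Fin r →₀ ℕ) :
    ex (parFun f) a = (-1) ^ wt d a * ex f a := by
  unfold ex; split_ifs <;> simp [parFun_apply]

/-- The parity involution as an algebra homomorphism. -/
def parity : Gca 𝕜 d →ₐ[𝕜] Gca 𝕜 d :=
  AlgHom.ofLinearMap
    { toFun := parFun
      map_add' := fun f g => by ext m; simp only [parFun_apply, add_apply, mul_add]
      map_smul' := fun c f => by
        ext m; simp only [smul_apply, parFun_apply, RingHom.id_apply]; ring }
    (by
      ext m
      change parFun 1 m = (1 : Gca 𝕜 d) m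
      rw [parFun_apply, ← ex_coe (1 : Gca 𝕜 d) m, ex_one]
      split_ifs with h
      · simp [h, wt]
      · simp)
    (by
      intro f g
      ext m
      change parFun (f * g) m = (parFun f * parFun g) m
      rw [parFun_apply, mul_apply, mul_apply, Finset.mul_sum]
      refine Finset.sum_congr rfl ?_
      rintro ⟨a, b⟩ hp
      rw [Finset.HasAntidiagonal.mem_antidiagonal] at hp
      rw [ex_parFun, ex_parFun, ← hp, wt_add, pow_add]
      ring)

instance : GrAlg 𝕜 (Gca 𝕜 d) where
  Idx := Mon d
  deg := fun m => wt d m.1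
  coeff := LinearEquiv.refl 𝕜 (Mon d → 𝕜)
  par := parity
  coeff_par := fun _ _ => rfl

end Gca

end Free

/-! ### Adjoining one odd variable -/

/-- Functions `fst + θ · snd` of one more odd variable `θ` of degree one, with coefficients in
the graded algebra `R`. -/
@[ext] structure OddExt (𝕜 R : Type) where
  fst : R
  snd : R

namespace OddExt

variable {𝕜 : Type} [RCLike 𝕜] {R : Type} [Ring R] [Algebra 𝕜 R]

instance : Zero (OddExt 𝕜 R) := ⟨⟨0, 0⟩⟩
instance : Add (OddExt 𝕜 R) := ⟨fun x y => ⟨x.fst + y.fst, x.snd + y.snd⟩⟩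
instance : Neg (OddExt 𝕜 R) := ⟨fun x => ⟨-x.fst, -x.snd⟩⟩
instance : SMul 𝕜 (OddExt 𝕜 R) := ⟨fun c x => ⟨c • x.fst, c • x.snd⟩⟩
instance : One (OddExt 𝕜 R) := ⟨⟨1, 0⟩⟩

/-- `(a + θ b)(a' + θ b') = a a' + θ (b a' + (-1)^{deg a} a b')`. -/
instance [GrAlg 𝕜 R] : Mul (OddExt 𝕜 R) :=
  ⟨fun x y => ⟨x.fst * y.fst, x.snd * y.fst + GrAlg.par (𝕜 := 𝕜) x.fst * y.snd⟩⟩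

@[simp] theorem fst_zero : (0 : OddExt 𝕜 R).fst = 0 := rfl
@[simp] theorem snd_zero : (0 : OddExt 𝕜 R).snd = 0 := rfl
@[simp] theorem fst_one : (1 : OddExt 𝕜 R).fst = 1 := rfl
@[simp] theorem snd_one : (1 : OddExt 𝕜 R).snd = 0 := rfl
@[simp] theorem fst_add (x y : OddExt 𝕜 R) : (x + y).fst = x.fst + y.fst := rfl
@[simp] theorem snd_add (x y : OddExt 𝕜 R) : (x + y).snd = x.snd + y.snd := rfl
@[simp] theorem fst_neg (x : OddExt 𝕜 R) : (-x).fst = -x.fst := rfl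
@[simp] theorem snd_neg (x : OddExt 𝕜 R) : (-x).snd = -x.snd := rfl
@[simp] theorem fst_smul (c : 𝕜) (x : OddExt 𝕜 R) : (c • x).fst = c • x.fst := rfl
@[simp] theorem snd_smul (c : 𝕜) (x : OddExt 𝕜 R) : (c • x).snd = c • x.snd := rfl

instance : AddCommGroup (OddExt 𝕜 R) where
  add_assoc x y z := by ext <;> simp [add_assoc]
  zero_add x := by ext <;> simp
  add_zero x := by ext <;> simp
  add_comm x y := by ext <;> simp [add_comm]
  neg_add_cancel x := by ext <;> simp
  nsmul := nsmulRec
  zsmul := zsmulRec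

instance : Module 𝕜 (OddExt 𝕜 R) where
  one_smul x := by ext <;> simp
  mul_smul c c' x := by ext <;> simp [mul_smul]
  smul_zero c := by ext <;> simp
  smul_add c x y := by ext <;> simp
  add_smul c c' x := by ext <;> simp [add_smul]
  zero_smul x := by ext <;> simp

variable [GrAlg 𝕜 R]

@[simp] theorem fst_mul (x y : OddExt 𝕜 R) : (x * y).fst = x.fst * y.fst := rfl
@[simp] theorem snd_mul (x y : OddExt 𝕜 R) :
    (x * y).snd = x.snd * y.fst + GrAlg.par (𝕜 := 𝕜) x.fst * y.snd := rfl

instance : Ring (OddExt 𝕜 R) where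
  __ := (inferInstance : AddCommGroup (OddExt 𝕜 R))
  mul := (· * ·)
  one := 1
  mul_assoc x y z := by ext <;> simp [mul_assoc, add_mul, mul_add, add_assoc]
  one_mul x := by ext <;> simp
  mul_one x := by ext <;> simp
  zero_mul x := by ext <;> simp
  mul_zero x := by ext <;> simp
  left_distrib x y z := by ext <;> simp [mul_add]; abel
  right_distrib x y z := by ext <;> simp [add_mul]; abel

instance : Algebra 𝕜 (OddExt 𝕜 R) :=
  Algebra.ofModule
    (fun c x y => by ext <;> simp)
    (fun c x y => by ext <;> simp)

theorem par_par (a : R) : GrAlg.par (𝕜 := 𝕜) (GrAlg.par (𝕜 := 𝕜) a) = a := by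
  apply (GrAlg.coeff (𝕜 := 𝕜)).injective
  funext i
  rw [GrAlg.coeff_par, GrAlg.coeff_par, ← mul_assoc, ← mul_pow]
  simp

/-- The parity involution of `R[θ]`. -/
def parity : OddExt 𝕜 R →ₐ[𝕜] OddExt 𝕜 R :=
  AlgHom.ofLinearMap
    { toFun := fun x => ⟨GrAlg.par (𝕜 := 𝕜) x.fst, -GrAlg.par (𝕜 := 𝕜) x.snd⟩
      map_add' := fun x y => by ext <;> simp; abel
      map_smul' := fun c x => by ext <;> simp }
    (by ext <;> simp)
    (by intro x y; ext <;> simp; abel)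

instance : GrAlg 𝕜 (OddExt 𝕜 R) where
  Idx := GrAlg.Idx 𝕜 R ⊕ GrAlg.Idx 𝕜 R
  deg := Sum.elim (GrAlg.deg (𝕜 := 𝕜) (R := R)) fun i => GrAlg.deg (𝕜 := 𝕜) (R := R) i + 1
  coeff :=
    { toFun := fun x => Sum.elim (GrAlg.coeff (𝕜 := 𝕜) x.fst) (GrAlg.coeff (𝕜 := 𝕜) x.snd)
      invFun := fun c => ⟨(GrAlg.coeff (𝕜 := 𝕜)).symm fun i => c (Sum.inl i),
        (GrAlg.coeff (𝕜 := 𝕜)).symm fun i => c (Sum.inr i)⟩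
      map_add' := fun x y => by funext i; cases i <;> simp
      map_smul' := fun c x => by funext i; cases i <;> simp
      left_inv := fun x => by ext <;> simp
      right_inv := fun c => by funext i; cases i <;> simp }
  par := parity
  coeff_par := fun x i => by
    cases i with
    | inl i => exact GrAlg.coeff_par _ _
    | inr i =>
      change GrAlg.coeff (𝕜 := 𝕜) (-GrAlg.par (𝕜 := 𝕜) x.snd) i = _
      rw [map_neg, Pi.neg_apply, GrAlg.coeff_par]
      simp [pow_succ]

end OddExt

/-! ### NQ-manifolds -/

/-- A non-negatively graded manifold over `𝕜`: a smooth manifold `Body` with a sheaf of graded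
commutative algebras locally isomorphic to `C^∞(U) ⊗ (free graded commutative algebra on
generators of positive degree)`.  As all generators have positive degree, the functions of degree
zero are the smooth functions on the body, and the sheaf is the sheaf of smooth sections of a
bundle of graded algebras.  The fibre over every point is a copy of the free algebra `Gca 𝕜 deg`;
the smooth structure is given by charts, which consist of coordinates on an open subset of the body
and a trivialization `frame c y` of the fibres over it. -/
structure NManifold (𝕜 : Type) [RCLike 𝕜] where
  Body : Type
  [top : TopologicalSpace Body]
  [t2 : T2Space Body]
  [sct : SecondCountableTopology Body]
  dim : ℕ
  gens : ℕ
  deg : Fin gens → ℕ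
  deg_pos : ∀ j, 0 < deg j
  Chart : Type
  coord : Chart → OpenPartialHomeomorph Body (EuclideanSpace ℝ (Fin dim))
  cover : ∀ y, ∃ c, y ∈ (coord c).source
  frame : Chart → Body → (Gca 𝕜 deg ≃ₐ[𝕜] Gca 𝕜 deg)
  frame_homog : ∀ c, ∀ y ∈ (coord c).source, ∀ (p : ℤ) (a : Gca 𝕜 deg),
    IsHomog 𝕜 p (frame c y a) ↔ IsHomog 𝕜 p a
  coord_smooth : ∀ c c', ContDiffOn ℝ ∞ (fun z => coord c' ((coord c).symm z))
    ((coord c).target ∩ (coord c).symm ⁻¹' (coord c').source)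
  frame_smooth : ∀ (c c') (p : ℤ) (a : Gca 𝕜 deg), IsHomog 𝕜 p a → ∀ i,
    ContDiffOn ℝ ∞ (fun z => GrAlg.coeff (𝕜 := 𝕜)
        (frame c' ((coord c).symm z) ((frame c ((coord c).symm z)).symm a)) i)
      ((coord c).target ∩ (coord c).symm ⁻¹' (coord c').source)

attribute [instance] NManifold.top NManifold.t2 NManifold.sct

namespace NManifold

variable {𝕜 : Type} [RCLike 𝕜] (M : NManifold 𝕜)

/-- The fibre of the bundle of graded algebras. -/
abbrev Alg : Type := Gca 𝕜 M.deg

/-- Local representative of a section in a chart. -/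
def rep (c : M.Chart) (f : M.Body → M.Alg) (z : EuclideanSpace ℝ (Fin M.dim)) : M.Alg :=
  M.frame c ((M.coord c).symm z) (f ((M.coord c).symm z))

/-- `f` is on `U` a function of degree `p` on the graded manifold. -/
def IsFn (U : Set M.Body) (p : ℤ) (f : M.Body → M.Alg) : Prop :=
  (∀ y ∈ U, IsHomog 𝕜 p (f y)) ∧
  ∀ c i, ContDiffOn ℝ ∞ (fun z => GrAlg.coeff (𝕜 := 𝕜) (M.rep c f z) i)
    ((M.coord c).target ∩ (M.coord c).symm ⁻¹' U)

/-- Smoothness on `W` of a family of sections that depends on a parameter in a normed space. -/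
def SmoothFam {P : Type} [NormedAddCommGroup P] [NormedSpace ℝ P] (W : Set (P × M.Body))
    (F : P → M.Body → M.Alg) : Prop :=
  ∀ c i, ContDiffOn ℝ ∞ (fun q : P × EuclideanSpace ℝ (Fin M.dim) =>
      GrAlg.coeff (𝕜 := 𝕜) (M.rep c (F q.1) q.2) i)
    {q | q.2 ∈ (M.coord c).target ∧ (q.1, (M.coord c).symm q.2) ∈ W}

/-- In the chart `c` the operator `Q` is the vector field of degree one
`∑_a v^a ∂/∂z^a + δ`, where the `v^a` are functions of degree one and `δ` is a smooth family of
derivations of degree one of the fibre (the part that differentiates the graded coordinates). -/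
def IsVectorFieldIn (c : M.Chart) (Q : (M.Body → M.Alg) → M.Body → M.Alg) : Prop :=
  ∃ (v : Fin M.dim → EuclideanSpace ℝ (Fin M.dim) → M.Alg)
    (δ : EuclideanSpace ℝ (Fin M.dim) → M.Alg →ₗ[𝕜] M.Alg),
    (∀ a, ∀ z ∈ (M.coord c).target, IsHomog 𝕜 1 (v a z)) ∧
    (∀ a i, ContDiffOn ℝ ∞ (fun z => GrAlg.coeff (𝕜 := 𝕜) (v a z) i) (M.coord c).target) ∧
    (∀ z ∈ (M.coord c).target, ∀ (p : ℤ) (x : M.Alg), IsHomog 𝕜 p x →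
      IsHomog 𝕜 (p + 1) (δ z x)) ∧
    (∀ z ∈ (M.coord c).target, ∀ x y : M.Alg,
      δ z (x * y) = δ z x * y + GrAlg.par (𝕜 := 𝕜) x * δ z y) ∧
    (∀ (p : ℤ) (x : M.Alg), IsHomog 𝕜 p x → ∀ i,
      ContDiffOn ℝ ∞ (fun z => GrAlg.coeff (𝕜 := 𝕜) (δ z x) i) (M.coord c).target) ∧
    ∀ (U : Set M.Body) (p : ℤ) (f : M.Body → M.Alg), IsOpen U → M.IsFn U p f →
      ∀ z ∈ (M.coord c).target ∩ (M.coord c).symm ⁻¹' U,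
        M.rep c (Q f) z = ∑ a, v a z * pderiv 𝕜 a (M.rep c f) z + δ z (M.rep c f z)

end NManifold

/-- An NQ-manifold: a non-negatively graded manifold with a homological vector field, that is, a
vector field `Q` of degree one with `Q² = 0`.  Only the values of `Q` on functions matter. -/
structure NQManifold (𝕜 : Type) [RCLike 𝕜] extends NManifold 𝕜 where
  Q : (Body → Gca 𝕜 deg) → Body → Gca 𝕜 deg
  Q_local : ∀ c, toNManifold.IsVectorFieldIn c Q
  Q_sq : ∀ (U : Set Body) (p : ℤ) (f : Body → Gca 𝕜 deg), IsOpen U → toNManifold.IsFn U p f →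
    ∀ y ∈ U, Q (Q f) y = 0

/-! ### Representations: `Q`-equivariant graded vector bundles -/

/-- The sign `(-1)^n`, acting on an abelian group. -/
abbrev sg {A : Type} [AddCommGroup A] (n : ℤ) (a : A) : A := n.negOnePow • a

/-- A `Q`-equivariant graded vector bundle of finite rank over `M`, given over an open cover by
local fibre coordinates `ζ^{(i)}_α` of degree (level) `lev α`, transition matrices
`ζ^{(j)}_α = ζ^{(i)}_β (Ω_{ij})^β_α`, and the lift
`Q̂ ζ^{(i)}_α = (-1)^β ζ^{(i)}_β (T_i)^β_α` of `Q`.  The equation `flat` is `Q̂² = 0` and the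
equation `gauge` says that the local expressions of `Q̂` agree on overlaps. -/
structure QBundle {𝕜 : Type} [RCLike 𝕜] (M : NQManifold 𝕜) where
  rank : ℕ
  lev : Fin rank → ℤ
  Patch : Type
  dom : Patch → Set M.Body
  dom_open : ∀ i, IsOpen (dom i)
  dom_cover : ∀ x, ∃ i, x ∈ dom i
  T : Patch → M.Body → Matrix (Fin rank) (Fin rank) M.Alg
  T_fn : ∀ i α β, M.IsFn (dom i) (1 + lev β - lev α) fun x => T i x α β
  flat : ∀ i, ∀ x ∈ dom i, ∀ β α,
    sg (lev β) (M.Q (fun x' => T i x' β α) x) + ∑ γ, sg (lev γ) (T i x β γ * T i x γ α) = 0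
  Ω : Patch → Patch → M.Body → Matrix (Fin rank) (Fin rank) M.Alg
  Ω_fn : ∀ i j α β, M.IsFn (dom i ∩ dom j) (lev β - lev α) fun x => Ω i j x α β
  Ω_self : ∀ i, ∀ x ∈ dom i, Ω i i x = 1
  Ω_cocycle : ∀ i j k, ∀ x ∈ dom i ∩ dom j ∩ dom k, Ω i j x * Ω j k x = Ω i k x
  gauge : ∀ i j, ∀ x ∈ dom i ∩ dom j, ∀ δ α,
    ∑ β, sg (lev β) (Ω i j x δ β * T j x β α) =
      sg (lev δ) (M.Q (fun x' => Ω i j x' δ α) x) + ∑ β, sg (lev δ) (T i x δ β * Ω i j x β α)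

/-! ### Super-curves and homotopies -/

section Curves

variable {𝕜 : Type} [RCLike 𝕜] (L M : NQManifold 𝕜)

/-- A morphism of NQ-manifolds `T[1]I × L → M`, for a time domain `I ⊆ ℝ` (a super-curve
parametrized by the test manifold `L`).  It consists of the map `body` of bodies and the induced
homomorphisms `pull t y` from the fibre of functions of `M` over `body t y` to the fibre of
functions of `T[1]I × L` over `(t, y)`; the pull-back of a function `f` is
`(t, y) ↦ pull t y (f (body t y))`.  It carries functions to functions (`smooth`) and commutes with
the differentials `Q` of `M` and `D + d^y` of `T[1]I × L` (`dga`), where `D = θ ∂_t` and `d^y` is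
the homological vector field of `L`. -/
structure SuperCurve (I : Set ℝ) where
  body : ℝ → L.Body → M.Body
  pull : ℝ → L.Body → (M.Alg →ₐ[𝕜] OddExt 𝕜 L.Alg)
  cont : ContinuousOn (fun q : ℝ × L.Body => body q.1 q.2) (I ×ˢ univ)
  homog : ∀ t ∈ I, ∀ (y) (p : ℤ) (a : M.Alg), IsHomog 𝕜 p a → IsHomog 𝕜 p (pull t y a)
  smooth : ∀ (U : Set M.Body) (p : ℤ) (f : M.Body → M.Alg), IsOpen U → M.IsFn U p f →
    L.SmoothFam {q : ℝ × L.Body | q.1 ∈ I ∧ body q.1 q.2 ∈ U}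
      (fun t y => (pull t y (f (body t y))).fst) ∧
    L.SmoothFam {q : ℝ × L.Body | q.1 ∈ I ∧ body q.1 q.2 ∈ U}
      (fun t y => (pull t y (f (body t y))).snd)
  dga : ∀ (U : Set M.Body) (p : ℤ) (f : M.Body → M.Alg), IsOpen U → M.IsFn U p f →
    ∀ t ∈ I, ∀ y, body t y ∈ U →
      pull t y (M.Q f (body t y)) =
        ⟨L.Q (fun y' => (pull t y' (f (body t y'))).fst) y,
          dWithin 𝕜 I (fun t' => (pull t' y (f (body t' y))).fst) t -
            L.Q (fun y' => (pull t y' (f (body t y'))).snd) y⟩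

/-- A super-loop is a morphism `T[1]S¹ × L → M`, with `S¹ = ℝ/ℤ`. -/
structure SuperLoop extends SuperCurve L M univ where
  periodic_body : ∀ t y, body (t + 1) y = body t y
  periodic_pull : ∀ t y, pull (t + 1) y = pull t y

/-- The differential `d^y + d^s` on functions `h + ϑ k` of `L × T[1][0,1]`, with `d^s = ϑ ∂_s`. -/
def dys (F : ℝ → L.Body → OddExt 𝕜 L.Alg) (s : ℝ) (y : L.Body) : OddExt 𝕜 L.Alg :=
  ⟨L.Q (fun y' => (F s y').fst) y,
    dWithin 𝕜 (Icc 0 1) (fun s' => (F s' y).fst) s - L.Q (fun y' => (F s y').snd) y⟩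

/-- A homotopy of super-curves: a morphism of NQ-manifolds `T[1]I × L × T[1][0,1] → M`.  The
coordinates of the factors are `(t, θ)`, `y` and `(s, ϑ)`; the outer odd variable of
`OddExt 𝕜 (OddExt 𝕜 L.Alg)` is `θ`, the inner one is `ϑ`.  Setting `ϑ = 0` gives a family of
super-curves `𝒙(t, θ, y, s)`, and the part linear in `ϑ` is the field `x̄` that generates the
homotopy, `∂_s 𝒙 = ι_x̄ Q(𝒙) + (D + d^y) x̄`. -/
structure Homotopy (I : Set ℝ) where
  body : ℝ → ℝ → L.Body → M.Body
  pull : ℝ → ℝ → L.Body → (M.Alg →ₐ[𝕜] OddExt 𝕜 (OddExt 𝕜 L.Alg))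
  cont : ContinuousOn (fun q : (ℝ × ℝ) × L.Body => body q.1.1 q.1.2 q.2)
    ((I ×ˢ Icc 0 1) ×ˢ univ)
  homog : ∀ t ∈ I, ∀ s ∈ Icc (0 : ℝ) 1, ∀ (y) (p : ℤ) (a : M.Alg), IsHomog 𝕜 p a →
    IsHomog 𝕜 p (pull t s y a)
  smooth : ∀ (U : Set M.Body) (p : ℤ) (f : M.Body → M.Alg), IsOpen U → M.IsFn U p f →
    let W : Set ((ℝ × ℝ) × L.Body) :=
      {q | q.1.1 ∈ I ∧ q.1.2 ∈ Icc 0 1 ∧ body q.1.1 q.1.2 q.2 ∈ U}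
    let F : ℝ × ℝ → L.Body → OddExt 𝕜 (OddExt 𝕜 L.Alg) := fun ts y =>
      pull ts.1 ts.2 y (f (body ts.1 ts.2 y))
    L.SmoothFam W (fun ts y => (F ts y).fst.fst) ∧ L.SmoothFam W (fun ts y => (F ts y).fst.snd) ∧
    L.SmoothFam W (fun ts y => (F ts y).snd.fst) ∧ L.SmoothFam W (fun ts y => (F ts y).snd.snd)
  dga : ∀ (U : Set M.Body) (p : ℤ) (f : M.Body → M.Alg), IsOpen U → M.IsFn U p f →
    ∀ t ∈ I, ∀ s ∈ Icc (0 : ℝ) 1, ∀ y, body t s y ∈ U →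
      pull t s y (M.Q f (body t s y)) =
        ⟨dys L (fun s' y' => (pull t s' y' (f (body t s' y'))).fst) s y,
          dWithin 𝕜 I (fun t' => (pull t' s y (f (body t' s y))).fst) t -
            dys L (fun s' y' => (pull t s' y' (f (body t s' y'))).snd) s y⟩

variable {L M}

/-- A homotopy of super-loops: a morphism `T[1]S¹ × L × T[1][0,1] → M`. -/
def Homotopy.IsPeriodic (H : Homotopy L M univ) : Prop :=
  (∀ t s y, H.body (t + 1) s y = H.body t s y) ∧ ∀ t s y, H.pull (t + 1) s y = H.pull t s y

/-- The restriction of `H` to `s` and `ϑ = 0` is the super-loop `φ`. -/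
def Homotopy.RestrictsTo (H : Homotopy L M univ) (s : ℝ) (φ : SuperLoop L M) : Prop :=
  (∀ t y, H.body t s y = φ.body t y) ∧
  ∀ (t y) (p : ℤ) (a : M.Alg), IsHomog 𝕜 p a →
    (⟨(H.pull t s y a).fst.fst, (H.pull t s y a).snd.fst⟩ : OddExt 𝕜 L.Alg) = φ.pull t y a

/-- Homotopic super-loops, `s = 0` and `s = 1` of one homotopy `T[1]S¹ × L × T[1][0,1] → M`. -/
def SuperLoop.Homotopic (φ₀ φ₁ : SuperLoop L M) : Prop :=
  ∃ H : Homotopy L M univ, H.IsPeriodic ∧ H.RestrictsTo 0 φ₀ ∧ H.RestrictsTo 1 φ₁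

end Curves

/-! ### Wilson lines and Wilson loops -/

section Wilson

variable {𝕜 : Type} [RCLike 𝕜] {M : NQManifold 𝕜} (E : QBundle M)
  {R : Type} [Ring R] [Algebra 𝕜 R] [GrAlg 𝕜 R]

/-- A subdivision `0 = τ_0 ≤ τ_1 ≤ ⋯ ≤ τ_n = 1` with a patch `patch k` of the bundle for every
piece `[τ_k, τ_{k+1}]`. -/
structure Subdivision where
  n : ℕ
  τ : ℕ → ℝ
  patch : ℕ → E.Patch
  mono : ∀ k < n, τ k ≤ τ (k + 1)
  start : τ 0 = 0
  finish : τ n = 1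

variable {E}

/-- The first patch of the subdivision. -/
def Subdivision.first (P : Subdivision E) : E.Patch := P.patch 0

/-- The last patch of the subdivision. -/
def Subdivision.last (P : Subdivision E) : E.Patch := P.patch (P.n - 1)

/-- Every piece of the curve lies in its patch. -/
def Subdivision.Adapted (P : Subdivision E) (γ : ℝ → M.Body) : Prop :=
  ∀ k < P.n, ∀ t ∈ Icc (P.τ k) (P.τ (k + 1)), γ t ∈ E.dom (P.patch k)

variable (E)

/-- The matrix of superfields `𝑻 = T(𝒙(t, θ))` along a curve at `θ = 0`. -/
def T0 (i : E.Patch) (γ : ℝ → M.Body) (h : ℝ → (M.Alg →ₐ[𝕜] OddExt 𝕜 R)) (t : ℝ) :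
    Matrix (Fin E.rank) (Fin E.rank) R :=
  Matrix.of fun α β => (h t (E.T i (γ t) α β)).fst

/-- The `θ`-component `∂_θ 𝑻 |_{θ = 0}` along a curve, `∫ dθ 𝑻`. -/
def T1 (i : E.Patch) (γ : ℝ → M.Body) (h : ℝ → (M.Alg →ₐ[𝕜] OddExt 𝕜 R)) (t : ℝ) :
    Matrix (Fin E.rank) (Fin E.rank) R :=
  Matrix.of fun α β => (h t (E.T i (γ t) α β)).snd

/-- The transition matrix at the point `t`, `θ = 0` of a curve. -/
def Ω0 (i j : E.Patch) (γ : ℝ → M.Body) (h : ℝ → (M.Alg →ₐ[𝕜] OddExt 𝕜 R)) (t : ℝ) :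
    Matrix (Fin E.rank) (Fin E.rank) R :=
  Matrix.of fun α β => (h t (E.Ω i j (γ t) α β)).fst

variable {E}

/-- The Wilson line over the first `k` pieces of a subdivision: the local Wilson lines
`P exp (-∫ dt dθ 𝑻)` of the pieces, spliced together with the transition matrices. -/
def wilsonUpTo (P : Subdivision E) (γ : ℝ → M.Body) (h : ℝ → (M.Alg →ₐ[𝕜] OddExt 𝕜 R)) :
    ℕ → Matrix (Fin E.rank) (Fin E.rank) R
  | 0 => 1
  | k + 1 => pexp 𝕜 (T1 E (P.patch k) γ h) (P.τ (k + 1)) (P.τ k) *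
      Ω0 E (P.patch k) (P.patch (k - 1)) γ h (P.τ k) * wilsonUpTo P γ h k

/-- The matrix `U^α_β(1, 0)` of the Wilson line `U_C = ζ_α U^α_β(1, 0) ζ^β`. -/
def wilsonLine (P : Subdivision E) (γ : ℝ → M.Body) (h : ℝ → (M.Alg →ₐ[𝕜] OddExt 𝕜 R)) :
    Matrix (Fin E.rank) (Fin E.rank) R :=
  wilsonUpTo P γ h P.n

/-- The Wilson loop `∑_α (-1)^α U^α_α`; the transition matrix from the last to the first patch
(the identity if they are equal) closes the loop. -/
def wilsonLoop (P : Subdivision E) (γ : ℝ → M.Body) (h : ℝ → (M.Alg →ₐ[𝕜] OddExt 𝕜 R)) : R :=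
  ∑ α, sg (E.lev α) ((Ω0 E P.first P.last γ h 1 * wilsonLine P γ h) α α)

variable {L : NQManifold 𝕜}

/-- The Wilson line along a homotopy, computed for the test manifold `L × T[1][0,1]`.  It is
`U + ϑ ι_x̄ U`: its value at `ϑ = 0` is the Wilson line `U` of the super-curve at `s`, and its part
linear in `ϑ` is the first variation `ι_x̄ U`, where `ι_x̄ = x̄^A ∂/∂x^A` is the derivation that
replaces one superfield `𝒙^A` by `x̄^A`. -/
def Homotopy.line {I : Set ℝ} (H : Homotopy L M I) (P : Subdivision E) (s : ℝ) (y : L.Body) :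
    Matrix (Fin E.rank) (Fin E.rank) (OddExt 𝕜 L.Alg) :=
  wilsonLine P (fun t => H.body t s y) (fun t => H.pull t s y)

/-- `T(0) + ϑ ι_x̄ T(0)` over the initial point. -/
def Homotopy.Tinit {I : Set ℝ} (H : Homotopy L M I) (P : Subdivision E) (s : ℝ) (y : L.Body) :
    Matrix (Fin E.rank) (Fin E.rank) (OddExt 𝕜 L.Alg) :=
  T0 E P.first (fun t => H.body t s y) (fun t => H.pull t s y) 0

/-- `T(1) + ϑ ι_x̄ T(1)` over the final point. -/
def Homotopy.Tfin {I : Set ℝ} (H : Homotopy L M I) (P : Subdivision E) (s : ℝ) (y : L.Body) :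
    Matrix (Fin E.rank) (Fin E.rank) (OddExt 𝕜 L.Alg) :=
  T0 E P.last (fun t => H.body t s y) (fun t => H.pull t s y) 1

/-- The value of a function of `L × T[1][0,1]` at `ϑ = 0`. -/
def bot (X : Matrix (Fin E.rank) (Fin E.rank) (OddExt 𝕜 R)) :
    Matrix (Fin E.rank) (Fin E.rank) R := X.map OddExt.fst

/-- The operation `ι_x̄`: the part linear in `ϑ`. -/
def iot (X : Matrix (Fin E.rank) (Fin E.rank) (OddExt 𝕜 R)) :
    Matrix (Fin E.rank) (Fin E.rank) R := X.map OddExt.snd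

/-- The differential `d^y` on `ζ_α X^α_β ζ^β`, in terms of the matrix `X`, with
`d^y ζ_α = (-1)^β ζ_β A^β_α` and `d^y ζ^α = - B^α_β ζ^β` (where `A = T(1)`, `B = T(0)`). -/
def dEnd (A B : Matrix (Fin E.rank) (Fin E.rank) L.Alg)
    (X : L.Body → Matrix (Fin E.rank) (Fin E.rank) L.Alg) (y : L.Body) :
    Matrix (Fin E.rank) (Fin E.rank) L.Alg :=
  Matrix.of fun α β =>
    ∑ γ, sg (E.lev α) (A α γ * X y γ β) + sg (E.lev α) (L.Q (fun y' => X y' α β) y) -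
      ∑ γ, sg (E.lev α) (GrAlg.par (𝕜 := 𝕜) (X y α γ) * B γ β)

/-- `∂_s (ζ_α X^α_β ζ^β) = ζ_α Y^α_β ζ^β` at `s`, in terms of the matrices `X` and `Y`, with
`∂_s ζ_α = ζ_β A'^β_α` and `∂_s ζ^α = - B'^α_β ζ^β` (where `A' = ι_x̄ T(1)`, `B' = ι_x̄ T(0)`). -/
def HasDsEnd (A' B' : Matrix (Fin E.rank) (Fin E.rank) L.Alg)
    (X : ℝ → Matrix (Fin E.rank) (Fin E.rank) L.Alg)
    (Y : Matrix (Fin E.rank) (Fin E.rank) L.Alg) (s : ℝ) : Prop :=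
  ∀ α β, HasDWithin 𝕜 (fun s' => X s' α β) ((Y - A' * X s + X s * B') α β) (Icc 0 1) s

end Wilson

end NQ

end

/-! A homotopy with test manifold L is the same thing as a super-curve with the larger test manifold
L × T[1][0,1]. Everything therefore follows from one identity for the differential d = d^y + ϑ∂_s
(`dys`): if T = B + θA along the curve and par is the parity involution, then dU = -B(1)U +
par(U)B(0). Its ϑ-component is the formula for ∂_s U, and both forms of part 1 are this component
with signs arranged differently. `IsTransport` records the identity.

Within one patch the reason is an ODE argument. The pull-back intertwines Q with θ∂_t + d, so the
θ-component of QT = par(T)T, which is the condition that the lift of Q squares to zero, reads ∂_t B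
= dA - par(A)B + BA (`Homotopy.hasMD_B`). The path ordered exponential solves U' = -AU. Hence Y = dU
+ BU - par(U)B(0) solves Y' = -par(A)Y with Y = 0 at the start, and vanishes
(`LocalField.appM_pexp`, `dM_pexp`). A transition matrix satisfies an identity of the same shape
(`Homotopy.dM_Om`), and in a product the boundary terms at the common point cancel
(`IsTransport.mul`), so the identity holds for the spliced line (`IsTransport.line`).

For a loop the two boundary matrices coincide, and the supertrace of -BF + par(F)B is zero by graded
commutativity (`str_parM_mul`). Thus d kills the Wilson loop; its ϑ-coefficient has degree -1 and is
zero, and what remains is ∂_s U_O = 0 (`hasDWithin_loop`).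

To integrate this over s one has to change patches. That is not an identity between matrices: since
Ω has a θ-component, Ω(b)U_i - U_jΩ(a) vanishes only up to a twisted exact term built from a matrix
Z (`exists_patch_homotopy`). This Z is the off-diagonal block of the path ordered exponential of the
block triangular "mapping cone" of Ω, so the formula for dZ is again `dM_pexp`. Inside the
supertrace of a closed transport the exact term is d of something of degree -1, hence zero, and the
twisting terms form a graded commutator (`str_patch`). Repeating this piece by piece compares two
subdivisions (`str_lineTo`, `loop_eq_loop`). The loop computed with any adapted subdivision at each
s then has zero derivative on [0,1] and is constant.

The analysis is made finite-dimensional by grading: a coefficient of degree at most D of a product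
involves only finitely many coefficients of degree at most D of the factors. After truncation U' =
-AU is a Volterra equation with a convergent Neumann series. Smooth dependence on parameters, and
the interchange of ∂_t with parameter derivatives, come from smoothness of operator inversion and of
p ↦ A(·, p) as a map into C([a,b]) (`exists_linear_ode`, `smoothOn_pexp_and_hasDWithin_pdir`). -/

noncomputable section

namespace NQ

/-! ### Graded algebras with finite-dimensional homogeneous components -/

/-- Every degree occurs finitely often, the product is given by finite structure constants that
respect degrees, and the algebra is graded commutative. -/
class FinGr (𝕜 : Type) [RCLike 𝕜] (R : Type) [Ring R] [Algebra 𝕜 R] [GrAlg 𝕜 R] : Prop where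
  finite_deg : ∀ D : ℕ, {i : GrAlg.Idx 𝕜 R | GrAlg.deg (𝕜 := 𝕜) (R := R) i ≤ D}.Finite
  mul_coeff : ∀ i : GrAlg.Idx 𝕜 R, ∃ (κ : Type) (_ : Fintype κ) (j k : κ → GrAlg.Idx 𝕜 R)
    (c : κ → 𝕜), (∀ l, GrAlg.deg (𝕜 := 𝕜) (R := R) (j l) + GrAlg.deg (𝕜 := 𝕜) (R := R) (k l) =
      GrAlg.deg (𝕜 := 𝕜) (R := R) i) ∧
    ∀ x y : R, GrAlg.coeff (𝕜 := 𝕜) (x * y) i =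
      ∑ l, c l * (GrAlg.coeff (𝕜 := 𝕜) x (j l) * GrAlg.coeff (𝕜 := 𝕜) y (k l))
  one_homog : IsHomog 𝕜 0 (1 : R)
  comm : ∀ (p q : ℤ) (x y : R), IsHomog 𝕜 p x → IsHomog 𝕜 q y →
    x * y = (p * q).negOnePow • (y * x)

section Basic

variable (𝕜 : Type) [RCLike 𝕜] {R : Type} [Ring R] [Algebra 𝕜 R] [GrAlg 𝕜 R]

/-- The coefficient of `a` at `i`. -/
abbrev cf (a : R) (i : GrAlg.Idx 𝕜 R) : 𝕜 := GrAlg.coeff (𝕜 := 𝕜) a i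

variable {𝕜}

theorem cf_ext {a b : R} (h : ∀ i, cf 𝕜 a i = cf 𝕜 b i) : a = b :=
  (GrAlg.coeff (𝕜 := 𝕜)).injective (funext h)

theorem cf_symm (c : GrAlg.Idx 𝕜 R → 𝕜) (i) :
    cf 𝕜 ((GrAlg.coeff (𝕜 := 𝕜) (R := R)).symm c) i = c i := by
  simp [cf]

@[simp] theorem cf_zero (i) : cf 𝕜 (0 : R) i = 0 := by simp [cf]
@[simp] theorem cf_add (a b : R) (i) : cf 𝕜 (a + b) i = cf 𝕜 a i + cf 𝕜 b i := by simp [cf]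
@[simp] theorem cf_sub (a b : R) (i) : cf 𝕜 (a - b) i = cf 𝕜 a i - cf 𝕜 b i := by simp [cf]
@[simp] theorem cf_neg (a : R) (i) : cf 𝕜 (-a) i = -cf 𝕜 a i := by simp [cf]
@[simp] theorem cf_smul (c : 𝕜) (a : R) (i) : cf 𝕜 (c • a) i = c * cf 𝕜 a i := by simp [cf]
theorem cf_sum {ι : Type*} (s : Finset ι) (f : ι → R) (i) :
    cf 𝕜 (∑ k ∈ s, f k) i = ∑ k ∈ s, cf 𝕜 (f k) i := by simp [cf]

theorem cf_par (a : R) (i) :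
    cf 𝕜 (GrAlg.par (𝕜 := 𝕜) a) i = (-1) ^ GrAlg.deg (𝕜 := 𝕜) i * cf 𝕜 a i :=
  GrAlg.coeff_par a i

/-- Either sign acts as `±1`. -/
theorem sg_cases (n : ℤ) : (∀ {A : Type} [AddCommGroup A] (a : A), sg n a = a) ∨
    (∀ {A : Type} [AddCommGroup A] (a : A), sg n a = -a) := by
  rcases Int.even_or_odd n with h | h
  · left; intro A _ a; simp [sg, Int.negOnePow_even n h]
  · right; intro A _ a; simp [sg, Int.negOnePow_odd n h]

section sg
variable {A B : Type} [AddCommGroup A] [AddCommGroup B]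
theorem sg_add (n : ℤ) (a b : A) : sg n (a + b) = sg n a + sg n b := smul_add _ _ _
theorem sg_neg (n : ℤ) (a : A) : sg n (-a) = -sg n a := smul_neg _ _
theorem sg_sub (n : ℤ) (a b : A) : sg n (a - b) = sg n a - sg n b := smul_sub _ _ _
theorem sg_sum {ι : Type*} (n : ℤ) (s : Finset ι) (f : ι → A) :
    sg n (∑ k ∈ s, f k) = ∑ k ∈ s, sg n (f k) := Finset.smul_sum
theorem sg_sg (m n : ℤ) (a : A) : sg m (sg n a) = sg (m + n) a := by
  simp [sg, smul_smul, Int.negOnePow_add]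
theorem sg_self (n : ℤ) (a : A) : sg n (sg n a) = a := by
  rcases sg_cases n with h | h <;> simp only [h, neg_neg]
theorem sg_zero (n : ℤ) : sg n (0 : A) = 0 := smul_zero _
theorem sg_even {n : ℤ} (h : Even n) (a : A) : sg n a = a := by simp [sg, Int.negOnePow_even n h]
theorem sg_odd {n : ℤ} (h : Odd n) (a : A) : sg n a = -a := by simp [sg, Int.negOnePow_odd n h]
theorem map_sg {F : Type*} [FunLike F A B] [AddMonoidHomClass F A B] (f : F) (n : ℤ) (a : A) :
    f (sg n a) = sg n (f a) := by
  rcases sg_cases n with h | h <;> simp only [h, map_neg]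
theorem sg_congr {m n : ℤ} (h : Even (m - n)) (a : A) : sg m a = sg n a := by
  have : m = n + (m - n) := by ring
  rw [this, ← sg_sg, sg_even h]
theorem sg_succ (n : ℤ) (a : A) : sg (n + 1) a = -sg n a := by
  rw [add_comm, ← sg_sg, sg_odd odd_one]
end sg

theorem sg_mul (n : ℤ) (a b : R) : sg n a * b = sg n (a * b) := by
  rcases sg_cases n with h | h <;> simp only [h, neg_mul]
theorem mul_sg (n : ℤ) (a b : R) : a * sg n b = sg n (a * b) := by
  rcases sg_cases n with h | h <;> simp only [h, mul_neg]
theorem cf_sg (n : ℤ) (a : R) (i) : cf 𝕜 (sg n a) i = sg n (cf 𝕜 a i) := by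
  rcases sg_cases n with h | h <;> simp only [h, cf_neg]

namespace IsHomog

variable {p q : ℤ} {a b : R}

theorem cf_eq_zero (h : IsHomog 𝕜 p a) {i} (hi : (GrAlg.deg (𝕜 := 𝕜) i : ℤ) ≠ p) :
    cf 𝕜 a i = 0 := by
  by_contra h'; exact hi (h i h')

theorem zero : IsHomog 𝕜 p (0 : R) := fun i h => absurd (cf_zero (𝕜 := 𝕜) i) h

theorem add (ha : IsHomog 𝕜 p a) (hb : IsHomog 𝕜 p b) : IsHomog 𝕜 p (a + b) := by
  intro i h
  by_contra hi
  exact h (by rw [← cf, cf_add, ha.cf_eq_zero hi, hb.cf_eq_zero hi, add_zero])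

theorem neg (ha : IsHomog 𝕜 p a) : IsHomog 𝕜 p (-a) := by
  intro i h
  by_contra hi
  exact h (by rw [← cf, cf_neg, ha.cf_eq_zero hi, neg_zero])

theorem sgn (n : ℤ) (ha : IsHomog 𝕜 p a) : IsHomog 𝕜 p (sg n a) := by
  rcases sg_cases n with h | h <;> simp only [h]
  exacts [ha, ha.neg]

theorem sum {ι : Type*} {s : Finset ι} {f : ι → R} (h : ∀ k ∈ s, IsHomog 𝕜 p (f k)) :
    IsHomog 𝕜 p (∑ k ∈ s, f k) :=
  Finset.sum_induction f (IsHomog 𝕜 p) (fun _ _ => add) zero h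

theorem par_eq (ha : IsHomog 𝕜 p a) : GrAlg.par (𝕜 := 𝕜) a = sg p a := by
  refine cf_ext (𝕜 := 𝕜) fun i => ?_
  rw [cf_par, cf_sg]
  by_cases hi : (GrAlg.deg (𝕜 := 𝕜) i : ℤ) = p
  · rw [← hi, sg, Int.negOnePow_def]
    rcases Nat.even_or_odd (GrAlg.deg (𝕜 := 𝕜) (R := R) i) with h | h <;>
      simp [h.neg_one_pow]
  · rw [ha.cf_eq_zero hi, sg_zero, mul_zero]

theorem par (ha : IsHomog 𝕜 p a) : IsHomog 𝕜 p (GrAlg.par (𝕜 := 𝕜) a) := by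
  rw [ha.par_eq]; exact ha.sgn p

theorem eq_zero_of_neg (ha : IsHomog 𝕜 p a) (hp : p < 0) : a = 0 :=
  cf_ext (𝕜 := 𝕜) fun i => by rw [ha.cf_eq_zero (by omega), cf_zero]

theorem mul [FinGr 𝕜 R] (ha : IsHomog 𝕜 p a) (hb : IsHomog 𝕜 q b) : IsHomog 𝕜 (p + q) (a * b) := by
  intro i h
  by_contra hi
  apply h
  obtain ⟨κ, _, j, k, c, hd, hc⟩ := FinGr.mul_coeff (𝕜 := 𝕜) (R := R) i
  rw [hc]
  refine Finset.sum_eq_zero fun l _ => ?_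
  by_cases hj : (GrAlg.deg (𝕜 := 𝕜) (j l) : ℤ) = p
  · have : cf 𝕜 b (k l) = 0 := hb.cf_eq_zero (by have := hd l; omega)
    simp only [cf] at this; rw [this]; simp
  · have : cf 𝕜 a (j l) = 0 := ha.cf_eq_zero hj
    simp only [cf] at this; rw [this]; simp

theorem congr (ha : IsHomog 𝕜 p a) (h : p = q) : IsHomog 𝕜 q a := h ▸ ha

end IsHomog

/-- The basis element of index `i`. -/
def bas (𝕜 : Type) [RCLike 𝕜] {R : Type} [Ring R] [Algebra 𝕜 R] [GrAlg 𝕜 R]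
    (i : GrAlg.Idx 𝕜 R) : R :=
  open Classical in (GrAlg.coeff (𝕜 := 𝕜)).symm (Pi.single i 1)

theorem cf_bas (i j : GrAlg.Idx 𝕜 R) [Decidable (j = i)] :
    cf 𝕜 (bas 𝕜 i : R) j = if j = i then 1 else 0 := by
  classical
  rw [bas, cf_symm, Pi.single_apply]
  congr

/-- The indices of degree `p`. -/
def degSet [FinGr 𝕜 R] (p : ℤ) : Finset (GrAlg.Idx 𝕜 R) :=
  open Classical in
  (FinGr.finite_deg (𝕜 := 𝕜) (R := R) p.toNat).toFinset.filter
    fun i => (GrAlg.deg (𝕜 := 𝕜) i : ℤ) = p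

theorem mem_degSet [FinGr 𝕜 R] {p : ℤ} {i : GrAlg.Idx 𝕜 R} :
    i ∈ degSet (𝕜 := 𝕜) (R := R) p ↔ (GrAlg.deg (𝕜 := 𝕜) i : ℤ) = p := by
  classical
  simp only [degSet, Finset.mem_filter, Set.Finite.mem_toFinset, Set.mem_ofPred_eq,
    and_iff_right_iff_imp]
  intro h; omega

theorem IsHomog.eq_sum [FinGr 𝕜 R] {p : ℤ} {a : R} (ha : IsHomog 𝕜 p a) :
    a = ∑ i ∈ degSet (𝕜 := 𝕜) (R := R) p, cf 𝕜 a i • bas 𝕜 i := by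
  classical
  refine cf_ext (𝕜 := 𝕜) fun i => ?_
  rw [cf_sum]
  simp only [cf_smul, cf_bas, mul_ite, mul_one, mul_zero]
  rw [Finset.sum_ite_eq]
  split_ifs with h
  · rfl
  · exact ha.cf_eq_zero fun h' => h (mem_degSet.2 h')

/-- Elements are arbitrary coefficient families and `φ` carries no continuity, so in general its
coefficients are not determined by finitely many coefficients of the argument. On a homogeneous
element they are, because there are finitely many indices of each degree. Every interchange of a
linear map with a limit rests on this. -/
theorem IsHomog.cf_map [FinGr 𝕜 R] {R' : Type} [Ring R'] [Algebra 𝕜 R'] [GrAlg 𝕜 R']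
    {p : ℤ} {a : R} (ha : IsHomog 𝕜 p a) (φ : R →ₗ[𝕜] R') (i) :
    cf 𝕜 (φ a) i = ∑ j ∈ degSet (𝕜 := 𝕜) (R := R) p, cf 𝕜 a j * cf 𝕜 (φ (bas 𝕜 j)) i := by
  conv_lhs => rw [ha.eq_sum]
  rw [map_sum, cf_sum]
  simp

end Basic

/-! ### Coefficientwise derivatives -/

section Deriv

variable {𝕜 : Type} [RCLike 𝕜] {R : Type} [Ring R] [Algebra 𝕜 R] [GrAlg 𝕜 R]
  {f g : ℝ → R} {f' g' : R} {S : Set ℝ} {t : ℝ}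

namespace HasDWithin

theorem const (a : R) : HasDWithin 𝕜 (fun _ => a) 0 S t := by
  intro i
  have := hasDerivWithinAt_const t S (cf 𝕜 a i)
  rwa [← cf, cf_zero]

theorem add (hf : HasDWithin 𝕜 f f' S t) (hg : HasDWithin 𝕜 g g' S t) :
    HasDWithin 𝕜 (fun u => f u + g u) (f' + g') S t := by
  intro i
  exact ((hf i).fun_add (hg i)).congr_deriv (cf_add f' g' i).symm |>.congr (fun _ _ => cf_add _ _ _) (cf_add _ _ _)

theorem neg (hf : HasDWithin 𝕜 f f' S t) : HasDWithin 𝕜 (fun u => -f u) (-f') S t := by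
  intro i
  exact ((hf i).fun_neg).congr_deriv (cf_neg f' i).symm |>.congr (fun _ _ => cf_neg _ _) (cf_neg _ _)

theorem sub (hf : HasDWithin 𝕜 f f' S t) (hg : HasDWithin 𝕜 g g' S t) :
    HasDWithin 𝕜 (fun u => f u - g u) (f' - g') S t := by
  intro i
  exact ((hf i).fun_sub (hg i)).congr_deriv (cf_sub f' g' i).symm |>.congr (fun _ _ => cf_sub _ _ _) (cf_sub _ _ _)

theorem sgn (n : ℤ) (hf : HasDWithin 𝕜 f f' S t) :
    HasDWithin 𝕜 (fun u => sg n (f u)) (sg n f') S t := by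
  rcases sg_cases n with h | h <;> simp only [h]
  exacts [hf, hf.neg]

theorem sum {ι : Type*} {s : Finset ι} {f : ι → ℝ → R} {f' : ι → R}
    (h : ∀ k ∈ s, HasDWithin 𝕜 (f k) (f' k) S t) :
    HasDWithin 𝕜 (fun u => ∑ k ∈ s, f k u) (∑ k ∈ s, f' k) S t := by
  classical
  induction s using Finset.induction_on with
  | empty => simpa using const (0 : R)
  | insert a s ha ih =>
    simp only [Finset.sum_insert ha]
    exact (h a (by simp)).add (ih fun k hk => h k (by simp [hk]))

theorem mul [FinGr 𝕜 R] (hf : HasDWithin 𝕜 f f' S t) (hg : HasDWithin 𝕜 g g' S t) :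
    HasDWithin 𝕜 (fun u => f u * g u) (f' * g t + f t * g') S t := by
  intro i
  obtain ⟨κ, _, j, k, c, -, hc⟩ := FinGr.mul_coeff (𝕜 := 𝕜) (R := R) i
  simp only [hc, map_add, Pi.add_apply]
  rw [← Finset.sum_add_distrib]
  refine (HasDerivWithinAt.fun_sum (u := Finset.univ) fun l _ =>
    ((hf (j l)).mul (hg (k l))).const_mul (c l)).congr_deriv ?_
  exact Finset.sum_congr rfl fun l _ => by ring

theorem const_mul [FinGr 𝕜 R] (a : R) (hf : HasDWithin 𝕜 f f' S t) :
    HasDWithin 𝕜 (fun u => a * f u) (a * f') S t := by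
  simpa using (const (S := S) (t := t) a).mul hf

theorem mul_const [FinGr 𝕜 R] (a : R) (hf : HasDWithin 𝕜 f f' S t) :
    HasDWithin 𝕜 (fun u => f u * a) (f' * a) S t := by
  simpa using hf.mul (const (S := S) (t := t) a)

theorem mono {S' : Set ℝ} (hf : HasDWithin 𝕜 f f' S t) (h : S' ⊆ S) : HasDWithin 𝕜 f f' S' t :=
  fun i => (hf i).mono h

theorem congr_deriv (hf : HasDWithin 𝕜 f f' S t) (h : f' = g') : HasDWithin 𝕜 f g' S t := h ▸ hf

theorem par (hf : HasDWithin 𝕜 f f' S t) :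
    HasDWithin 𝕜 (fun u => GrAlg.par (𝕜 := 𝕜) (f u)) (GrAlg.par (𝕜 := 𝕜) f') S t := by
  intro i
  simp only [GrAlg.coeff_par]
  exact (hf i).const_mul _

/-- Derivatives of homogeneous functions are homogeneous. -/
theorem homog {p : ℤ} (hf : HasDWithin 𝕜 f f' S t) (hS : UniqueDiffWithinAt ℝ S t)
    (h : ∀ u ∈ S, IsHomog 𝕜 p (f u)) (ht : t ∈ S) : IsHomog 𝕜 p f' := by
  intro i hi
  by_contra hp
  apply hi
  refine hS.eq_deriv _ (hf i) ((hasDerivWithinAt_const t S (0 : 𝕜)).congr ?_ ?_)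
  · intro u hu; exact (h u hu).cf_eq_zero hp
  · exact (h t ht).cf_eq_zero hp

/-- Homogeneity replaces continuity of `φ`: on a fixed degree `φ` is a finite matrix with constant
entries. The lemma is applied to frames and to the derivations inside a vector field. -/
theorem map [FinGr 𝕜 R] {R' : Type} [Ring R'] [Algebra 𝕜 R'] [GrAlg 𝕜 R'] {p : ℤ}
    (φ : R →ₗ[𝕜] R') (hf : HasDWithin 𝕜 f f' S t) (h : ∀ u ∈ S, IsHomog 𝕜 p (f u))
    (ht : t ∈ S) (h' : IsHomog 𝕜 p f') : HasDWithin 𝕜 (fun u => φ (f u)) (φ f') S t := by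
  intro i
  rw [← cf, h'.cf_map φ i]
  refine (HasDerivWithinAt.fun_sum (u := degSet (𝕜 := 𝕜) (R := R) p) fun j _ =>
    (hf j).mul_const (cf 𝕜 (φ (bas 𝕜 j)) i)).congr ?_ ?_
  · intro u hu; exact (h u hu).cf_map φ i
  · exact (h t ht).cf_map φ i

end HasDWithin

end Deriv

/-! ### The instances -/

section Instances

variable {r : ℕ} {𝕜 : Type} [RCLike 𝕜] {d : Fin r → ℕ}

/-- All pairs of indices (i, j) are split into j < i, j > i and j = i. The diagonal sum is the only
obstruction to the sign rule for exchanging two monomials. -/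
theorem signExp_comm (a b : Fin r →₀ ℕ) :
    signExp d a b + signExp d b a + ∑ i, a i * b i * (d i * d i) = wt d a * wt d b := by
  have h1 : signExp d b a = ∑ i, ∑ j ∈ Finset.univ.filter (fun j => i < j),
      (a i * d i) * (b j * d j) := by
    unfold signExp
    simp only [Finset.sum_filter]
    rw [Finset.sum_comm]
    exact Finset.sum_congr rfl fun i _ => Finset.sum_congr rfl fun j _ => by
      split_ifs <;> ring
  rw [h1, signExp, wt, wt, Finset.sum_mul_sum, ← Finset.sum_add_distrib, ← Finset.sum_add_distrib]
  refine Finset.sum_congr rfl fun i _ => ?_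
  simp only [Finset.sum_filter]
  have h2 : a i * b i * (d i * d i) = ∑ j, if j = i then (a i * d i) * (b j * d j) else 0 := by
    simp; ring
  rw [h2, ← Finset.sum_add_distrib, ← Finset.sum_add_distrib]
  refine Finset.sum_congr rfl fun j _ => ?_
  rcases lt_trichotomy j i with h | h | h
  · simp [h, h.ne, h.not_gt]
  · simp [h]
  · simp [h, h.ne', h.not_gt]

/-- The diagonal sum is even: generators of even degree contribute even terms, and an odd generator
cannot occur in both monomials when their product is admissible. -/
theorem neg_one_pow_signExp {a b : Fin r →₀ ℕ} (h : Adm d (a + b)) :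
    (-1 : 𝕜) ^ signExp d a b = (-1) ^ (wt d a * wt d b) * (-1) ^ signExp d b a := by
  rw [← signExp_comm, pow_add, pow_add]
  have : Even (∑ i, a i * b i * (d i * d i)) := by
    refine Finset.even_sum _ fun i _ => ?_
    rcases Nat.even_or_odd (d i) with hd | hd
    · exact (hd.mul_right _).mul_left _
    · have h1 := h i hd
      rw [Finsupp.add_apply] at h1
      have : a i * b i = 0 := by
        rcases Nat.eq_zero_or_pos (a i) with h2 | h2
        · simp [h2]
        · have : b i = 0 := by omega
          simp [this]
      simp [this]
  rw [this.neg_one_pow, mul_one, mul_assoc, ← mul_pow]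
  simp

theorem Gca.adm_left {m : Mon d} (l : {p // p ∈ Finset.HasAntidiagonal.antidiagonal m.1}) :
    Adm d l.1.1 ∧ Adm d l.1.2 := by
  have h := Finset.HasAntidiagonal.mem_antidiagonal.1 l.2
  exact Gca.adm_of_add (by rw [h]; exact m.2)

theorem Gca.cf_mul (x y : Gca 𝕜 d) (m : Mon d) : (x * y) m =
    ∑ l : {p // p ∈ Finset.HasAntidiagonal.antidiagonal m.1},
      (-1) ^ signExp d l.1.1 l.1.2 *
        (x ⟨l.1.1, (Gca.adm_left l).1⟩ * y ⟨l.1.2, (Gca.adm_left l).2⟩) := by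
  rw [Gca.mul_apply, ← Finset.sum_coe_sort]
  refine Finset.sum_congr rfl fun l _ => ?_
  rw [Gca.ex, Gca.ex, dif_pos (Gca.adm_left l).1, dif_pos (Gca.adm_left l).2]

theorem Gca.ex_eq_zero {p : ℤ} {x : Gca 𝕜 d} (hx : IsHomog 𝕜 p x) {a : Fin r →₀ ℕ}
    (h : (wt d a : ℤ) ≠ p) : Gca.ex x a = 0 := by
  unfold Gca.ex
  split_ifs with h'
  · exact hx.cf_eq_zero (i := (⟨a, h'⟩ : Mon d)) h
  · rfl

theorem sg_natCast_mul (m n : ℕ) (z : 𝕜) : sg ((m : ℤ) * n) z = (-1) ^ (m * n) * z := by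
  rcases Nat.even_or_odd (m * n) with h | h
  · rw [sg_even (by exact_mod_cast h), h.neg_one_pow, one_mul]
  · rw [sg_odd (by exact_mod_cast h), h.neg_one_pow, neg_one_mul]

/-- Positivity of the degrees bounds every exponent of a monomial by its total degree, so each
degree has finitely many monomials. Graded commutativity is obtained by swapping the two entries of
the antidiagonal. -/
theorem Gca.finGr (hd : ∀ j, 0 < d j) : FinGr 𝕜 (Gca 𝕜 d) where
  finite_deg D := by
    have : {i : Mon d | wt d i.1 ≤ D} ⊆ Subtype.val ⁻¹'
        (Set.Iic (Finsupp.equivFunOnFinite.symm fun _ : Fin r => D)) := by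
      intro m hm j
      have h1 : m.1 j * d j ≤ wt d m.1 :=
        Finset.single_le_sum (f := fun j => m.1 j * d j) (fun _ _ => Nat.zero_le _)
          (Finset.mem_univ j)
      have h2 : m.1 j ≤ m.1 j * d j := Nat.le_mul_of_pos_right _ (hd j)
      exact h2.trans (h1.trans hm)
    exact ((Set.finite_Iic _).preimage Subtype.val_injective.injOn).subset this
  mul_coeff m := by
    refine ⟨{p // p ∈ Finset.HasAntidiagonal.antidiagonal m.1}, inferInstance,
      fun l => (⟨l.1.1, (Gca.adm_left l).1⟩ : Mon d), fun l => (⟨l.1.2, (Gca.adm_left l).2⟩ : Mon d),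
      fun l => (-1) ^ signExp d l.1.1 l.1.2, ?_,
      fun x y => Gca.cf_mul x y m⟩
    rintro ⟨l, hl⟩
    change wt d l.1 + wt d l.2 = wt d m.1
    rw [← Gca.wt_add, Finset.HasAntidiagonal.mem_antidiagonal.1 hl]
  one_homog := by
    intro m hm
    change wt d m.1 = (0 : ℤ)
    have : m.1 = 0 := by
      by_contra h
      exact hm (if_neg h)
    simp [this, wt]
  comm p q x y hx hy := by
    refine cf_ext (𝕜 := 𝕜) fun m => ?_
    change cf 𝕜 (x * y) m = cf 𝕜 (sg (p * q) (y * x)) m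
    rw [cf_sg]
    change (x * y) m = sg (p * q) ((y * x) m)
    rw [Gca.mul_apply, Gca.mul_apply, sg_sum]
    refine Finset.sum_nbij' Prod.swap Prod.swap ?_ ?_ (fun _ _ => rfl) (fun _ _ => rfl) ?_
    · rintro ⟨a, b⟩ h
      simpa [add_comm] using h
    · rintro ⟨a, b⟩ h
      simpa [add_comm] using h
    rintro ⟨a, b⟩ hab
    rw [Finset.HasAntidiagonal.mem_antidiagonal] at hab
    simp only [Prod.fst_swap, Prod.snd_swap]
    by_cases ha : (wt d a : ℤ) = p
    · by_cases hb : (wt d b : ℤ) = q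
      · rw [← ha, ← hb, sg_natCast_mul,
          neg_one_pow_signExp (a := a) (b := b) (hab ▸ m.2)]
        ring
      · simp [Gca.ex_eq_zero hy hb, sg_zero]
    · simp [Gca.ex_eq_zero hx ha, sg_zero]

instance (L : NManifold 𝕜) : FinGr 𝕜 (Gca 𝕜 L.deg) := Gca.finGr L.deg_pos

variable {R : Type} [Ring R] [Algebra 𝕜 R] [GrAlg 𝕜 R]

theorem cf_inl (x : OddExt 𝕜 R) (i : GrAlg.Idx 𝕜 R) :
    cf 𝕜 x (Sum.inl i : GrAlg.Idx 𝕜 (OddExt 𝕜 R)) = cf 𝕜 x.fst i := rfl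

theorem cf_inr (x : OddExt 𝕜 R) (i : GrAlg.Idx 𝕜 R) :
    cf 𝕜 x (Sum.inr i : GrAlg.Idx 𝕜 (OddExt 𝕜 R)) = cf 𝕜 x.snd i := rfl

@[simp] theorem OddExt.fst_par (x : OddExt 𝕜 R) :
    (GrAlg.par (𝕜 := 𝕜) x).fst = GrAlg.par (𝕜 := 𝕜) x.fst := rfl

@[simp] theorem OddExt.snd_par (x : OddExt 𝕜 R) :
    (GrAlg.par (𝕜 := 𝕜) x).snd = -GrAlg.par (𝕜 := 𝕜) x.snd := rfl

theorem OddExt.isHomog_iff {p : ℤ} {x : OddExt 𝕜 R} :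
    IsHomog 𝕜 p x ↔ IsHomog 𝕜 p x.fst ∧ IsHomog 𝕜 (p - 1) x.snd := by
  constructor
  · intro h
    refine ⟨fun i hi => h (Sum.inl i) hi, fun i hi => ?_⟩
    have : ((GrAlg.deg (𝕜 := 𝕜) (R := R) i + 1 : ℕ) : ℤ) = p := h (Sum.inr i) hi
    omega
  · rintro ⟨h1, h2⟩ (i | i) hi
    · exact h1 i hi
    · have : (GrAlg.deg (𝕜 := 𝕜) (R := R) i : ℤ) = p - 1 := h2 i hi
      change ((GrAlg.deg (𝕜 := 𝕜) (R := R) i + 1 : ℕ) : ℤ) = p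
      omega

@[simp] theorem OddExt.fst_sub (x y : OddExt 𝕜 R) : (x - y).fst = x.fst - y.fst := by
  rw [sub_eq_add_neg, OddExt.fst_add, OddExt.fst_neg, sub_eq_add_neg]

@[simp] theorem OddExt.snd_sub (x y : OddExt 𝕜 R) : (x - y).snd = x.snd - y.snd := by
  rw [sub_eq_add_neg, OddExt.snd_add, OddExt.snd_neg, sub_eq_add_neg]

theorem OddExt.fst_sg (n : ℤ) (x : OddExt 𝕜 R) : (sg n x).fst = sg n x.fst := by
  rcases sg_cases n with h | h <;> simp [h]

theorem OddExt.snd_sg (n : ℤ) (x : OddExt 𝕜 R) : (sg n x).snd = sg n x.snd := by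
  rcases sg_cases n with h | h <;> simp [h]

instance [FinGr 𝕜 R] : FinGr 𝕜 (OddExt 𝕜 R) where
  finite_deg D := by
    have h := FinGr.finite_deg (𝕜 := 𝕜) (R := R) D
    refine ((h.image Sum.inl).union (h.image Sum.inr)).subset ?_
    rintro (i | i) hi
    · exact Or.inl ⟨i, hi, rfl⟩
    · exact Or.inr ⟨i, (Nat.le_succ _).trans hi, rfl⟩
  mul_coeff := by
    rintro (i | i)
    · obtain ⟨κ, _, j, k, c, hd, hc⟩ := FinGr.mul_coeff (𝕜 := 𝕜) (R := R) i
      exact ⟨κ, inferInstance, fun l => Sum.inl (j l), fun l => Sum.inl (k l), c, hd,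
        fun x y => hc x.fst y.fst⟩
    · obtain ⟨κ, _, j, k, c, hd, hc⟩ := FinGr.mul_coeff (𝕜 := 𝕜) (R := R) i
      -- The θ-coefficient of a product has two contributions, according to which factor supplies θ.
      -- If it is the second factor, θ has to pass the first one, which produces the sign.
      refine ⟨κ ⊕ κ, inferInstance,
        Sum.elim (fun l => Sum.inr (j l)) (fun l => Sum.inl (j l)),
        Sum.elim (fun l => Sum.inl (k l)) (fun l => Sum.inr (k l)),
        Sum.elim c (fun l => c l * (-1) ^ GrAlg.deg (𝕜 := 𝕜) (R := R) (j l)), ?_, ?_⟩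
      · have hd' : ∀ l, GrAlg.deg (𝕜 := 𝕜) (R := R) (j l) + GrAlg.deg (𝕜 := 𝕜) (R := R) (k l) =
          GrAlg.deg (𝕜 := 𝕜) (R := R) i := hd
        rintro (l | l)
        · change GrAlg.deg (𝕜 := 𝕜) (R := R) (j l) + 1 + GrAlg.deg (𝕜 := 𝕜) (R := R) (k l) =
            GrAlg.deg (𝕜 := 𝕜) (R := R) i + 1
          have := hd' l; omega
        · change GrAlg.deg (𝕜 := 𝕜) (R := R) (j l) + (GrAlg.deg (𝕜 := 𝕜) (R := R) (k l) + 1) =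
            GrAlg.deg (𝕜 := 𝕜) (R := R) i + 1
          have := hd' l; omega
      · intro x y
        change cf 𝕜 (x * y).snd i = _
        rw [OddExt.snd_mul, cf_add, cf, cf, hc, hc, Fintype.sum_sum_type]
        congr 1
        refine Finset.sum_congr rfl fun l _ => ?_
        simp only [Sum.elim_inr, GrAlg.coeff_par]
        rw [mul_assoc (c l), mul_assoc ((-1 : 𝕜) ^ _)]
        rfl
  one_homog := OddExt.isHomog_iff.2 ⟨FinGr.one_homog, IsHomog.zero⟩
  comm p q x y hx hy := by
    obtain ⟨hx0, hx1⟩ := OddExt.isHomog_iff.1 hx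
    obtain ⟨hy0, hy1⟩ := OddExt.isHomog_iff.1 hy
    change x * y = sg (p * q) (y * x)
    ext
    · rw [OddExt.fst_sg]; exact FinGr.comm p q _ _ hx0 hy0
    · rw [OddExt.snd_sg, OddExt.snd_mul, OddExt.snd_mul, hx0.par_eq, hy0.par_eq, sg_mul, sg_mul,
        FinGr.comm (𝕜 := 𝕜) _ _ _ _ hx1 hy0, FinGr.comm (𝕜 := 𝕜) _ _ _ _ hx0 hy1, sg_add,
        add_comm]
      congr 1
      · change sg p (sg (p * (q - 1)) _) = _
        rw [sg_sg]; congr 2; ring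
      · change sg ((p - 1) * q) _ = _
        rw [sg_sg]
        exact sg_congr ⟨-q, by ring⟩ _

end Instances

/-! ### Linear Volterra equations in a Banach space -/

section Volterra

variable {V W : Type} [NormedAddCommGroup V] [NormedSpace ℝ V]
  [NormedAddCommGroup W] [NormedSpace ℝ W] {a b : ℝ}

theorem continuous_IccExtend (hab : a ≤ b) (f : C(Icc a b, V)) : Continuous (IccExtend hab f) :=
  f.continuous.Icc_extend'

theorem IccExtend_coe (hab : a ≤ b) (f : C(Icc a b, V)) (t : Icc a b) :
    IccExtend hab f t = f t := IccExtend_val hab f t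

variable (V) in
/-- The primitive `t ↦ ∫_a^t f` as an operator on continuous functions. -/
def primitive (hab : a ≤ b) : C(Icc a b, V) →L[ℝ] C(Icc a b, V) :=
  LinearMap.mkContinuous
    { toFun := fun f => ⟨fun t => ∫ τ in a..t, IccExtend hab f τ,
        (intervalIntegral.continuous_primitive
          (fun _ _ => (continuous_IccExtend hab f).intervalIntegrable _ _) a).comp
          continuous_subtype_val⟩
      map_add' := fun f g => by
        ext t
        simp only [ContinuousMap.coe_mk, ContinuousMap.add_apply]
        rw [← intervalIntegral.integral_add
          ((continuous_IccExtend hab f).intervalIntegrable _ _)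
          ((continuous_IccExtend hab g).intervalIntegrable _ _)]
        rfl
      map_smul' := fun c f => by
        ext t
        simp only [ContinuousMap.coe_mk, ContinuousMap.smul_apply, RingHom.id_apply]
        rw [← intervalIntegral.integral_smul]
        rfl }
    (b - a) (fun f => by
      refine (ContinuousMap.norm_le _ (by have := norm_nonneg f; nlinarith)).2 fun t => ?_
      refine (intervalIntegral.norm_integral_le_of_norm_le_const (C := ‖f‖)
        fun τ _ => f.norm_coe_le_norm _).trans ?_
      rw [abs_of_nonneg (by linarith [t.2.1]), mul_comm]
      exact mul_le_mul_of_nonneg_right (by linarith [t.2.2]) (norm_nonneg _))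

theorem primitive_apply (hab : a ≤ b) (f : C(Icc a b, V)) (t : Icc a b) :
    primitive V hab f t = ∫ τ in a..t, IccExtend hab f τ := rfl

/-- A bilinear operation, applied pointwise. -/
def pointwise (a b : ℝ) (B : W →L[ℝ] V →L[ℝ] V) :
    C(Icc a b, W) →L[ℝ] C(Icc a b, V) →L[ℝ] C(Icc a b, V) :=
  LinearMap.mkContinuous₂
    (LinearMap.mk₂ ℝ
      (fun (A : C(Icc a b, W)) (u : C(Icc a b, V)) =>
        (⟨fun t => B (A t) (u t), (B.continuous.comp A.continuous).clm_apply u.continuous⟩ :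
          C(Icc a b, V)))
      (fun _ _ _ => by ext; simp) (fun _ _ _ => by ext; simp) (fun _ _ _ => by ext; simp)
      (fun _ _ _ => by ext; simp)) ‖B‖
    (fun A u => by
      refine (ContinuousMap.norm_le _ (by positivity)).2 fun t => ?_
      exact (B.le_opNorm₂ _ _).trans (by
        gcongr
        exacts [A.norm_coe_le_norm t, u.norm_coe_le_norm t]))

variable (B : W →L[ℝ] V →L[ℝ] V)

theorem pointwise_apply (A : C(Icc a b, W)) (u : C(Icc a b, V)) (t : Icc a b) :
    pointwise a b B A u t = B (A t) (u t) := rfl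

/-- The Volterra operator `u ↦ ∫_a^t B(A, u)`. -/
def volterra (hab : a ≤ b) : C(Icc a b, W) →L[ℝ] C(Icc a b, V) →L[ℝ] C(Icc a b, V) :=
  (ContinuousLinearMap.compL ℝ _ _ _ (primitive V hab)) ∘L pointwise a b B

theorem volterra_apply (hab : a ≤ b) (A : C(Icc a b, W)) (u : C(Icc a b, V))
    (t : Icc a b) : volterra B hab A u t = ∫ τ in a..t, IccExtend hab (pointwise a b B A u) τ := rfl

/-- Each further integration of (τ - a)^n gains a factor 1/(n+1), so the iterates decay factorially
however large `A` and the interval are. -/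
theorem norm_volterra_iterate_apply_le (hab : a ≤ b) (A : C(Icc a b, W)) (u : C(Icc a b, V))
    (n : ℕ) (t : Icc a b) :
    ‖(volterra B hab A)^[n] u t‖ ≤ (‖B‖ * ‖A‖ * (t - a)) ^ n / n.factorial * ‖u‖ := by
  induction n generalizing t with
  | zero => simpa using u.norm_coe_le_norm t
  | succ n ih =>
    rw [Function.iterate_succ_apply', volterra_apply]
    have h1 : ‖∫ τ in a..t, IccExtend hab (pointwise a b B A ((volterra B hab A)^[n] u)) τ‖ ≤
        ∫ τ in a..t, ‖B‖ * ‖A‖ * ((‖B‖ * ‖A‖ * (τ - a)) ^ n / n.factorial * ‖u‖) := by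
      refine intervalIntegral.norm_integral_le_of_norm_le t.2.1
        (Filter.Eventually.of_forall fun τ hτ => ?_)
        (Continuous.intervalIntegrable (by fun_prop) _ _)
      have hm : τ ∈ Icc a b := ⟨hτ.1.le, hτ.2.trans t.2.2⟩
      rw [IccExtend_of_mem hab _ hm, pointwise_apply]
      refine (B.le_opNorm₂ _ _).trans ?_
      gcongr
      · exact A.norm_coe_le_norm _
      · exact ih ⟨τ, hm⟩
    refine h1.trans (le_of_eq ?_)
    have h2 : ∀ τ : ℝ, ‖B‖ * ‖A‖ * ((‖B‖ * ‖A‖ * (τ - a)) ^ n / n.factorial * ‖u‖) =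
        ((‖B‖ * ‖A‖) ^ (n + 1) / n.factorial * ‖u‖) * (τ - a) ^ n := by
      intro τ; rw [mul_pow _ (τ - a)]; ring
    simp only [h2]
    rw [intervalIntegral.integral_const_mul,
      intervalIntegral.integral_comp_sub_right (fun x => x ^ n), integral_pow, sub_self,
      Nat.factorial_succ, mul_pow _ ((t : ℝ) - a)]
    have : (n.factorial : ℝ) ≠ 0 := by positivity
    have : (n : ℝ) + 1 ≠ 0 := by positivity
    push_cast
    field_simp
    simp

theorem norm_volterra_iterate_le (hab : a ≤ b) (A : C(Icc a b, W)) (n : ℕ) (u : C(Icc a b, V)) :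
    ‖(volterra B hab A)^[n] u‖ ≤ (‖B‖ * ‖A‖ * (b - a)) ^ n / n.factorial * ‖u‖ := by
  have h0 : 0 ≤ ‖B‖ * ‖A‖ * (b - a) := mul_nonneg (by positivity) (by linarith)
  refine (ContinuousMap.norm_le _ (by positivity)).2 fun t => ?_
  refine (norm_volterra_iterate_apply_le B hab A u n t).trans ?_
  have : 0 ≤ ‖B‖ * ‖A‖ * (t - a) := mul_nonneg (by positivity) (by linarith [t.2.1])
  have h2 : ‖B‖ * ‖A‖ * (t - a) ≤ ‖B‖ * ‖A‖ * (b - a) :=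
    mul_le_mul_of_nonneg_left (by linarith [t.2.2]) (by positivity)
  gcongr

/-- `1 + x` is a unit if the geometric series of `-x` converges. -/
def oneAddUnit {𝓡 : Type} [NormedRing 𝓡] {x : 𝓡} (h : Summable fun n : ℕ => (-x) ^ n) : 𝓡ˣ where
  val := 1 + x
  inv := ∑' n : ℕ, (-x) ^ n
  val_inv := by
    have := h.one_sub_mul_tsum_pow
    rwa [sub_neg_eq_add] at this
  inv_val := by
    have := h.tsum_pow_mul_one_sub
    rwa [sub_neg_eq_add] at this

/-- The equation `u + f_A u = v` for a family of operators `f_A` with quickly decreasing powers. -/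
theorem exists_neumann {G E : Type} [NormedAddCommGroup G] [NormedSpace ℝ G]
    [NormedAddCommGroup E] [NormedSpace ℝ E] [CompleteSpace E] (f : G →L[ℝ] E →L[ℝ] E)
    (hf : ∀ A, ∃ c : ℝ, 0 ≤ c ∧ ∀ (n : ℕ) (u : E), ‖(f A)^[n] u‖ ≤ c ^ n / n.factorial * ‖u‖)
    (v : E) :
    ∃ sol : G → E, ContDiff ℝ ∞ sol ∧ (∀ A, sol A + f A (sol A) = v) ∧
      ∀ A, HasSum (fun n : ℕ => (-1 : ℝ) ^ n • (f A)^[n] v) (sol A) := by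
  have hs : ∀ A, Summable fun n : ℕ => (-f A) ^ n := by
    intro A
    obtain ⟨c, hc, h⟩ := hf A
    refine Summable.of_norm_bounded (Real.summable_pow_div_factorial c) fun n => ?_
    rw [neg_pow]
    have : ‖f A ^ n‖ ≤ c ^ n / n.factorial := by
      refine ContinuousLinearMap.opNorm_le_bound _ (by positivity) fun u => ?_
      rw [FunLike.coe_pow_eq_iterate]
      exact h n u
    rcases neg_one_pow_eq_or (E →L[ℝ] E) n with h | h <;>
      simp only [h, one_mul, neg_mul, norm_neg] <;> exact this
  -- Smoothness in `A` is read off from inversion being smooth at units, so the series never has to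
  -- be differentiated term by term. The series itself is kept only to identify the solution with
  -- the iterated integrals.
  have hinv : ∀ A, Ring.inverse (1 + f A) = ∑' n : ℕ, (-f A) ^ n := fun A =>
    Ring.inverse_unit (oneAddUnit (hs A))
  refine ⟨fun A => Ring.inverse (1 + f A) v, ?_, ?_, ?_⟩
  · refine contDiff_iff_contDiffAt.2 fun A => ?_
    have : ContDiffAt ℝ ∞ (fun A => Ring.inverse (1 + f A)) A :=
      ContDiffAt.comp (g := Ring.inverse) (f := fun A => 1 + f A) A
        (contDiffAt_ringInverse ℝ (oneAddUnit (hs A)))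
        (contDiffAt_const.add f.contDiff.contDiffAt)
    exact this.clm_apply contDiffAt_const
  · intro A
    have h : (1 + f A) * Ring.inverse (1 + f A) = 1 :=
      Ring.mul_inverse_cancel _ (oneAddUnit (hs A)).isUnit
    exact congrArg (fun T : E →L[ℝ] E => T v) h
  · intro A
    simp only [hinv]
    have := (ContinuousLinearMap.apply ℝ _ v).hasSum (hs A).hasSum
    refine this.congr_fun fun n => ?_
    rw [neg_pow (f A), ContinuousLinearMap.apply_apply, ← FunLike.coe_pow_eq_iterate]
    rcases Nat.even_or_odd n with h | h <;>
      simp only [h.neg_one_pow, one_mul, one_smul, neg_mul, neg_smul] <;> rfl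

variable [CompleteSpace V]

theorem exists_volterraSol (hab : a ≤ b) (v : V) :
    ∃ sol : C(Icc a b, W) → C(Icc a b, V), ContDiff ℝ ∞ sol ∧
      (∀ A, sol A + volterra B hab A (sol A) = ContinuousMap.const _ v) ∧
      ∀ A, HasSum (fun n : ℕ => (-1 : ℝ) ^ n • (volterra B hab A)^[n] (ContinuousMap.const _ v))
        (sol A) :=
  exists_neumann (volterra B hab) (fun A => ⟨‖B‖ * ‖A‖ * (b - a),
    mul_nonneg (by positivity) (by linarith), norm_volterra_iterate_le B hab A⟩) _

/-- The solution of `u(t) = v - ∫_a^t B(A, u)`. -/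
def volterraSol (hab : a ≤ b) (v : V) : C(Icc a b, W) → C(Icc a b, V) :=
  (exists_volterraSol B hab v).choose

theorem contDiff_volterraSol (hab : a ≤ b) (v : V) : ContDiff ℝ ∞ (volterraSol B hab v) :=
  (exists_volterraSol B hab v).choose_spec.1

theorem volterraSol_add (hab : a ≤ b) (v : V) (A : C(Icc a b, W)) :
    volterraSol B hab v A + volterra B hab A (volterraSol B hab v A) = ContinuousMap.const _ v :=
  (exists_volterraSol B hab v).choose_spec.2.1 A

theorem volterraSol_hasSum (hab : a ≤ b) (v : V) (A : C(Icc a b, W)) :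
    HasSum (fun n : ℕ => (-1 : ℝ) ^ n • (volterra B hab A)^[n] (ContinuousMap.const _ v))
      (volterraSol B hab v A) :=
  (exists_volterraSol B hab v).choose_spec.2.2 A

/-- The extension by constants is continuous on the whole line, so the fundamental theorem of
calculus applies at the endpoints too. -/
theorem hasDerivWithinAt_primitive (hab : a ≤ b) (f : C(Icc a b, V)) (t : Icc a b) :
    HasDerivWithinAt (fun τ => IccExtend hab (primitive V hab f) τ) (f t) (Icc a b) t := by
  have h := ((continuous_IccExtend hab f).integral_hasStrictDerivAt a t).hasDerivAt
  rw [IccExtend_coe] at h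
  refine h.hasDerivWithinAt.congr (fun τ hτ => ?_) ?_
  · rw [IccExtend_of_mem hab _ hτ, primitive_apply]
  · rw [IccExtend_coe, primitive_apply]

/-- A solution of the Volterra equation solves the differential equation. -/
theorem hasDerivWithinAt_of_add_volterra (hab : a ≤ b) {v : V} {A : C(Icc a b, W)}
    {u f : C(Icc a b, V)} (hu : u + volterra B hab A u + primitive V hab f =
      ContinuousMap.const _ v) (t : Icc a b) :
    HasDerivWithinAt (fun τ => IccExtend hab u τ) (-(B (A t) (u t)) - f t) (Icc a b) t := by
  have h1 := ((hasDerivWithinAt_primitive hab (pointwise a b B A u) t).fun_add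
    (hasDerivWithinAt_primitive hab f t)).const_sub v
  have h2 : ∀ τ : Icc a b, u τ = v - (primitive V hab (pointwise a b B A u) τ +
      primitive V hab f τ) := by
    intro τ
    have := congrArg (fun w : C(Icc a b, V) => w τ) hu
    simp only [ContinuousMap.add_apply, ContinuousMap.const_apply] at this
    rw [← this]
    change u τ = u τ + volterra B hab A u τ + _ - (volterra B hab A u τ + _)
    abel
  refine (h1.congr (fun τ hτ => ?_) ?_).congr_deriv ?_
  · rw [IccExtend_of_mem hab _ hτ, IccExtend_of_mem hab _ hτ, IccExtend_of_mem hab _ hτ, h2]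
  · rw [IccExtend_coe, IccExtend_coe, IccExtend_coe, h2]
  · rw [pointwise_apply]; abel

theorem apply_left_of_add_volterra (hab : a ≤ b) {v : V} {A : C(Icc a b, W)}
    {u f : C(Icc a b, V)} (hu : u + volterra B hab A u + primitive V hab f =
      ContinuousMap.const _ v) : u ⟨a, left_mem_Icc.2 hab⟩ = v := by
  have := congrArg (fun w : C(Icc a b, V) => w ⟨a, left_mem_Icc.2 hab⟩) hu
  simpa [volterra_apply, primitive_apply] using this

/-- Uniqueness for linear differential equations. -/
theorem eq_zero_of_linear_ode {A : ℝ → W} (hA : ContinuousOn A (Icc a b)) {u : ℝ → V}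
    (hu : ∀ t ∈ Icc a b, HasDerivWithinAt u (B (A t) (u t)) (Icc a b) t) (h0 : u a = 0) :
    ∀ t ∈ Icc a b, u t = 0 := by
  intro t ht
  obtain ⟨C, hC⟩ := isCompact_Icc.exists_bound_of_continuousOn hA
  refine eq_zero_of_abs_deriv_le_mul_abs_self_of_eq_zero_right (K := ‖B‖ * C) (a := a) (b := b)
    (f' := fun t => B (A t) (u t)) (fun t ht => (hu t ht).continuousWithinAt) ?_ h0 ?_ t ht
  · intro x hx
    exact (hu x ⟨hx.1, hx.2.le⟩).mono_of_mem_nhdsWithin (Icc_mem_nhdsGE_of_mem hx)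
  · intro x hx
    exact (B.le_opNorm₂ _ _).trans (by
      have := hC x ⟨hx.1, hx.2.le⟩
      gcongr)

end Volterra

/-! ### Families of continuous functions that depend smoothly on a parameter -/

section Nemytskii

variable {S : Type} {F : Type} [NormedAddCommGroup S] [NormedSpace ℝ S] [NormedAddCommGroup F]
  [NormedSpace ℝ F] {a b : ℝ} {P : Set S}

open Classical in
/-- The continuous function on `[a, b]` given by `f` (zero if `f` is not continuous). -/
def restr (a b : ℝ) (f : ℝ → F) : C(Icc a b, F) :=
  if h : Continuous fun t : Icc a b => f t then ⟨fun t => f t, h⟩ else 0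

theorem restr_apply {f : ℝ → F} (h : ContinuousOn f (Icc a b)) (t : Icc a b) :
    restr a b f t = f t := by
  rw [restr, dif_pos (show Continuous fun t : Icc a b => f t from
    continuousOn_iff_continuous_domRestrict.1 h)]
  rfl

variable (S F a b) in
/-- Exchange of a linear argument and a continuous one. -/
def flipEval : C(Icc a b, S →L[ℝ] F) →L[ℝ] S →L[ℝ] C(Icc a b, F) :=
  LinearMap.mkContinuous₂
    (LinearMap.mk₂ ℝ
      (fun (A : C(Icc a b, S →L[ℝ] F)) (v : S) =>
        (⟨fun t => A t v, A.continuous.clm_apply continuous_const⟩ : C(Icc a b, F)))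
      (fun _ _ _ => by ext; simp) (fun _ _ _ => by ext; simp) (fun _ _ _ => by ext; simp)
      (fun _ _ _ => by ext; simp)) 1
    (fun A v => by
      refine (ContinuousMap.norm_le _ (by positivity)).2 fun t => ?_
      rw [one_mul]
      exact ((A t).le_opNorm _).trans
        (mul_le_mul_of_nonneg_right (A.norm_coe_le_norm t) (norm_nonneg _)))

theorem flipEval_apply (A : C(Icc a b, S →L[ℝ] F)) (v : S) (t : Icc a b) :
    flipEval S F a b A v t = A t v := rfl

theorem continuousOn_slice {f : ℝ × S → F} (hf : ContinuousOn f (Icc a b ×ˢ P)) {p : S}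
    (hp : p ∈ P) : ContinuousOn (fun t => f (t, p)) (Icc a b) :=
  hf.comp (by fun_prop) fun _ ht => ⟨ht, hp⟩

/-- Currying: a jointly continuous function gives a continuous map into the space of continuous
functions on the compact interval. -/
theorem continuousOn_restr {f : ℝ × S → F} (hf : ContinuousOn f (Icc a b ×ˢ P)) :
    ContinuousOn (fun p => restr a b fun t => f (t, p)) P := by
  rw [continuousOn_iff_continuous_domRestrict]
  have h : Continuous fun q : P × Icc a b => f (q.2, q.1) :=
    hf.comp_continuous (by fun_prop) fun q => ⟨q.2.2, q.1.2⟩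
  have h2 := (ContinuousMap.curry ⟨_, h⟩).continuous
  refine h2.congr fun p => ?_
  ext t
  exact (restr_apply (continuousOn_slice hf p.2) t).symm

/-- The mean value inequality on the convex set `P` bounds the remainder at each time by the
oscillation of `f'`, and this is uniform in time because `f'` varies continuously in the sup norm.
-/
theorem hasFDerivWithinAt_restr (hP : Convex ℝ P) {f : ℝ × S → F} {f' : ℝ × S → S →L[ℝ] F}
    (hf : ContinuousOn f (Icc a b ×ˢ P)) (hf' : ContinuousOn f' (Icc a b ×ˢ P))
    (h : ∀ t ∈ Icc a b, ∀ p ∈ P, HasFDerivWithinAt (fun p => f (t, p)) (f' (t, p)) P p)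
    {p : S} (hp : p ∈ P) :
    HasFDerivWithinAt (fun p => restr a b fun t => f (t, p))
      (flipEval S F a b (restr a b fun t => f' (t, p))) P p := by
  rw [hasFDerivWithinAt_iff_isLittleO, Asymptotics.isLittleO_iff]
  intro c hc
  have h1 := continuousOn_restr hf' p hp
  obtain ⟨ε, hε, hε'⟩ := Metric.mem_nhdsWithin_iff.1 (h1 (Metric.closedBall_mem_nhds _ hc))
  refine Metric.mem_nhdsWithin_iff.2 ⟨ε, hε, fun q hq => ?_⟩
  refine (ContinuousMap.norm_le _ (by positivity)).2 fun t => ?_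
  simp only [ContinuousMap.sub_apply, flipEval_apply]
  rw [restr_apply (continuousOn_slice hf hq.2), restr_apply (continuousOn_slice hf hp), restr_apply (continuousOn_slice hf' hp)]
  refine (hP.inter (convex_ball p ε)).norm_image_sub_le_of_norm_hasFDerivWithin_le'
    (f := fun p => f (t, p)) (f' := fun p => f' (t, p)) (φ := f' (t, p)) (C := c)
    (fun r hr => (h t t.2 r hr.1).mono inter_subset_left) (fun r hr => ?_)
    ⟨hp, Metric.mem_ball_self hε⟩ ⟨hq.2, hq.1⟩
  have h2 : restr a b (fun t => f' (t, r)) ∈ Metric.closedBall (restr a b fun t => f' (t, p)) c :=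
    hε' ⟨hr.2, hr.1⟩
  rw [mem_closedBall_iff_norm] at h2
  refine le_trans ?_ h2
  have h3 := (restr a b (fun t => f' (t, r)) - restr a b fun t => f' (t, p)).norm_coe_le_norm t
  rwa [ContinuousMap.sub_apply, restr_apply (continuousOn_slice hf' hr.1), restr_apply (continuousOn_slice hf' hp)] at h3

theorem hasFDerivWithinAt_slice {f : ℝ × S → F}
    (hf : ContDiffOn ℝ 1 f (Icc a b ×ˢ P)) {t : ℝ} (ht : t ∈ Icc a b) {p : S} (hp : p ∈ P) :
    HasFDerivWithinAt (fun p => f (t, p))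
      ((fderivWithin ℝ f (Icc a b ×ˢ P) (t, p)).comp (ContinuousLinearMap.inr ℝ ℝ S)) P p := by
  have h1 := (hf.differentiableOn one_ne_zero (t, p) ⟨ht, hp⟩).hasFDerivWithinAt
  exact h1.comp (f := fun p => (t, p)) p (hasFDerivAt_prodMk_right t p).hasFDerivWithinAt
    fun q hq => ⟨ht, hq⟩

theorem contDiffOn_restr_nat (hab : a < b) (hP : Convex ℝ P) (hu : UniqueDiffOn ℝ P) (n : ℕ)
    {f : ℝ × S → F} (hf : ContDiffOn ℝ n f (Icc a b ×ˢ P)) :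
    ContDiffOn ℝ n (fun p => restr a b fun t => f (t, p)) P := by
  induction n generalizing F with
  | zero =>
    rw [Nat.cast_zero, contDiffOn_zero] at hf ⊢
    exact continuousOn_restr hf
  | succ n ih =>
    have huK : UniqueDiffOn ℝ (Icc a b ×ˢ P) := (uniqueDiffOn_Icc hab).prod hu
    have h1 : ContDiffOn ℝ 1 f (Icc a b ×ˢ P) := hf.of_le (by norm_cast; omega)
    have hf' : ContDiffOn ℝ n (fun q => (fderivWithin ℝ f (Icc a b ×ˢ P) q).comp
        (ContinuousLinearMap.inr ℝ ℝ S)) (Icc a b ×ˢ P) :=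
      (hf.fderivWithin huK (m := n) (by norm_cast)).clm_comp contDiffOn_const
    have h2 : ∀ p ∈ P, HasFDerivWithinAt (fun p => restr a b fun t => f (t, p)) _ P p :=
      fun p hp => hasFDerivWithinAt_restr hP hf.continuousOn hf'.continuousOn
        (fun t ht p hp => hasFDerivWithinAt_slice h1 ht hp) hp
    rw [Nat.cast_succ, contDiffOn_succ_iff_fderivWithin hu]
    -- The derivative is a map of the same kind, built from the partial derivative in the parameter
    -- and followed by the continuous linear map `flipEval`. This closes the induction over all
    -- target spaces.
    refine ⟨fun p hp => (h2 p hp).differentiableWithinAt, by simp, ?_⟩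
    refine ((flipEval S F a b).contDiff.comp_contDiffOn (ih hf')).congr fun p hp => ?_
    exact (h2 p hp).fderivWithin (hu p hp)

theorem contDiffOn_restr (hab : a < b) (hP : Convex ℝ P) (hu : UniqueDiffOn ℝ P)
    {f : ℝ × S → F} (hf : ContDiffOn ℝ ∞ f (Icc a b ×ˢ P)) :
    ContDiffOn ℝ ∞ (fun p => restr a b fun t => f (t, p)) P :=
  contDiffOn_infty.2 fun n => contDiffOn_restr_nat hab hP hu n (contDiffOn_infty.1 hf n)

end Nemytskii

/-! ### Linear differential equations with parameters -/

section LinearODE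

variable {S V W : Type} [NormedAddCommGroup S] [NormedSpace ℝ S] [NormedAddCommGroup V]
  [NormedSpace ℝ V] [CompleteSpace V] [NormedAddCommGroup W] [NormedSpace ℝ W] {a b : ℝ} {P : Set S}

/-- Smooth dependence on parameters of the solution of `u' = -A u`, `u a = v`, and the equation for
the derivative in the direction `e`. -/
theorem exists_linear_ode (hab : a < b) (hP : Convex ℝ P) (hu : UniqueDiffOn ℝ P)
    (B : W →L[ℝ] V →L[ℝ] V) {A : ℝ × S → W} (hA : ContDiffOn ℝ ∞ A (Icc a b ×ˢ P)) (v : V) :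
    ∃ u : ℝ → S → V,
      (∀ p ∈ P, ∀ t, (ht : t ∈ Icc a b) →
        u t p = volterraSol B hab.le v (restr a b fun t => A (t, p)) ⟨t, ht⟩) ∧
      (∀ t ∈ Icc a b, ContDiffOn ℝ ∞ (u t) P) ∧
      (∀ p ∈ P, u a p = v ∧ ∀ t ∈ Icc a b,
        HasDerivWithinAt (fun t => u t p) (-(B (A (t, p)) (u t p))) (Icc a b) t) ∧
      ∀ p ∈ P, ∀ e : S, fderivWithin ℝ (u a) P p e = 0 ∧ ∀ t ∈ Icc a b,
        HasDerivWithinAt (fun t => fderivWithin ℝ (u t) P p e)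
          (-(B (A (t, p)) (fderivWithin ℝ (u t) P p e)) -
            B (fderivWithin ℝ (fun p => A (t, p)) P p e) (u t p)) (Icc a b) t := by
  set 𝒜 : S → C(Icc a b, W) := fun p => restr a b fun t => A (t, p) with h𝒜
  have h𝒜d : ContDiffOn ℝ ∞ 𝒜 P := contDiffOn_restr hab hP hu hA
  set 𝒰 : S → C(Icc a b, V) := fun p => volterraSol B hab.le v (𝒜 p) with h𝒰
  have h𝒰d : ContDiffOn ℝ ∞ 𝒰 P := (contDiff_volterraSol B hab.le v).comp_contDiffOn h𝒜d
  have h𝒜t : ∀ p ∈ P, ∀ t : Icc a b, 𝒜 p t = A (t, p) :=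
    fun p hp t => restr_apply (continuousOn_slice hA.continuousOn hp) t
  let ev : Icc a b → C(Icc a b, V) →L[ℝ] V := fun t => ContinuousMap.evalCLM ℝ t
  let ev' : Icc a b → C(Icc a b, W) →L[ℝ] W :=
    fun t => ContinuousMap.evalCLM ℝ t
  have hd𝒰 : ∀ p ∈ P, HasFDerivWithinAt 𝒰 (fderivWithin ℝ 𝒰 P p) P p := fun p hp =>
    (h𝒰d.differentiableOn (by simp) p hp).hasFDerivWithinAt
  have hd𝒜 : ∀ p ∈ P, HasFDerivWithinAt 𝒜 (fderivWithin ℝ 𝒜 P p) P p := fun p hp =>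
    (h𝒜d.differentiableOn (by simp) p hp).hasFDerivWithinAt
  have heq : ∀ p, 𝒰 p + volterra B hab.le (𝒜 p) (𝒰 p) = ContinuousMap.const _ v :=
    fun p => volterraSol_add B hab.le v (𝒜 p)
  -- A zero source is inserted so that the lemmas with a source term serve both for the solution and
  -- for its parameter derivative.
  have hsol : ∀ p, 𝒰 p + volterra B hab.le (𝒜 p) (𝒰 p) + primitive V hab.le 0 =
      ContinuousMap.const _ v := fun p => by rw [heq, map_zero, add_zero]
  -- Differentiating the integral equation in the parameter gives a Volterra equation for the
  -- derivative, with source from the derivative of `A`. Read as an ODE, it contains the interchange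
  -- of the time and parameter derivatives.
  have hlin : ∀ p ∈ P, ∀ e, fderivWithin ℝ 𝒰 P p e +
      volterra B hab.le (𝒜 p) (fderivWithin ℝ 𝒰 P p e) +
      primitive V hab.le (pointwise a b B (fderivWithin ℝ 𝒜 P p e) (𝒰 p)) =
      ContinuousMap.const _ 0 := by
    intro p hp e
    have h1 := (hd𝒰 p hp).fun_add (((volterra B hab.le).hasFDerivAt.comp_hasFDerivWithinAt p
      (hd𝒜 p hp)).clm_apply (hd𝒰 p hp))
    have h2 : HasFDerivWithinAt (fun p => 𝒰 p + volterra B hab.le (𝒜 p) (𝒰 p))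
        (0 : S →L[ℝ] C(Icc a b, V)) P p :=
      (hasFDerivWithinAt_const (ContinuousMap.const (Icc a b) v) p P).congr
        (fun q _ => heq q) (heq p)
    have h3 := congrArg (fun T : S →L[ℝ] C(Icc a b, V) => T e) ((hu p hp).eq h1 h2)
    rw [add_assoc]
    exact h3
  have hfd : ∀ p ∈ P, ∀ e, ∀ t : Icc a b, fderivWithin ℝ (fun p => 𝒰 p t) P p e =
      fderivWithin ℝ 𝒰 P p e t := by
    intro p hp e t
    exact congrArg (fun T : S →L[ℝ] V => T e)
      ((ev t).hasFDerivAt.comp_hasFDerivWithinAt p (hd𝒰 p hp) |>.fderivWithin (hu p hp))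
  have hfdA : ∀ p ∈ P, ∀ e, ∀ t : Icc a b, fderivWithin ℝ (fun p => A (t, p)) P p e =
      fderivWithin ℝ 𝒜 P p e t := by
    intro p hp e t
    rw [fderivWithin_congr (f := fun p => 𝒜 p t) (fun q hq => (h𝒜t q hq t).symm)
      (h𝒜t p hp t).symm]
    exact congrArg (fun T : S →L[ℝ] W => T e)
      ((ev' t).hasFDerivAt.comp_hasFDerivWithinAt p (hd𝒜 p hp) |>.fderivWithin (hu p hp))
  have hext : ∀ p, ∀ t : Icc a b, IccExtend hab.le (𝒰 p) t = 𝒰 p t := fun p t =>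
    IccExtend_coe hab.le (𝒰 p) t
  have ha : a ∈ Icc a b := left_mem_Icc.2 hab.le
  refine ⟨fun t p => IccExtend hab.le (𝒰 p) t, ?_, ?_, ?_, ?_⟩
  · intro p hp t ht
    exact hext p ⟨t, ht⟩
  · intro t ht
    exact ((ev ⟨t, ht⟩).contDiff.comp_contDiffOn h𝒰d).congr fun p _ => hext p ⟨t, ht⟩
  · refine fun p hp => ⟨?_, fun t ht => ?_⟩
    · exact (hext p ⟨a, ha⟩).trans (apply_left_of_add_volterra B hab.le (hsol p))
    · have := hasDerivWithinAt_of_add_volterra B hab.le (hsol p) ⟨t, ht⟩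
      rw [ContinuousMap.zero_apply, sub_zero, h𝒜t p hp ⟨t, ht⟩, ← hext p ⟨t, ht⟩] at this
      exact this
  · have hfun : ∀ t : Icc a b, (fun p => IccExtend hab.le (𝒰 p) t) = fun p => 𝒰 p t :=
      fun t => funext fun p => hext p t
    refine fun p hp e => ⟨?_, fun t ht => ?_⟩
    · have h1 := hfun ⟨a, ha⟩
      beta_reduce
      simp only at h1
      rw [h1, hfd p hp e ⟨a, ha⟩]
      exact apply_left_of_add_volterra B hab.le (hlin p hp e)
    · have := hasDerivWithinAt_of_add_volterra B hab.le (hlin p hp e) ⟨t, ht⟩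
      rw [pointwise_apply, ← hfdA p hp e ⟨t, ht⟩, ← hfd p hp e ⟨t, ht⟩, h𝒜t p hp ⟨t, ht⟩] at this
      have h1 := hfun ⟨t, ht⟩
      simp only at h1
      beta_reduce
      rw [h1, hext p ⟨t, ht⟩]
      refine this.congr (fun τ hτ => ?_) ?_
      · rw [IccExtend_of_mem _ _ hτ, ← hfd p hp e ⟨τ, hτ⟩, ← hfun ⟨τ, hτ⟩]
      · rw [IccExtend_of_mem _ _ ht, ← hfd p hp e ⟨t, ht⟩, ← hfun ⟨t, ht⟩]

end LinearODE

/-! ### Truncated matrices -/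

section Trunc

variable (𝕜 : Type) [RCLike 𝕜] (R : Type) [Ring R] [Algebra 𝕜 R] [GrAlg 𝕜 R]

/-- The indices of degree at most `D`. -/
abbrev LowIdx (D : ℕ) : Type := {i : GrAlg.Idx 𝕜 R // GrAlg.deg (𝕜 := 𝕜) (R := R) i ≤ D}

instance [FinGr 𝕜 R] (D : ℕ) : Fintype (LowIdx 𝕜 R D) :=
  (FinGr.finite_deg (𝕜 := 𝕜) (R := R) D).fintype

/-- Matrices over `R`, modulo terms of degree more than `D`. -/
abbrev Trunc (N D : ℕ) : Type := Fin N × Fin N × LowIdx 𝕜 R D → 𝕜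

variable {R} {N : ℕ} (D : ℕ)

/-- Truncation at degree `D`. -/
def tr (A : Matrix (Fin N) (Fin N) R) : Trunc 𝕜 R N D := fun x => cf 𝕜 (A x.1 x.2.1) x.2.2

variable {𝕜} {D}

open Classical in
/-- The matrix with a given truncation and no terms of higher degree. -/
def unTr (u : Trunc 𝕜 R N D) : Matrix (Fin N) (Fin N) R := fun α β =>
  (GrAlg.coeff (𝕜 := 𝕜)).symm fun i =>
    if h : GrAlg.deg (𝕜 := 𝕜) (R := R) i ≤ D then u (α, β, ⟨i, h⟩) else 0

theorem cf_unTr (u : Trunc 𝕜 R N D) (α β) (i : LowIdx 𝕜 R D) :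
    cf 𝕜 (unTr u α β) i = u (α, β, i) := by
  rw [unTr, cf_symm, dif_pos i.2]

theorem unTr_add (u v : Trunc 𝕜 R N D) : unTr (u + v) = unTr u + unTr v := by
  ext α β
  refine cf_ext (𝕜 := 𝕜) fun i => ?_
  rw [Matrix.add_apply, cf_add, unTr, unTr, unTr, cf_symm, cf_symm, cf_symm]
  split_ifs <;> simp

theorem unTr_smul (c : ℝ) (u : Trunc 𝕜 R N D) : unTr (c • u) = (c : 𝕜) • unTr u := by
  ext α β
  refine cf_ext (𝕜 := 𝕜) fun i => ?_
  rw [Matrix.smul_apply, cf_smul, unTr, unTr, cf_symm, cf_symm]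
  split_ifs <;> simp [RCLike.real_smul_eq_coe_mul]

theorem tr_add (A B : Matrix (Fin N) (Fin N) R) : tr 𝕜 D (A + B) = tr 𝕜 D A + tr 𝕜 D B := by
  ext x; simp [tr]

theorem tr_neg (A : Matrix (Fin N) (Fin N) R) : tr 𝕜 D (-A) = -tr 𝕜 D A := by
  ext x; simp [tr]

theorem tr_sub (A B : Matrix (Fin N) (Fin N) R) : tr 𝕜 D (A - B) = tr 𝕜 D A - tr 𝕜 D B := by
  ext x; simp [tr]

theorem tr_smul (c : ℝ) (A : Matrix (Fin N) (Fin N) R) :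
    tr 𝕜 D ((c : 𝕜) • A) = c • tr 𝕜 D A := by
  ext x; simp [tr, RCLike.real_smul_eq_coe_mul]

variable [FinGr 𝕜 R]

/-- Degrees are natural numbers that add up under multiplication, so a coefficient of degree at most
`D` only sees such coefficients of both factors. The product therefore descends to truncations. -/
theorem tr_mul_congr {A A' X X' : Matrix (Fin N) (Fin N) R} (hA : tr 𝕜 D A = tr 𝕜 D A')
    (hX : tr 𝕜 D X = tr 𝕜 D X') : tr 𝕜 D (A * X) = tr 𝕜 D (A' * X') := by
  ext ⟨α, β, i, hi⟩
  simp only [tr, Matrix.mul_apply, cf_sum]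
  refine Finset.sum_congr rfl fun γ _ => ?_
  obtain ⟨κ, _, j, k, c, hd, hc⟩ := FinGr.mul_coeff (𝕜 := 𝕜) (R := R) i
  simp only [cf, hc]
  refine Finset.sum_congr rfl fun l _ => ?_
  have hl := hd l
  have h1 := congrFun hA (α, γ, ⟨j l, by omega⟩)
  have h2 := congrFun hX (γ, β, ⟨k l, by omega⟩)
  simp only [tr, cf] at h1 h2
  rw [h1, h2]

theorem tr_unTr (u : Trunc 𝕜 R N D) : tr 𝕜 D (unTr u) = u := by
  ext ⟨α, β, i⟩
  exact cf_unTr u α β i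

variable (𝕜 R N D) in
/-- The product of truncated matrices. -/
def trMul : Trunc 𝕜 R N D →L[ℝ] Trunc 𝕜 R N D →L[ℝ] Trunc 𝕜 R N D :=
  LinearMap.toContinuousBilinearMap (LinearMap.mk₂ ℝ (fun u v => tr 𝕜 D (unTr u * unTr v))
    (fun u u' v => by rw [unTr_add, add_mul, tr_add])
    (fun c u v => by rw [unTr_smul, smul_mul_assoc, tr_smul])
    (fun u v v' => by rw [unTr_add, mul_add, tr_add])
    (fun c u v => by rw [unTr_smul, mul_smul_comm, tr_smul]))

theorem trMul_tr (A X : Matrix (Fin N) (Fin N) R) :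
    trMul 𝕜 R N D (tr 𝕜 D A) (tr 𝕜 D X) = tr 𝕜 D (A * X) :=
  tr_mul_congr (tr_unTr _) (tr_unTr _)

end Trunc

/-! ### The path ordered exponential -/

section Pexp

variable {𝕜 : Type} [RCLike 𝕜] {R : Type} [Ring R] [Algebra 𝕜 R] [GrAlg 𝕜 R] {N : ℕ}
  {A A' : ℝ → Matrix (Fin N) (Fin N) R} {a b c t : ℝ}

variable (𝕜) in
/-- All coefficients of the entries are continuous on `S`. -/
def CoeffCts (A : ℝ → Matrix (Fin N) (Fin N) R) (S : Set ℝ) : Prop :=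
  ∀ α β (i : GrAlg.Idx 𝕜 R), ContinuousOn (fun t => cf 𝕜 (A t α β) i) S

theorem CoeffCts.mono {S S' : Set ℝ} (h : CoeffCts 𝕜 A S) (hS : S' ⊆ S) : CoeffCts 𝕜 A S' :=
  fun α β i => (h α β i).mono hS

theorem iterInt_succ (A : ℝ → Matrix (Fin N) (Fin N) R) (a : ℝ) (q : ℕ) (t : ℝ) (α β) (i) :
    cf 𝕜 (iterInt 𝕜 A a (q + 1) t α β) i =
      -∫ u in a..t, cf 𝕜 ((A u * iterInt 𝕜 A a q u) α β) i := by
  rw [iterInt, Matrix.of_apply, cf_neg, integ, cf_symm]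

theorem cf_pexp (A : ℝ → Matrix (Fin N) (Fin N) R) (b a : ℝ) (α β) (i) :
    cf 𝕜 (pexp 𝕜 A b a α β) i = ∑' q, cf 𝕜 (iterInt 𝕜 A a q b α β) i := by
  rw [pexp, Matrix.of_apply, series, cf_symm]

theorem iterInt_congr (h : ∀ u ∈ Icc a b, A u = A' u) (q : ℕ) :
    ∀ t ∈ Icc a b, iterInt 𝕜 A a q t = iterInt 𝕜 A' a q t := by
  induction q with
  | zero => intro t _; rfl
  | succ q ih =>
    intro t ht
    ext α β
    refine cf_ext (𝕜 := 𝕜) fun i => ?_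
    rw [iterInt_succ, iterInt_succ]
    congr 1
    refine intervalIntegral.integral_congr fun u hu => ?_
    rw [uIcc_of_le ht.1] at hu
    have hu' : u ∈ Icc a b := ⟨hu.1, hu.2.trans ht.2⟩
    simp only [h u hu', ih u hu']

theorem pexp_congr (hab : a ≤ b) (h : ∀ u ∈ Icc a b, A u = A' u) :
    pexp 𝕜 A b a = pexp 𝕜 A' b a := by
  ext α β
  refine cf_ext (𝕜 := 𝕜) fun i => ?_
  rw [cf_pexp, cf_pexp]
  exact tsum_congr fun q => by rw [iterInt_congr h q b (right_mem_Icc.2 hab)]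

theorem pexp_self (A : ℝ → Matrix (Fin N) (Fin N) R) (a : ℝ) : pexp 𝕜 A a a = 1 := by
  ext α β
  refine cf_ext (𝕜 := 𝕜) fun i => ?_
  rw [cf_pexp, tsum_eq_single 0]
  · rfl
  · intro q hq
    obtain ⟨q, rfl⟩ := Nat.exists_eq_succ_of_ne_zero hq
    rw [Nat.succ_eq_add_one, iterInt_succ, intervalIntegral.integral_same, neg_zero]

theorem matrix_one_homog [FinGr 𝕜 R] (lev : Fin N → ℤ) (α β : Fin N) :
    IsHomog 𝕜 (lev β - lev α) ((1 : Matrix (Fin N) (Fin N) R) α β) := by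
  rw [Matrix.one_apply]
  split_ifs with h
  · subst h
    exact FinGr.one_homog.congr (by ring)
  · exact IsHomog.zero

theorem matrix_mul_homog [FinGr 𝕜 R] {n : Type} [Fintype n] {l₁ l₂ l₃ : n → ℤ} {A X : Matrix n n R}
    (hA : ∀ α β, IsHomog 𝕜 (l₂ β - l₁ α) (A α β)) (hX : ∀ α β, IsHomog 𝕜 (l₃ β - l₂ α) (X α β))
    (α β : n) : IsHomog 𝕜 (l₃ β - l₁ α) ((A * X) α β) := by
  rw [Matrix.mul_apply]
  exact IsHomog.sum fun γ _ => ((hA α γ).mul (hX γ β)).congr (by ring)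

theorem iterInt_homog [FinGr 𝕜 R] (lev : Fin N → ℤ)
    (h : ∀ u ∈ Icc a b, ∀ α β, IsHomog 𝕜 (lev β - lev α) (A u α β)) (q : ℕ) :
    ∀ t ∈ Icc a b, ∀ α β, IsHomog 𝕜 (lev β - lev α) (iterInt 𝕜 A a q t α β) := by
  induction q with
  | zero => intro t _ α β; exact matrix_one_homog lev α β
  | succ q ih =>
    intro t ht α β i hi
    by_contra hd
    apply hi
    change cf 𝕜 _ i = 0
    rw [iterInt_succ, intervalIntegral.integral_congr (g := fun _ => 0),
      intervalIntegral.integral_zero, neg_zero]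
    intro u hu
    rw [uIcc_of_le ht.1] at hu
    have hu' : u ∈ Icc a b := ⟨hu.1, hu.2.trans ht.2⟩
    exact (matrix_mul_homog (h u hu') (ih u hu') α β).cf_eq_zero hd

theorem pexp_homog [FinGr 𝕜 R] (lev : Fin N → ℤ) (hab : a ≤ b)
    (h : ∀ u ∈ Icc a b, ∀ α β, IsHomog 𝕜 (lev β - lev α) (A u α β)) (α β : Fin N) :
    IsHomog 𝕜 (lev β - lev α) (pexp 𝕜 A b a α β) := by
  intro i hi
  by_contra hd
  apply hi
  change cf 𝕜 _ i = 0
  rw [cf_pexp]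
  refine (tsum_congr fun q => ?_).trans tsum_zero
  exact (iterInt_homog lev h q b (right_mem_Icc.2 hab) α β).cf_eq_zero hd

variable [FinGr 𝕜 R]

theorem continuousOn_tr {D : ℕ} {S : Set ℝ} (hA : CoeffCts 𝕜 A S) :
    ContinuousOn (fun t => tr 𝕜 D (A t)) S :=
  continuousOn_pi.2 fun x => hA x.1 x.2.1 x.2.2

/-- Truncation turns the iterated integrals into Volterra iterates applied to the constant unit
matrix. This connects the definition of `pexp` with the Banach space theory. -/
theorem tr_iterInt (D : ℕ) (hab : a ≤ b) (hA : CoeffCts 𝕜 A (Icc a b)) (q : ℕ) (t : Icc a b) :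
    tr 𝕜 D (iterInt 𝕜 A a q t) = ((-1 : ℝ) ^ q •
      (volterra (trMul 𝕜 R N D) hab (restr a b fun t => tr 𝕜 D (A t)))^[q]
        (ContinuousMap.const _ (tr 𝕜 D 1))) t := by
  induction q generalizing t with
  | zero => simp [iterInt]
  | succ q ih =>
    rw [Function.iterate_succ_apply', pow_succ, mul_smul, neg_one_smul, smul_neg,
      ← map_smul]
    funext x
    rw [tr, iterInt_succ, ContinuousMap.neg_apply, volterra_apply, Pi.neg_apply]
    congr 1
    have h := (ContinuousLinearMap.proj (R := ℝ) (φ := fun _ => 𝕜) x).intervalIntegral_comp_comm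
      (μ := MeasureTheory.volume)
      ((continuous_IccExtend hab (pointwise a b (trMul 𝕜 R N D)
      (restr a b fun t => tr 𝕜 D (A t)) ((-1 : ℝ) ^ q •
      (volterra (trMul 𝕜 R N D) hab (restr a b fun t => tr 𝕜 D (A t)))^[q]
        (ContinuousMap.const _ (tr 𝕜 D 1))))).intervalIntegrable a t)
    rw [ContinuousLinearMap.proj_apply] at h
    rw [← h]
    refine intervalIntegral.integral_congr fun u hu => ?_
    rw [uIcc_of_le t.2.1] at hu
    have hu' : u ∈ Icc a b := ⟨hu.1, hu.2.trans t.2.2⟩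
    simp only [ContinuousLinearMap.proj_apply]
    rw [IccExtend_of_mem hab _ hu', pointwise_apply, ← ih ⟨u, hu'⟩,
      restr_apply (continuousOn_tr hA), trMul_tr]
    rfl

/-- The coefficient series in `pexp` are evaluations of a convergent Neumann series. The `tsum` is
thus a genuine sum and not the default value of a divergent series. -/
theorem tr_pexp (D : ℕ) (hab : a ≤ b) (hA : CoeffCts 𝕜 A (Icc a b)) (t : Icc a b) :
    tr 𝕜 D (pexp 𝕜 A t a) = volterraSol (trMul 𝕜 R N D) hab (tr 𝕜 D 1)
      (restr a b fun t => tr 𝕜 D (A t)) t := by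
  have h := volterraSol_hasSum (trMul 𝕜 R N D) hab (tr 𝕜 D 1) (restr a b fun t => tr 𝕜 D (A t))
  have h1 := (ContinuousMap.evalCLM (M := Trunc 𝕜 R N D) ℝ t).hasSum h
  funext x
  have h2 := (ContinuousLinearMap.proj (R := ℝ) (φ := fun _ => 𝕜) x).hasSum h1
  have h3 := h2.tsum_eq
  rw [tr, cf_pexp]
  refine Eq.trans (tsum_congr fun q => ?_) h3
  have := congrFun (tr_iterInt D hab hA q t) x
  exact this

/-- The differential equation `U' = -A U`. -/
theorem hasDWithin_pexp (hab : a ≤ b) (hA : CoeffCts 𝕜 A (Icc a b)) (ht : t ∈ Icc a b) (α β) :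
    HasDWithin 𝕜 (fun t => pexp 𝕜 A t a α β) (-(A t * pexp 𝕜 A t a) α β) (Icc a b) t := by
  intro i
  -- Truncating at the degree of the index under consideration loses nothing for that coefficient;
  -- the truncation depends on the index, and no uniformity is needed.
  set D := GrAlg.deg (𝕜 := 𝕜) i with hD
  have h := volterraSol_add (trMul 𝕜 R N D) hab (tr 𝕜 D 1) (restr a b fun t => tr 𝕜 D (A t))
  rw [← add_zero (volterraSol _ _ _ _ + _), ← map_zero (primitive (Trunc 𝕜 R N D) hab)] at h
  have h' := hasDerivWithinAt_of_add_volterra (trMul 𝕜 R N D) hab h ⟨t, ht⟩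
  have h2 := hasDerivWithinAt_pi.1 h' (α, β, ⟨i, le_rfl⟩)
  refine (h2.congr (fun τ hτ => ?_) ?_).congr_deriv ?_
  · rw [IccExtend_of_mem hab _ hτ, ← tr_pexp D hab hA ⟨τ, hτ⟩]; rfl
  · rw [IccExtend_of_mem hab _ ht, ← tr_pexp D hab hA ⟨t, ht⟩]; rfl
  · rw [← tr_pexp D hab hA ⟨t, ht⟩, restr_apply (continuousOn_tr hA), trMul_tr,
      ContinuousMap.zero_apply, sub_zero, Pi.neg_apply]
    exact (cf_neg _ _).symm

theorem eq_zero_of_hasDWithin (hA : CoeffCts 𝕜 A (Icc a b)) {X : ℝ → Matrix (Fin N) (Fin N) R}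
    (hX : ∀ t ∈ Icc a b, ∀ α β, HasDWithin 𝕜 (fun t => X t α β) ((A t * X t) α β) (Icc a b) t)
    (h0 : X a = 0) (ht : t ∈ Icc a b) : X t = 0 := by
  ext α β
  refine cf_ext (𝕜 := 𝕜) fun i => ?_
  set D := GrAlg.deg (𝕜 := 𝕜) i with hD
  have h := eq_zero_of_linear_ode (trMul 𝕜 R N D) (continuousOn_tr hA)
    (u := fun t => tr 𝕜 D (X t)) (fun t ht => ?_) ?_ t ht
  · exact (congrFun h (α, β, ⟨i, le_rfl⟩)).trans (cf_zero i).symm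
  · rw [trMul_tr]
    exact hasDerivWithinAt_pi.2 fun x => hX t ht x.1 x.2.1 x.2.2
  · rw [h0]; ext x; simp [tr]

/-- The difference of the two sides solves the same homogeneous linear equation and vanishes at `a`.
Composition of exponentials and all identifications of blocks below are instances of this
uniqueness. -/
theorem eq_pexp_mul (hab : a ≤ b) (hA : CoeffCts 𝕜 A (Icc a b)) {X : ℝ → Matrix (Fin N) (Fin N) R}
    (hX : ∀ t ∈ Icc a b, ∀ α β, HasDWithin 𝕜 (fun t => X t α β) (-(A t * X t) α β) (Icc a b) t)
    (ht : t ∈ Icc a b) : X t = pexp 𝕜 A t a * X a := by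
  rw [← sub_eq_zero]
  refine eq_zero_of_hasDWithin (𝕜 := 𝕜) (A := fun t => -A t) (X := fun t => X t - pexp 𝕜 A t a * X a)
    (fun α β i => ?_) (fun t ht α β => ?_) ?_ ht
  · exact (hA α β i).neg.congr fun t _ => by simp
  · have h2 : HasDWithin 𝕜 (fun t => (pexp 𝕜 A t a * X a) α β)
        (∑ γ, -(A t * pexp 𝕜 A t a) α γ * X a γ β) (Icc a b) t := by
      simp only [Matrix.mul_apply (M := pexp 𝕜 A _ _)]
      exact HasDWithin.sum fun γ _ => (hasDWithin_pexp hab hA ht α γ).mul_const _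
    refine ((hX t ht α β).sub h2).congr_deriv ?_
    have : ∑ γ, -(A t * pexp 𝕜 A t a) α γ * X a γ β = -(A t * (pexp 𝕜 A t a * X a)) α β := by
      rw [← mul_assoc, Matrix.mul_apply (M := A t * _), ← Finset.sum_neg_distrib]
      exact Finset.sum_congr rfl fun γ _ => neg_mul _ _
    rw [this, Matrix.neg_mul, mul_sub, Matrix.neg_apply, Matrix.sub_apply]
    abel
  · rw [pexp_self, one_mul, sub_self]

theorem pexp_unique (hab : a ≤ b) (hA : CoeffCts 𝕜 A (Icc a b)) {X : ℝ → Matrix (Fin N) (Fin N) R}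
    (hX : ∀ t ∈ Icc a b, ∀ α β, HasDWithin 𝕜 (fun t => X t α β) (-(A t * X t) α β) (Icc a b) t)
    (h1 : X a = 1) (ht : t ∈ Icc a b) : X t = pexp 𝕜 A t a := by
  rw [eq_pexp_mul hab hA hX ht, h1, mul_one]

theorem pexp_mul_pexp (hab : a ≤ b) (hbc : b ≤ c) (hA : CoeffCts 𝕜 A (Icc a c)) :
    pexp 𝕜 A c b * pexp 𝕜 A b a = pexp 𝕜 A c a := by
  have h : Icc b c ⊆ Icc a c := Icc_subset_Icc_left hab
  exact (eq_pexp_mul (X := fun t => pexp 𝕜 A t a) hbc (hA.mono h)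
    (fun t ht α β => (hasDWithin_pexp (hab.trans hbc) hA (h ht) α β).mono h)
    (right_mem_Icc.2 hbc)).symm

/-! #### Parameters -/

variable {S : Type} [NormedAddCommGroup S] [NormedSpace ℝ S] {P : Set S}

variable (𝕜) in
/-- Coefficientwise directional derivative within `P`. -/
def pdir (P : Set S) (F : S → R) (p e : S) : R :=
  (GrAlg.coeff (𝕜 := 𝕜)).symm fun i => fderivWithin ℝ (fun p => cf 𝕜 (F p) i) P p e

variable (𝕜) in
/-- Smoothness of all coefficients. -/
def SmoothOn (F : S → R) (P : Set S) : Prop :=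
  ∀ i : GrAlg.Idx 𝕜 R, ContDiffOn ℝ ∞ (fun p => cf 𝕜 (F p) i) P

theorem cf_pdir (F : S → R) (p e : S) (i) :
    cf 𝕜 (pdir 𝕜 P F p e) i = fderivWithin ℝ (fun p => cf 𝕜 (F p) i) P p e := by
  rw [pdir, cf_symm]

variable {F : ℝ → S → Matrix (Fin N) (Fin N) R}

theorem coeffCts_of_smoothOn
    (hF : ∀ α β, SmoothOn 𝕜 (fun q : ℝ × S => F q.1 q.2 α β) (Icc a b ×ˢ P)) {p : S} (hp : p ∈ P) :
    CoeffCts 𝕜 (fun t => F t p) (Icc a b) :=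
  fun α β i => continuousOn_slice (hF α β i).continuousOn hp

theorem SmoothOn.slice {G : ℝ → S → R} (hG : SmoothOn 𝕜 (fun q : ℝ × S => G q.1 q.2) (Icc a b ×ˢ P))
    (ht : t ∈ Icc a b) : SmoothOn 𝕜 (G t) P := fun i =>
  (hG i).comp (f := fun p => (t, p)) (contDiff_prodMk_right t).contDiffOn fun _ hp => ⟨ht, hp⟩

/-- The parameter derivative of U' = -AU. Both claims are proved for each truncation by
`exists_linear_ode` and then read off coefficient by coefficient. -/
theorem smoothOn_pexp_and_hasDWithin_pdir (hab : a < b) (hP : Convex ℝ P) (hu : UniqueDiffOn ℝ P)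
    (hF : ∀ α β, SmoothOn 𝕜 (fun q : ℝ × S => F q.1 q.2 α β) (Icc a b ×ˢ P)) :
    (∀ t ∈ Icc a b, ∀ α β, SmoothOn 𝕜 (fun p => pexp 𝕜 (fun t => F t p) t a α β) P) ∧
    ∀ p ∈ P, ∀ e, ∀ t ∈ Icc a b, ∀ α β,
      HasDWithin 𝕜 (fun t => pdir 𝕜 P (fun p => pexp 𝕜 (fun t => F t p) t a α β) p e)
        (-∑ γ, F t p α γ * pdir 𝕜 P (fun p => pexp 𝕜 (fun t => F t p) t a γ β) p e -
          ∑ γ, pdir 𝕜 P (fun p => F t p α γ) p e * pexp 𝕜 (fun t => F t p) t a γ β)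
        (Icc a b) t := by
  have key : ∀ D : ℕ, ∃ u : ℝ → S → Trunc 𝕜 R N D,
      (∀ p ∈ P, ∀ t ∈ Icc a b, u t p = tr 𝕜 D (pexp 𝕜 (fun t => F t p) t a)) ∧
      (∀ t ∈ Icc a b, ContDiffOn ℝ ∞ (u t) P) ∧
      ∀ p ∈ P, ∀ e : S, ∀ t ∈ Icc a b,
        HasDerivWithinAt (fun t => fderivWithin ℝ (u t) P p e)
          (-(trMul 𝕜 R N D (tr 𝕜 D (F t p)) (fderivWithin ℝ (u t) P p e)) -
            trMul 𝕜 R N D (fderivWithin ℝ (fun p => tr 𝕜 D (F t p)) P p e) (u t p))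
          (Icc a b) t := by
    intro D
    obtain ⟨u, h1, h2, -, h4⟩ := exists_linear_ode hab hP hu (trMul 𝕜 R N D)
      (A := fun q => tr 𝕜 D (F q.1 q.2)) (contDiffOn_pi.2 fun x => hF x.1 x.2.1 x.2.2) (tr 𝕜 D 1)
    refine ⟨u, fun p hp t ht => ?_, h2, fun p hp e => (h4 p hp e).2⟩
    rw [h1 p hp t ht, ← tr_pexp D hab.le (coeffCts_of_smoothOn hF hp) ⟨t, ht⟩]
  -- The Fréchet derivative of a truncation is the truncation of the coefficientwise derivative;
  -- this translates the Banach space statement back.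
  have hfd : ∀ (D : ℕ) (u : S → Trunc 𝕜 R N D) (G : S → Matrix (Fin N) (Fin N) R),
      (∀ p ∈ P, u p = tr 𝕜 D (G p)) → ContDiffOn ℝ ∞ u P → ∀ p ∈ P, ∀ e,
      fderivWithin ℝ u P p e = tr 𝕜 D (Matrix.of fun α β => pdir 𝕜 P (fun p => G p α β) p e) := by
    intro D u G huG hud p hp e
    funext x
    rw [tr, Matrix.of_apply, cf_pdir]
    have h1 := hasFDerivWithinAt_pi'.1
      (hud.differentiableOn (by simp) p hp).hasFDerivWithinAt x
    have h2 : HasFDerivWithinAt (fun p => cf 𝕜 (G p x.1 x.2.1) x.2.2) _ P p :=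
      h1.congr (fun q hq => (congrFun (huG q hq) x).symm) (congrFun (huG p hp) x).symm
    rw [h2.fderivWithin (hu p hp)]
    rfl
  constructor
  · intro t ht α β i
    obtain ⟨u, h1, h2, -⟩ := key (GrAlg.deg (𝕜 := 𝕜) i)
    exact (contDiffOn_pi.1 (h2 t ht) (α, β, ⟨i, le_rfl⟩)).congr fun p hp => by
      rw [h1 p hp t ht]; rfl
  · intro p hp e t ht α β i
    set D := GrAlg.deg (𝕜 := 𝕜) i with hD
    obtain ⟨u, h1, h2, h3⟩ := key D
    have h4 : ∀ τ ∈ Icc a b, fderivWithin ℝ (u τ) P p e = tr 𝕜 D (Matrix.of fun α β =>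
        pdir 𝕜 P (fun p => pexp 𝕜 (fun t => F t p) τ a α β) p e) := fun τ hτ =>
      hfd D (u τ) _ (fun q hq => h1 q hq τ hτ) (h2 τ hτ) p hp e
    have h5 := hfd D (fun p => tr 𝕜 D (F t p)) (F t) (fun _ _ => rfl)
      (contDiffOn_pi.2 fun x =>
        SmoothOn.slice (G := fun t p => F t p x.1 x.2.1) (hF x.1 x.2.1) ht x.2.2) p hp e
    have h6 := h3 p hp e t ht
    rw [h4 t ht, h5, h1 p hp t ht, trMul_tr, trMul_tr, ← tr_neg, ← tr_sub] at h6
    refine ((hasDerivWithinAt_pi.1 h6 (α, β, ⟨i, le_rfl⟩)).congr (fun τ hτ => ?_) ?_).congr_deriv ?_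
    · rw [h4 τ hτ]; rfl
    · rw [h4 t ht]; rfl
    · simp only [tr, Matrix.sub_apply, Matrix.neg_apply, Matrix.mul_apply, Matrix.of_apply, cf]

end Pexp

/-! ### The part without the additional odd variable -/

section Fst

variable {𝕜 : Type} [RCLike 𝕜] {R : Type} [Ring R] [Algebra 𝕜 R] [GrAlg 𝕜 R] {N : ℕ}

theorem fst_sum {ι : Type*} (s : Finset ι) (f : ι → OddExt 𝕜 R) :
    (∑ k ∈ s, f k).fst = ∑ k ∈ s, (f k).fst := by
  classical
  induction s using Finset.induction_on with
  | empty => simp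
  | insert a s ha ih => simp [Finset.sum_insert ha, ih]

theorem snd_sum {ι : Type*} (s : Finset ι) (f : ι → OddExt 𝕜 R) :
    (∑ k ∈ s, f k).snd = ∑ k ∈ s, (f k).snd := by
  classical
  induction s using Finset.induction_on with
  | empty => simp
  | insert a s ha ih => simp [Finset.sum_insert ha, ih]

theorem map_fst_mul (A X : Matrix (Fin N) (Fin N) (OddExt 𝕜 R)) :
    (A * X).map OddExt.fst = A.map OddExt.fst * X.map OddExt.fst := by
  ext α β
  simp [Matrix.mul_apply, fst_sum]

theorem map_fst_one : (1 : Matrix (Fin N) (Fin N) (OddExt 𝕜 R)).map OddExt.fst = 1 := by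
  ext α β
  by_cases h : α = β <;> simp [Matrix.one_apply, h]

theorem map_fst_iterInt (A : ℝ → Matrix (Fin N) (Fin N) (OddExt 𝕜 R)) (a : ℝ) (q : ℕ) (t : ℝ) :
    (iterInt 𝕜 A a q t).map OddExt.fst = iterInt 𝕜 (fun t => (A t).map OddExt.fst) a q t := by
  induction q generalizing t with
  | zero => exact map_fst_one
  | succ q ih =>
    ext α β
    refine cf_ext (𝕜 := 𝕜) fun i => ?_
    rw [Matrix.map_apply, ← cf_inl, iterInt_succ, iterInt_succ]
    simp only [← ih, ← map_fst_mul]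
    rfl

/-- No convergence is needed: the coefficients of the first component are those with index
`Sum.inl`, so both sides consist of the same integrals and series. This is what restricts a homotopy
to ϑ = 0. -/
theorem map_fst_pexp (A : ℝ → Matrix (Fin N) (Fin N) (OddExt 𝕜 R)) (b a : ℝ) :
    (pexp 𝕜 A b a).map OddExt.fst = pexp 𝕜 (fun t => (A t).map OddExt.fst) b a := by
  ext α β
  refine cf_ext (𝕜 := 𝕜) fun i => ?_
  rw [Matrix.map_apply, ← cf_inl, cf_pexp, cf_pexp]
  simp only [← map_fst_iterInt]
  rfl

end Fst

/-! ### Matrices over a graded algebra -/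

section MatrixCalculus

variable {𝕜 : Type} [RCLike 𝕜] {R : Type} [Ring R] [Algebra 𝕜 R] [GrAlg 𝕜 R] {n : Type}

variable (𝕜) in
/-- The parity involution applied to every entry. -/
def parM (A : Matrix n n R) : Matrix n n R := A.map (GrAlg.par (𝕜 := 𝕜))

theorem parM_apply (A : Matrix n n R) (α β) : parM 𝕜 A α β = GrAlg.par (𝕜 := 𝕜) (A α β) := rfl

theorem parM_neg (A : Matrix n n R) : parM 𝕜 (-A) = -parM 𝕜 A := by
  ext; simp [parM]

theorem parM_one [DecidableEq n] : parM 𝕜 (1 : Matrix n n R) = 1 := by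
  ext α β
  rw [parM_apply, Matrix.one_apply]
  split_ifs <;> simp

theorem parM_mul [Fintype n] (A X : Matrix n n R) : parM 𝕜 (A * X) = parM 𝕜 A * parM 𝕜 X := by
  ext; simp [parM, Matrix.mul_apply]

theorem parM_parM (A : Matrix n n R) : parM 𝕜 (parM 𝕜 A) = A := by
  ext; simp [parM, OddExt.par_par]

variable (𝕜) in
/-- Entrywise coefficientwise derivative. -/
def HasMD (X : ℝ → Matrix n n R) (X' : Matrix n n R) (S : Set ℝ) (t : ℝ) : Prop :=
  ∀ α β, HasDWithin 𝕜 (fun t => X t α β) (X' α β) S t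

namespace HasMD

variable {X Y : ℝ → Matrix n n R} {X' Y' : Matrix n n R} {S : Set ℝ} {t : ℝ}

theorem const (A : Matrix n n R) : HasMD 𝕜 (fun _ => A) 0 S t := fun _ _ => HasDWithin.const _

theorem add (hX : HasMD 𝕜 X X' S t) (hY : HasMD 𝕜 Y Y' S t) :
    HasMD 𝕜 (fun t => X t + Y t) (X' + Y') S t := fun α β => (hX α β).add (hY α β)

theorem sub (hX : HasMD 𝕜 X X' S t) (hY : HasMD 𝕜 Y Y' S t) :
    HasMD 𝕜 (fun t => X t - Y t) (X' - Y') S t := fun α β => (hX α β).sub (hY α β)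

theorem par (hX : HasMD 𝕜 X X' S t) : HasMD 𝕜 (fun t => parM 𝕜 (X t)) (parM 𝕜 X') S t :=
  fun α β => (hX α β).par

theorem mono {S' : Set ℝ} (hX : HasMD 𝕜 X X' S t) (h : S' ⊆ S) : HasMD 𝕜 X X' S' t :=
  fun α β => (hX α β).mono h

theorem congr_deriv (hX : HasMD 𝕜 X X' S t) (h : X' = Y') : HasMD 𝕜 X Y' S t := h ▸ hX

theorem mul [FinGr 𝕜 R] [Fintype n] (hX : HasMD 𝕜 X X' S t) (hY : HasMD 𝕜 Y Y' S t) :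
    HasMD 𝕜 (fun t => X t * Y t) (X' * Y t + X t * Y') S t := by
  intro α β
  simp only [Matrix.mul_apply, Matrix.add_apply]
  rw [← Finset.sum_add_distrib]
  exact HasDWithin.sum fun γ _ => (hX α γ).mul (hY γ β)

theorem mul_const [FinGr 𝕜 R] [Fintype n] (hX : HasMD 𝕜 X X' S t) (A : Matrix n n R) :
    HasMD 𝕜 (fun t => X t * A) (X' * A) S t := by
  simpa using hX.mul (const (S := S) (t := t) A)

end HasMD

theorem IsHomog.odd_mul [FinGr 𝕜 R] {q : ℤ} {w x : R} (hw : IsHomog 𝕜 1 w) (hx : IsHomog 𝕜 q x) :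
    w * x = GrAlg.par (𝕜 := 𝕜) x * w := by
  rw [hx.par_eq, sg_mul, FinGr.comm (𝕜 := 𝕜) 1 q w x hw hx, one_mul]

end MatrixCalculus

/-! ### Linear maps and path ordered exponentials -/

section MapPexp

variable {𝕜 : Type} [RCLike 𝕜] {R R' : Type} [Ring R] [Algebra 𝕜 R] [GrAlg 𝕜 R] [FinGr 𝕜 R]
  [Ring R'] [Algebra 𝕜 R'] [GrAlg 𝕜 R'] [FinGr 𝕜 R'] {N : ℕ} {a b : ℝ}
  {A : ℝ → Matrix (Fin N) (Fin N) R}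

/-- Linear maps that are multiplicative on homogeneous elements respect path ordered
exponentials. -/
theorem map_pexp (φ : R →ₗ[𝕜] R') (h1 : φ 1 = 1)
    (hmul : ∀ (p q : ℤ) (x y : R), IsHomog 𝕜 p x → IsHomog 𝕜 q y → φ (x * y) = φ x * φ y)
    (hab : a ≤ b) (hA : CoeffCts 𝕜 A (Icc a b)) (lev : Fin N → ℤ)
    (hlev : ∀ t ∈ Icc a b, ∀ α β, IsHomog 𝕜 (lev β - lev α) (A t α β)) :
    CoeffCts 𝕜 (fun t => (A t).map φ) (Icc a b) ∧
    (pexp 𝕜 A b a).map φ = pexp 𝕜 (fun t => (A t).map φ) b a := by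
  have hc : CoeffCts 𝕜 (fun t => (A t).map φ) (Icc a b) := by
    intro α β i
    refine (continuousOn_finsetSum (degSet (𝕜 := 𝕜) (R := R) (lev β - lev α)) fun j _ =>
      (hA α β j).mul (continuousOn_const (c := cf 𝕜 (φ (bas 𝕜 j)) i))).congr fun t ht => ?_
    exact (hlev t ht α β).cf_map φ i
  have hU : ∀ t ∈ Icc a b, ∀ α β, IsHomog 𝕜 (lev β - lev α) (pexp 𝕜 A t a α β) :=
    fun t ht => pexp_homog lev ht.1 fun u hu => hlev u ⟨hu.1, hu.2.trans ht.2⟩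
  -- The image of the exponential solves the equation with the mapped exponent. Multiplicativity is
  -- only used on entries of `A` and of the exponential, and both are homogeneous.
  refine ⟨hc, pexp_unique (X := fun t => (pexp 𝕜 A t a).map φ) hab hc (fun t ht α β => ?_) ?_
    (right_mem_Icc.2 hab)⟩
  · refine ((hasDWithin_pexp hab hA ht α β).map φ (fun u hu => hU u hu α β) ht
      (by exact (matrix_mul_homog (hlev t ht) (hU t ht) α β).neg)).congr_deriv ?_
    simp only [Matrix.neg_apply, Matrix.mul_apply, map_neg, map_sum, Matrix.map_apply,
      hmul _ _ _ _ (hlev t ht _ _) (hU t ht _ _)]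
  · rw [pexp_self]
    ext α β
    rw [Matrix.map_apply, Matrix.one_apply, Matrix.one_apply]
    split_ifs
    · exact h1
    · exact map_zero φ

end MapPexp

/-! ### Vector fields of degree one at a point -/

section LocalField

variable {𝕜 : Type} [RCLike 𝕜] {R : Type} [Ring R] [Algebra 𝕜 R] [GrAlg 𝕜 R] [FinGr 𝕜 R]
  {S : Type} [NormedAddCommGroup S] [NormedSpace ℝ S] {P : Set S} {p : S}

variable (𝕜 R S) in
/-- The value at a point of a vector field of degree one: `∑_a w_a ∂_{e_a} + δ` with odd functions
`w_a` and an odd derivation `δ`. -/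
structure LocalField where
  ι : Type
  [fin : Fintype ι]
  w : ι → R
  e : ι → S
  δ : R →ₗ[𝕜] R
  w_homog : ∀ a, IsHomog 𝕜 1 (w a)
  δ_homog : ∀ (q : ℤ) (x : R), IsHomog 𝕜 q x → IsHomog 𝕜 (q + 1) (δ x)
  δ_mul : ∀ (q : ℤ) (x y : R), IsHomog 𝕜 q x → δ (x * y) = δ x * y + GrAlg.par (𝕜 := 𝕜) x * δ y

attribute [instance] LocalField.fin

theorem pdir_congr {F G : S → R} (h : ∀ q ∈ P, F q = G q) (hp : p ∈ P) (e : S) :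
    pdir 𝕜 P F p e = pdir 𝕜 P G p e := by
  refine cf_ext (𝕜 := 𝕜) fun i => ?_
  rw [cf_pdir, cf_pdir, fderivWithin_congr (fun q hq => by rw [h q hq]) (by rw [h p hp])]

theorem pdir_const (a : R) (e : S) : pdir 𝕜 P (fun _ => a) p e = 0 := by
  refine cf_ext (𝕜 := 𝕜) fun i => ?_
  rw [cf_pdir, fderivWithin_fun_const]
  simp

theorem SmoothOn.hasFDerivWithinAt {F : S → R} (hF : SmoothOn 𝕜 F P) (hp : p ∈ P)
    (i : GrAlg.Idx 𝕜 R) : HasFDerivWithinAt (fun p => cf 𝕜 (F p) i)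
      (fderivWithin ℝ (fun p => cf 𝕜 (F p) i) P p) P p :=
  ((hF i).differentiableOn (by simp) p hp).hasFDerivWithinAt

theorem SmoothOn.mul {F G : S → R} (hF : SmoothOn 𝕜 F P) (hG : SmoothOn 𝕜 G P) :
    SmoothOn 𝕜 (fun p => F p * G p) P := by
  intro i
  obtain ⟨κ, _, j, k, c, -, hc⟩ := FinGr.mul_coeff (𝕜 := 𝕜) (R := R) i
  simp only [cf, hc]
  exact ContDiffOn.sum fun l _ => contDiffOn_const.mul ((hF (j l)).mul (hG (k l)))

theorem pdir_mul (hu : UniqueDiffOn ℝ P) (hp : p ∈ P) {F G : S → R} (hF : SmoothOn 𝕜 F P)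
    (hG : SmoothOn 𝕜 G P) (e : S) : pdir 𝕜 P (fun p => F p * G p) p e =
      pdir 𝕜 P F p e * G p + F p * pdir 𝕜 P G p e := by
  refine cf_ext (𝕜 := 𝕜) fun i => ?_
  obtain ⟨κ, _, j, k, c, -, hc⟩ := FinGr.mul_coeff (𝕜 := 𝕜) (R := R) i
  rw [cf_pdir, cf_add]
  simp only [cf, hc]
  have h := HasFDerivWithinAt.fun_sum (u := Finset.univ) fun l _ =>
    ((hF.hasFDerivWithinAt hp (j l)).mul (hG.hasFDerivWithinAt hp (k l))).const_mul (c l)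
  rw [show fderivWithin ℝ (fun p => ∑ l, c l * (GrAlg.coeff (𝕜 := 𝕜) (F p) (j l) *
    GrAlg.coeff (𝕜 := 𝕜) (G p) (k l))) P p = _ from h.fderivWithin (hu p hp), ← Finset.sum_add_distrib, sum_apply]
  refine Finset.sum_congr rfl fun l _ => ?_
  have h1 := cf_pdir (𝕜 := 𝕜) (P := P) F p e (j l)
  have h2 := cf_pdir (𝕜 := 𝕜) (P := P) G p e (k l)
  simp only [cf] at h1 h2 ⊢
  rw [h1, h2]
  simp only [FunLike.coe_smul, FunLike.coe_add, Pi.smul_apply, Pi.add_apply, smul_eq_mul]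
  ring

theorem pdir_add (hu : UniqueDiffOn ℝ P) (hp : p ∈ P) {F G : S → R} (hF : SmoothOn 𝕜 F P)
    (hG : SmoothOn 𝕜 G P) (e : S) : pdir 𝕜 P (fun p => F p + G p) p e =
      pdir 𝕜 P F p e + pdir 𝕜 P G p e := by
  refine cf_ext (𝕜 := 𝕜) fun i => ?_
  rw [cf_pdir, cf_add, cf_pdir, cf_pdir]
  simp only [cf_add]
  rw [((hF.hasFDerivWithinAt hp i).fun_add (hG.hasFDerivWithinAt hp i)).fderivWithin (hu p hp)]
  rfl

theorem pdir_homog {F : S → R} {q : ℤ} (hF : ∀ p ∈ P, IsHomog 𝕜 q (F p)) (hp : p ∈ P) (e : S) :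
    IsHomog 𝕜 q (pdir 𝕜 P F p e) := by
  intro i hi
  by_contra hq
  apply hi
  change cf 𝕜 _ i = 0
  rw [cf_pdir, fderivWithin_congr (f := fun _ => (0 : 𝕜))
    (fun r hr => (hF r hr).cf_eq_zero hq) ((hF p hp).cf_eq_zero hq), fderivWithin_fun_const]
  simp

namespace LocalField

variable (X : LocalField 𝕜 R S)

/-- The vector field applied to a function on `P`. -/
def app (P : Set S) (F : S → R) (p : S) : R := ∑ a, X.w a * pdir 𝕜 P F p (X.e a) + X.δ (F p)

theorem app_congr {F G : S → R} (h : ∀ q ∈ P, F q = G q) (hp : p ∈ P) :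
    X.app P F p = X.app P G p := by
  simp only [app, pdir_congr h hp, h p hp]

theorem δ_one : X.δ 1 = 0 := by
  have := X.δ_mul 0 1 1 FinGr.one_homog
  simpa using this

theorem app_add (hu : UniqueDiffOn ℝ P) (hp : p ∈ P) {F G : S → R} (hF : SmoothOn 𝕜 F P)
    (hG : SmoothOn 𝕜 G P) : X.app P (fun p => F p + G p) p = X.app P F p + X.app P G p := by
  simp only [app, pdir_add hu hp hF hG, map_add, mul_add, Finset.sum_add_distrib]
  abel

/-- The Leibniz rule. -/
theorem app_mul (hu : UniqueDiffOn ℝ P) (hp : p ∈ P) {F G : S → R} (hF : SmoothOn 𝕜 F P)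
    (hG : SmoothOn 𝕜 G P) {q : ℤ} (hq : IsHomog 𝕜 q (F p)) :
    X.app P (fun p => F p * G p) p =
      X.app P F p * G p + GrAlg.par (𝕜 := 𝕜) (F p) * X.app P G p := by
  simp only [app, pdir_mul hu hp hF hG, X.δ_mul q _ _ hq, mul_add, add_mul, Finset.sum_mul,
    Finset.mul_sum, Finset.sum_add_distrib]
  simp only [← mul_assoc, (X.w_homog _).odd_mul hq]
  abel

theorem app_homog {F : S → R} {q : ℤ} (hF : ∀ p ∈ P, IsHomog 𝕜 q (F p)) (hp : p ∈ P) :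
    IsHomog 𝕜 (q + 1) (X.app P F p) :=
  (IsHomog.sum fun a _ => ((X.w_homog a).mul (pdir_homog hF hp (X.e a))).congr
    (add_comm 1 q)).add (X.δ_homog q _ (hF p hp))

theorem app_const_one : X.app P (fun _ => 1) p = 0 := by
  simp [app, pdir_const, X.δ_one]

theorem app_const_zero : X.app P (fun _ => 0) p = 0 := by
  simp [app, pdir_const]

/-- The vector field applied to every entry. -/
def appM {n : Type} (P : Set S) (F : S → Matrix n n R) (p : S) : Matrix n n R :=
  Matrix.of fun α β => X.app P (fun p => F p α β) p

variable {N : ℕ} {a b : ℝ} {F : ℝ → S → Matrix (Fin N) (Fin N) R}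

/-- The vector field commutes with ∂_t, so the Leibniz rule is applied to U' = -AU. The odd
coefficients and the odd derivation pass `F` at the cost of its parity, whence `parM`. -/
theorem hasMD_appM_pexp (hab : a < b) (hP : Convex ℝ P) (hu : UniqueDiffOn ℝ P) (hp : p ∈ P)
    (hF : ∀ α β, SmoothOn 𝕜 (fun q : ℝ × S => F q.1 q.2 α β) (Icc a b ×ˢ P)) (lev : Fin N → ℤ)
    (hlev : ∀ t ∈ Icc a b, ∀ α β, IsHomog 𝕜 (lev β - lev α) (F t p α β)) {t : ℝ}
    (ht : t ∈ Icc a b) :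
    HasMD 𝕜 (fun t => X.appM P (fun p => pexp 𝕜 (fun t => F t p) t a) p)
      (-(X.appM P (F t) p * pexp 𝕜 (fun t => F t p) t a + parM 𝕜 (F t p) *
        X.appM P (fun p => pexp 𝕜 (fun t => F t p) t a) p)) (Icc a b) t := by
  intro α β
  obtain ⟨hs, hd⟩ := smoothOn_pexp_and_hasDWithin_pdir hab hP hu hF
  have hc := coeffCts_of_smoothOn hF hp
  have hU : ∀ t ∈ Icc a b, ∀ α β, IsHomog 𝕜 (lev β - lev α) (pexp 𝕜 (fun t => F t p) t a α β) :=
    fun t ht => pexp_homog lev ht.1 fun u hu => hlev u ⟨hu.1, hu.2.trans ht.2⟩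
  have h1 := (HasDWithin.sum (s := Finset.univ) fun k _ =>
    (hd p hp (X.e k) t ht α β).const_mul (X.w k)).add
    ((hasDWithin_pexp hab.le hc ht α β).map X.δ (fun u hu => hU u hu α β) ht
      (by exact (matrix_mul_homog (hlev t ht) (hU t ht) α β).neg))
  refine h1.congr_deriv ?_
  simp only [Matrix.neg_apply, Matrix.add_apply, Matrix.mul_apply, map_neg, map_sum,
    X.δ_mul _ _ _ (hlev t ht _ _), parM_apply, appM, Matrix.of_apply, app, mul_sub, mul_neg,
    Finset.mul_sum, Finset.sum_mul, mul_add, add_mul, Finset.sum_add_distrib,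
    Finset.sum_sub_distrib, Finset.sum_neg_distrib, ← mul_assoc,
    (X.w_homog _).odd_mul (hlev t ht _ _)]
  rw [Finset.sum_comm, Finset.sum_comm (f := fun k γ => X.w k * pdir 𝕜 P (fun p => F t p α γ) p
    (X.e k) * pexp 𝕜 (fun t => F t p) t a γ β)]
  abel

/-- The vector field on a path ordered exponential whose exponent satisfies
`X A = ∂_t B + par(A) B - B A`. -/
theorem appM_pexp (hab : a < b) (hP : Convex ℝ P) (hu : UniqueDiffOn ℝ P) (hp : p ∈ P)
    (hF : ∀ α β, SmoothOn 𝕜 (fun q : ℝ × S => F q.1 q.2 α β) (Icc a b ×ˢ P)) (lev : Fin N → ℤ)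
    (hlev : ∀ t ∈ Icc a b, ∀ α β, IsHomog 𝕜 (lev β - lev α) (F t p α β))
    {B : ℝ → Matrix (Fin N) (Fin N) R}
    (hB : ∀ t ∈ Icc a b, HasMD 𝕜 B (X.appM P (F t) p - parM 𝕜 (F t p) * B t + B t * F t p)
      (Icc a b) t) :
    X.appM P (fun p => pexp 𝕜 (fun t => F t p) b a) p =
      -(B b * pexp 𝕜 (fun t => F t p) b a) + parM 𝕜 (pexp 𝕜 (fun t => F t p) b a) * B a := by
  have hc := coeffCts_of_smoothOn hF hp
  set U := fun t => pexp 𝕜 (fun t => F t p) t a with hUdef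
  set dU := fun t => X.appM P (fun p => pexp 𝕜 (fun t => F t p) t a) p with hdU
  have hUd : ∀ t ∈ Icc a b, HasMD 𝕜 U (-(F t p * U t)) (Icc a b) t :=
    fun t ht α β => hasDWithin_pexp hab.le hc ht α β
  -- The combination Y = XU + BU - par(U)B(a) is chosen so that the hypothesis on `B` leaves Y' =
  -- -par(A)Y. It starts at zero because X annihilates the constant unit matrix.
  have h := eq_zero_of_hasDWithin (𝕜 := 𝕜) (A := fun t => -parM 𝕜 (F t p))
    (X := fun t => dU t + B t * U t - parM 𝕜 (U t) * B a) (a := a) (b := b) (t := b)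
    (fun α β i => ?_) (fun t ht => ?_) ?_ (right_mem_Icc.2 hab.le)
  · rw [← sub_eq_zero, ← h]
    abel
  · simp only [Matrix.neg_apply, parM_apply, cf_neg, cf_par]
    exact ((hc α β i).const_mul _).neg
  · have h1 := ((X.hasMD_appM_pexp hab hP hu hp hF lev hlev ht).add
      ((hB t ht).mul (hUd t ht))).sub ((hUd t ht).par.mul_const (B a))
    refine h1.congr_deriv ?_
    rw [parM_neg, parM_mul]
    noncomm_ring
  · have h1 : dU a = 0 := by
      ext α β
      simp only [hdU, appM, Matrix.of_apply, pexp_self, Matrix.one_apply, Matrix.zero_apply]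
      split_ifs
      · exact X.app_const_one
      · exact X.app_const_zero
    simp only [h1, hUdef, pexp_self, parM_one]
    simp

end LocalField

end LocalField

/-! ### Functions on the product of the test manifold with `T[1][0,1]` -/

section Functions

variable {𝕜 : Type} [RCLike 𝕜] {L : NQManifold 𝕜}

/-- A frame acting on functions `h + ϑ k`. -/
def frK (L : NQManifold 𝕜) (c : L.Chart) (y : L.Body) :
    OddExt 𝕜 L.Alg ≃ₗ[𝕜] OddExt 𝕜 L.Alg where
  toFun x := ⟨L.frame c y x.fst, L.frame c y x.snd⟩
  invFun x := ⟨(L.frame c y).symm x.fst, (L.frame c y).symm x.snd⟩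
  map_add' x x' := by ext1 <;> simp
  map_smul' r x := by ext1 <;> simp
  left_inv x := by ext1 <;> simp
  right_inv x := by ext1 <;> simp

theorem frK_fst (c : L.Chart) (y : L.Body) (x : OddExt 𝕜 L.Alg) :
    (frK L c y x).fst = L.frame c y x.fst := rfl

theorem frK_snd (c : L.Chart) (y : L.Body) (x : OddExt 𝕜 L.Alg) :
    (frK L c y x).snd = L.frame c y x.snd := rfl

theorem frK_homog {c : L.Chart} {y : L.Body} (hy : y ∈ (L.coord c).source) {p : ℤ}
    {x : OddExt 𝕜 L.Alg} : IsHomog 𝕜 p (frK L c y x) ↔ IsHomog 𝕜 p x := by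
  rw [OddExt.isHomog_iff, OddExt.isHomog_iff, frK_fst, frK_snd, L.frame_homog c y hy,
    L.frame_homog c y hy]

theorem frK_one (c : L.Chart) (y : L.Body) : frK L c y 1 = 1 := by
  ext1 <;> simp [frK_fst, frK_snd]

/-- The product of `OddExt` contains a parity involution. A frame preserves degrees, so on a
homogeneous first factor this involution is the same sign before and after the frame. -/
theorem frK_mul {c : L.Chart} {y : L.Body} (hy : y ∈ (L.coord c).source) {p : ℤ}
    {x : OddExt 𝕜 L.Alg} (hx : IsHomog 𝕜 p x) (x' : OddExt 𝕜 L.Alg) :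
    frK L c y (x * x') = frK L c y x * frK L c y x' := by
  have h := (OddExt.isHomog_iff.1 hx).1
  ext1
  · simp [frK_fst]
  · simp only [frK_snd, frK_fst, OddExt.snd_mul, map_add, map_mul]
    rw [((L.frame_homog c y hy p _).2 h).par_eq, h.par_eq, map_sg]

theorem frK_symm_mul {c : L.Chart} {y : L.Body} (hy : y ∈ (L.coord c).source) {p : ℤ}
    {x : OddExt 𝕜 L.Alg} (hx : IsHomog 𝕜 p x) (x' : OddExt 𝕜 L.Alg) :
    (frK L c y).symm (x * x') = (frK L c y).symm x * (frK L c y).symm x' := by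
  apply (frK L c y).injective
  rw [frK_mul hy ((frK_homog hy).1 (by simpa using hx))]
  simp

/-- The local representative of a function `h + ϑ k` in a chart. -/
def framed (c : L.Chart) (G : ℝ → L.Body → OddExt 𝕜 L.Alg)
    (q : ℝ × EuclideanSpace ℝ (Fin L.dim)) : OddExt 𝕜 L.Alg :=
  frK L c ((L.coord c).symm q.2) (G q.1 ((L.coord c).symm q.2))

/-- The part of `W` seen in a chart. -/
def chartSet (W : Set (ℝ × L.Body)) (c : L.Chart) : Set (ℝ × EuclideanSpace ℝ (Fin L.dim)) :=
  {q | q.2 ∈ (L.coord c).target ∧ (q.1, (L.coord c).symm q.2) ∈ W}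

/-- Open subsets of `[0,1] × L`. -/
def RelOpen (W : Set (ℝ × L.Body)) : Prop :=
  ∃ O : Set (ℝ × L.Body), IsOpen O ∧ W = O ∩ Icc 0 1 ×ˢ univ

/-- `G` is on `W` a function of degree `q`. -/
structure Fn (W : Set (ℝ × L.Body)) (q : ℤ) (G : ℝ → L.Body → OddExt 𝕜 L.Alg) : Prop where
  homog : ∀ x ∈ W, IsHomog 𝕜 q (G x.1 x.2)
  smooth : ∀ c, SmoothOn 𝕜 (framed c G) (chartSet W c)

theorem RelOpen.mem_Icc {W : Set (ℝ × L.Body)} (hW : RelOpen W) {x : ℝ × L.Body} (hx : x ∈ W) :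
    x.1 ∈ Icc (0 : ℝ) 1 := by
  obtain ⟨O, -, rfl⟩ := hW
  exact hx.2.1

theorem RelOpen.inter {W W' : Set (ℝ × L.Body)} (hW : RelOpen W) (hW' : RelOpen W') :
    RelOpen (W ∩ W') := by
  obtain ⟨O, hO, rfl⟩ := hW
  obtain ⟨O', hO', rfl⟩ := hW'
  refine ⟨O ∩ O', hO.inter hO', ?_⟩
  ext x; simp only [mem_inter_iff]; tauto

theorem RelOpen.isOpen_slice {W : Set (ℝ × L.Body)} (hW : RelOpen W) {s : ℝ}
    (hs : s ∈ Icc (0 : ℝ) 1) : IsOpen {y | (s, y) ∈ W} := by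
  obtain ⟨O, hO, rfl⟩ := hW
  have : {y : L.Body | (s, y) ∈ O ∩ Icc 0 1 ×ˢ univ} = (fun y => (s, y)) ⁻¹' O := by
    ext y; simp [hs.1, hs.2]
  rw [this]
  exact hO.preimage (by fun_prop)

theorem mem_source_of_mem_target {c : L.Chart} {z : EuclideanSpace ℝ (Fin L.dim)}
    (hz : z ∈ (L.coord c).target) : (L.coord c).symm z ∈ (L.coord c).source :=
  (L.coord c).map_target hz

namespace Fn

variable {W W' : Set (ℝ × L.Body)} {p q : ℤ} {F G : ℝ → L.Body → OddExt 𝕜 L.Alg}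

theorem congr (hF : Fn W q F) (h : ∀ x ∈ W, G x.1 x.2 = F x.1 x.2) : Fn W q G :=
  ⟨fun x hx => h x hx ▸ hF.homog x hx, fun c i => (hF.smooth c i).congr fun r hr => by
    rw [framed, framed, h _ hr.2]⟩

theorem congr_deg (hF : Fn W p F) (h : p = q) : Fn W q F := h ▸ hF

theorem zero : Fn W q (fun _ _ => (0 : OddExt 𝕜 L.Alg)) :=
  ⟨fun _ _ => IsHomog.zero, fun c i => by
    simp only [framed, map_zero, cf_zero]; exact contDiffOn_const⟩

theorem one : Fn W 0 (fun _ _ => (1 : OddExt 𝕜 L.Alg)) :=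
  ⟨fun _ _ => FinGr.one_homog, fun c i => by
    simp only [framed, frK_one]; exact contDiffOn_const⟩

theorem add (hF : Fn W q F) (hG : Fn W q G) : Fn W q (fun s y => F s y + G s y) :=
  ⟨fun x hx => (hF.homog x hx).add (hG.homog x hx), fun c i => by
    simp only [framed, map_add, cf_add]; exact (hF.smooth c i).add (hG.smooth c i)⟩

theorem neg (hF : Fn W q F) : Fn W q (fun s y => -F s y) :=
  ⟨fun x hx => (hF.homog x hx).neg, fun c i => by
    simp only [framed, map_neg, cf_neg]; exact (hF.smooth c i).neg⟩

theorem sgn (n : ℤ) (hF : Fn W q F) : Fn W q (fun s y => sg n (F s y)) := by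
  rcases sg_cases n with h | h <;> simp only [h]
  exacts [hF, hF.neg]

theorem sum {ι : Type*} {s : Finset ι} {F : ι → ℝ → L.Body → OddExt 𝕜 L.Alg}
    (h : ∀ k ∈ s, Fn W q (F k)) : Fn W q (fun r y => ∑ k ∈ s, F k r y) := by
  classical
  induction s using Finset.induction_on with
  | empty => simpa using zero
  | insert a s ha ih =>
    simp only [Finset.sum_insert ha]
    exact (h a (by simp)).add (ih fun k hk => h k (by simp [hk]))

theorem framed_mul (hF : Fn W p F) (c : L.Chart) {r : ℝ × EuclideanSpace ℝ (Fin L.dim)}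
    (hr : r ∈ chartSet W c) : framed c (fun s y => F s y * G s y) r = framed c F r * framed c G r :=
  frK_mul (mem_source_of_mem_target hr.1) (hF.homog _ hr.2) _

theorem mul (hF : Fn W p F) (hG : Fn W q G) : Fn W (p + q) (fun s y => F s y * G s y) :=
  ⟨fun x hx => (hF.homog x hx).mul (hG.homog x hx), fun c i =>
    ((hF.smooth c).mul (hG.smooth c) i).congr fun r hr => by rw [hF.framed_mul c hr]⟩

end Fn

/-- A convex neighbourhood in a chart. -/
theorem exists_box {W : Set (ℝ × L.Body)} (hW : RelOpen W) (c : L.Chart)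
    {q : ℝ × EuclideanSpace ℝ (Fin L.dim)} (hq : q ∈ chartSet W c) : ∃ ε > 0,
      (Icc 0 1 ∩ Metric.ball q.1 ε) ×ˢ Metric.ball q.2 ε ⊆ chartSet W c := by
  obtain ⟨O, hO, rfl⟩ := hW
  have h1 : ContinuousOn (fun r : ℝ × EuclideanSpace ℝ (Fin L.dim) => (r.1, (L.coord c).symm r.2))
      (univ ×ˢ (L.coord c).target) :=
    continuousOn_fst.prodMk ((L.coord c).continuousOn_symm.comp continuousOn_snd fun r hr => hr.2)
  have h2 := h1.isOpen_inter_preimage (isOpen_univ.prod (L.coord c).open_target) hO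
  obtain ⟨ε, hε, h3⟩ := Metric.isOpen_iff.1 h2 q ⟨⟨trivial, hq.1⟩, hq.2.1⟩
  refine ⟨ε, hε, fun r hr => ?_⟩
  have h4 : r ∈ Metric.ball q ε := by
    rw [← ball_prod_same]; exact ⟨hr.1.2, hr.2⟩
  exact ⟨(h3 h4).1.2, (h3 h4).2, hr.1.1, trivial⟩

/-- The box `([0,1] ∩ (s-ε, s+ε)) × B(z, ε)`. -/
def box {n : ℕ} (q : ℝ × EuclideanSpace ℝ (Fin n)) (ε : ℝ) :
    Set (ℝ × EuclideanSpace ℝ (Fin n)) := (Icc 0 1 ∩ Metric.ball q.1 ε) ×ˢ Metric.ball q.2 ε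

section Box

variable {n : ℕ} {q : ℝ × EuclideanSpace ℝ (Fin n)} {ε : ℝ}

theorem convex_box : Convex ℝ (box q ε) :=
  ((convex_Icc 0 1).inter (convex_ball _ _)).prod (convex_ball _ _)

theorem uniqueDiffOn_box : UniqueDiffOn ℝ (box q ε) :=
  ((uniqueDiffOn_Icc zero_lt_one).inter Metric.isOpen_ball).prod Metric.isOpen_ball.uniqueDiffOn

theorem mem_box (hε : 0 < ε) (hq : q.1 ∈ Icc (0 : ℝ) 1) : q ∈ box q ε :=
  ⟨⟨hq, Metric.mem_ball_self hε⟩, Metric.mem_ball_self hε⟩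

end Box

/-- The differential `d^y + d^s` at a point, in a chart. -/
theorem exists_localField (c : L.Chart) {z : EuclideanSpace ℝ (Fin L.dim)}
    (hz : z ∈ (L.coord c).target) :
    ∃ X : LocalField 𝕜 (OddExt 𝕜 L.Alg) (ℝ × EuclideanSpace ℝ (Fin L.dim)),
      ∀ (W : Set (ℝ × L.Body)), RelOpen W → ∀ (p : ℤ) (G : ℝ → L.Body → OddExt 𝕜 L.Alg) (s ε : ℝ),
        Fn W p G → (s, z) ∈ chartSet W c → 0 < ε → box (s, z) ε ⊆ chartSet W c →
        frK L c ((L.coord c).symm z) (dys L G s ((L.coord c).symm z)) =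
          X.app (box (s, z) ε) (framed c G) (s, z) ∧
        HasDWithin 𝕜 (fun s' => (G s' ((L.coord c).symm z)).fst)
          (dWithin 𝕜 (Icc 0 1) (fun s' => (G s' ((L.coord c).symm z)).fst) s) (Icc 0 1) s := by
  obtain ⟨v, δ, hv, -, hδ, hδm, -, hQ⟩ := L.Q_local c
  -- The index `none` carries ϑ∂_s, with odd coefficient ϑ and direction (1, 0); the indices `some
  -- a` carry the body part of d^y. The derivation acquires a minus sign on the ϑ-coefficient
  -- because it moves past ϑ. The field depends on the chart and the point only, so one field serves
  -- all functions.
  refine ⟨{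
    ι := Option (Fin L.dim)
    w := fun a => a.elim ⟨0, 1⟩ fun a => ⟨v a z, 0⟩
    e := fun a => a.elim (1, 0) fun a => (0, EuclideanSpace.single a 1)
    δ := { toFun := fun x => ⟨δ z x.fst, -δ z x.snd⟩
           map_add' := fun x x' => by ext1 <;> simp; abel
           map_smul' := fun r x => by ext1 <;> simp }
    w_homog := ?_
    δ_homog := ?_
    δ_mul := ?_ }, ?_⟩
  · rintro (_ | a)
    · exact OddExt.isHomog_iff.2 ⟨IsHomog.zero, FinGr.one_homog.congr (by ring)⟩
    · exact OddExt.isHomog_iff.2 ⟨hv a z hz, IsHomog.zero⟩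
  · intro q x hx
    obtain ⟨h0, h1⟩ := OddExt.isHomog_iff.1 hx
    exact OddExt.isHomog_iff.2 ⟨hδ z hz q _ h0, ((hδ z hz _ _ h1).congr (by ring)).neg⟩
  · intro q x y hx
    obtain ⟨h0, h1⟩ := OddExt.isHomog_iff.1 hx
    have h2 : δ z (GrAlg.par (𝕜 := 𝕜) x.fst) = -GrAlg.par (𝕜 := 𝕜) (δ z x.fst) := by
      rw [h0.par_eq, (hδ z hz q _ h0).par_eq, map_sg, sg_succ, neg_neg]
    ext1
    · exact hδm z hz _ _
    · simp only [LinearMap.coe_mk, AddHom.coe_mk, OddExt.snd_add, OddExt.snd_mul, map_add,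
        hδm z hz, h2, OddExt.par_par, OddExt.snd_par, OddExt.fst_par]
      noncomm_ring
  · intro W hW p G s ε hG hmem hε hbox
    set y := (L.coord c).symm z with hy
    have hys : y ∈ (L.coord c).source := mem_source_of_mem_target hz
    have hs : s ∈ Icc (0 : ℝ) 1 := hW.mem_Icc hmem.2
    set P := box (s, z) ε with hP
    have hzP : (s, z) ∈ P := mem_box hε hs
    have hu : UniqueDiffOn ℝ P := uniqueDiffOn_box
    have hsm : SmoothOn 𝕜 (framed c G) P := fun i => (hG.smooth c i).mono hbox
    have hfd := fun i => hsm.hasFDerivWithinAt hzP i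
    set U : Set L.Body := {y | (s, y) ∈ W} with hU
    have hUo : IsOpen U := hW.isOpen_slice hs
    -- derivatives in the direction of the body
    have hpd : ∀ a : Fin L.dim,
        (pdir 𝕜 P (framed c G) (s, z) (0, EuclideanSpace.single a 1)) =
          ⟨pderiv 𝕜 a (L.rep c fun y => (G s y).fst) z,
            pderiv 𝕜 a (L.rep c fun y => (G s y).snd) z⟩ := by
      intro a
      have hcomp : ∀ i, fderiv ℝ (fun w => cf 𝕜 (framed c G (s, w)) i) z
          (EuclideanSpace.single a 1) =
          fderivWithin ℝ (fun q => cf 𝕜 (framed c G q) i) P (s, z)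
            (0, EuclideanSpace.single a 1) := by
        intro i
        have h1 := (hfd i).comp (f := fun w => (s, w)) (s := Metric.ball z ε) z
          (hasFDerivAt_prodMk_right s z).hasFDerivWithinAt
          fun w hw => ⟨⟨hs, Metric.mem_ball_self hε⟩, hw⟩
        have h2 := h1.hasFDerivAt (Metric.ball_mem_nhds z hε)
        rw [show fderiv ℝ (fun w => cf 𝕜 (framed c G (s, w)) i) z = _ from h2.fderiv]
        rfl
      refine cf_ext (𝕜 := 𝕜) ?_
      rintro (i | i)
      · rw [cf_pdir, ← hcomp (Sum.inl i), cf_inl]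
        dsimp only
        rw [pderiv, cf_symm]; rfl
      · rw [cf_pdir, ← hcomp (Sum.inr i), cf_inr]
        dsimp only
        rw [pderiv, cf_symm]; rfl
    -- the derivative in the direction of `s`
    set J : Set ℝ := Icc 0 1 ∩ Metric.ball s ε with hJ
    have hJu : UniqueDiffWithinAt ℝ J s :=
      ((uniqueDiffOn_Icc zero_lt_one).inter Metric.isOpen_ball) s ⟨hs, Metric.mem_ball_self hε⟩
    have hds : HasDWithin 𝕜 (fun s' => L.frame c y (G s' y).fst)
        (pdir 𝕜 P (framed c G) (s, z) (1, 0)).fst J s := by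
      intro i
      have h1 := (hfd (Sum.inl i)).comp_hasDerivWithinAt (f := fun s' => (s', z)) (s := J)
        (f' := (1, 0)) s ((hasDerivAt_id s).prodMk (hasDerivAt_const s z)).hasDerivWithinAt
        fun s' hs' => ⟨hs', Metric.mem_ball_self hε⟩
      refine h1.congr_deriv ?_
      rw [← cf, ← cf_inl, cf_pdir]
    have hhom : ∀ s' ∈ J, IsHomog 𝕜 p (L.frame c y (G s' y).fst) := fun s' hs' =>
      (L.frame_homog c y hys p _).2 (OddExt.isHomog_iff.1 (hG.homog (s', y)
        (hbox (show (s', z) ∈ P from ⟨hs', Metric.mem_ball_self hε⟩)).2)).1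
    have hsJ : s ∈ J := ⟨hs, Metric.mem_ball_self hε⟩
    -- Smoothness is known for the framed representative. The point `y` is fixed here, so the frame
    -- is a fixed linear map and can be undone under the derivative in `s`.
    have hds' : HasDWithin 𝕜 (fun s' => (G s' y).fst)
        ((L.frame c y).symm (pdir 𝕜 P (framed c G) (s, z) (1, 0)).fst) (Icc 0 1) s := by
      intro i
      have := (hds.map (L.frame c y).symm.toLinearEquiv.toLinearMap hhom hsJ
        (hds.homog hJu hhom hsJ)) i
      simp only [LinearEquiv.coe_coe, AlgEquiv.toLinearEquiv_apply,
        AlgEquiv.symm_apply_apply] at this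
      exact this.mono_of_mem_nhdsWithin
        (inter_mem_nhdsWithin _ (Metric.ball_mem_nhds s hε))
    have hdw : dWithin 𝕜 (Icc 0 1) (fun s' => (G s' y).fst) s =
        (L.frame c y).symm (pdir 𝕜 P (framed c G) (s, z) (1, 0)).fst := by
      refine cf_ext (𝕜 := 𝕜) fun i => ?_
      rw [dWithin, cf_symm]
      exact (hds' i).derivWithin (uniqueDiffOn_Icc zero_lt_one s hs)
    refine ⟨?_, hdw ▸ hds'⟩
    -- The local form of Q concerns functions on the body of L; it is applied to the slice at fixed
    -- `s` of each of the two components.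
    have hfn : ∀ {q : ℤ} {f : L.Body → L.Alg}, (∀ y' ∈ U, IsHomog 𝕜 q (f y')) →
        (∀ c' i, ContDiffOn ℝ ∞ (fun w => GrAlg.coeff (𝕜 := 𝕜) (L.rep c' f w) i)
          ((L.coord c').target ∩ (L.coord c').symm ⁻¹' U)) →
        L.frame c y (L.Q f y) = ∑ a, v a z * pderiv 𝕜 a (L.rep c f) z + δ z (L.rep c f z) :=
      fun h1 h2 => hQ U _ _ hUo ⟨h1, h2⟩ z ⟨hz, hmem.2⟩
    have hsl : ∀ c', MapsTo (fun w => (s, w)) ((L.coord c').target ∩ (L.coord c').symm ⁻¹' U)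
        (chartSet W c') := fun c' w hw => hw
    have hQ1 := hfn (q := p) (f := fun y => (G s y).fst)
      (fun y' hy' => (OddExt.isHomog_iff.1 (hG.homog (s, y') hy')).1)
      (fun c' i => (hG.smooth c' (Sum.inl i)).comp (contDiff_prodMk_right s).contDiffOn (hsl c'))
    have hQ2 := hfn (q := p - 1) (f := fun y => (G s y).snd)
      (fun y' hy' => (OddExt.isHomog_iff.1 (hG.homog (s, y') hy')).2)
      (fun c' i => (hG.smooth c' (Sum.inr i)).comp (contDiff_prodMk_right s).contDiffOn (hsl c'))
    have hpar : ∀ a, GrAlg.par (𝕜 := 𝕜) (v a z) = -v a z := fun a => by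
      rw [(hv a z hz).par_eq, sg_odd odd_one]
    rw [LocalField.app, Fintype.sum_option]
    simp only [Option.elim_none, Option.elim_some, hpd]
    ext1
    · rw [frK_fst]
      simp only [dys, OddExt.fst_add, fst_sum, OddExt.fst_mul, zero_mul, zero_add]
      exact hQ1
    · rw [frK_snd]
      simp only [dys, OddExt.snd_add, snd_sum, OddExt.snd_mul, zero_mul, zero_add, map_zero,
        one_mul, add_zero, hdw, map_sub, AlgEquiv.apply_symm_apply, hpar, neg_mul,
        Finset.sum_neg_distrib]
      rw [hQ2]
      simp only [LinearMap.coe_mk, AddHom.coe_mk]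
      change _ = _ + -δ z (L.rep c (fun y => (G s y).snd) z)
      abel


/-! #### Rules for the differential -/

section Rules

variable {W : Set (ℝ × L.Body)} {x : ℝ × L.Body} {p q : ℤ}
  {F G : ℝ → L.Body → OddExt 𝕜 L.Alg}

/-- A chart around a point of `W`. -/
theorem exists_chart (hW : RelOpen W) (hx : x ∈ W) : ∃ (c : L.Chart) (z : EuclideanSpace ℝ (Fin L.dim))
    (ε : ℝ) (X : LocalField 𝕜 (OddExt 𝕜 L.Alg) (ℝ × EuclideanSpace ℝ (Fin L.dim))),
    (x.1, z) ∈ chartSet W c ∧ (L.coord c).symm z = x.2 ∧ 0 < ε ∧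
    box (x.1, z) ε ⊆ chartSet W c ∧ (x.1, z) ∈ box (x.1, z) ε ∧
    ∀ (p : ℤ) (G : ℝ → L.Body → OddExt 𝕜 L.Alg), Fn W p G →
      frK L c x.2 (dys L G x.1 x.2) = X.app (box (x.1, z) ε) (framed c G) (x.1, z) ∧
      HasDWithin 𝕜 (fun s' => (G s' x.2).fst)
        (dWithin 𝕜 (Icc 0 1) (fun s' => (G s' x.2).fst) x.1) (Icc 0 1) x.1 := by
  obtain ⟨c, hc⟩ := L.cover x.2
  have hz := (L.coord c).map_source hc
  have hyz : (L.coord c).symm (L.coord c x.2) = x.2 := (L.coord c).left_inv hc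
  have hmem : (x.1, L.coord c x.2) ∈ chartSet W c := ⟨hz, by rw [hyz]; exact hx⟩
  obtain ⟨ε, hε, hbox⟩ := exists_box hW c hmem
  obtain ⟨X, hX⟩ := exists_localField c hz
  refine ⟨c, L.coord c x.2, ε, X, hmem, hyz, hε, hbox, mem_box hε (hW.mem_Icc hx), ?_⟩
  intro p G hG
  have := hX W hW p G x.1 ε hG hmem hε hbox
  rwa [hyz] at this

/-- This is the ϑ-component of `dys` solved for the derivative in `s`. Actual differentiability is
part of the claim, since `dWithin` alone would return a default value. -/
theorem Fn.hasDWithin_fst (hG : Fn W q G) (hW : RelOpen W) (hx : x ∈ W) :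
    HasDWithin 𝕜 (fun s' => (G s' x.2).fst)
      ((dys L G x.1 x.2).snd + L.Q (fun y => (G x.1 y).snd) x.2) (Icc 0 1) x.1 := by
  obtain ⟨c, z, ε, X, -, -, -, -, -, h⟩ := exists_chart hW hx
  refine (h q G hG).2.congr_deriv ?_
  simp only [dys, sub_add_cancel]

theorem dys_homog (hW : RelOpen W) (hG : Fn W q G) (hx : x ∈ W) : IsHomog 𝕜 (q + 1) (dys L G x.1 x.2) := by
  obtain ⟨c, z, ε, X, hmem, hz, hε, hbox, hm, h⟩ := exists_chart hW hx
  have hs := mem_source_of_mem_target hmem.1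
  rw [hz] at hs
  rw [← frK_homog hs, (h q G hG).1]
  refine X.app_homog (fun r hr => ?_) hm
  have hr' := hbox hr
  exact (frK_homog (mem_source_of_mem_target hr'.1)).2 (hG.homog _ hr'.2)

theorem dys_congr (hW : RelOpen W) (hF : Fn W p F) (h : ∀ x ∈ W, G x.1 x.2 = F x.1 x.2) (hx : x ∈ W) :
    dys L G x.1 x.2 = dys L F x.1 x.2 := by
  obtain ⟨c, z, ε, X, hmem, hz, hε, hbox, hm, h'⟩ := exists_chart hW hx
  apply (frK L c x.2).injective
  rw [(h' p F hF).1, (h' p G (hF.congr h)).1]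
  exact X.app_congr (fun r hr => by rw [framed, framed, h _ (hbox hr).2]) hm

theorem dys_add (hW : RelOpen W) (hF : Fn W p F) (hG : Fn W p G) (hx : x ∈ W) :
    dys L (fun s y => F s y + G s y) x.1 x.2 = dys L F x.1 x.2 + dys L G x.1 x.2 := by
  obtain ⟨c, z, ε, X, hmem, hz, hε, hbox, hm, h⟩ := exists_chart hW hx
  apply (frK L c x.2).injective
  rw [map_add, (h p F hF).1, (h p G hG).1, (h p _ (hF.add hG)).1,
    ← X.app_add uniqueDiffOn_box hm (fun i => (hF.smooth c i).mono hbox)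
      (fun i => (hG.smooth c i).mono hbox)]
  exact X.app_congr (fun r _ => by simp only [framed, map_add]) hm

/-- In a chart `dys` is a vector field of degree one, and the frame is multiplicative on the
homogeneous factors that occur, so the pointwise Leibniz rule can be pulled back through it. -/
theorem dys_mul (hW : RelOpen W) (hF : Fn W p F) (hG : Fn W q G) (hx : x ∈ W) :
    dys L (fun s y => F s y * G s y) x.1 x.2 =
      dys L F x.1 x.2 * G x.1 x.2 + GrAlg.par (𝕜 := 𝕜) (F x.1 x.2) * dys L G x.1 x.2 := by
  obtain ⟨c, z, ε, X, hmem, hz, hε, hbox, hm, h⟩ := exists_chart hW hx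
  have hs := mem_source_of_mem_target hmem.1
  rw [hz] at hs
  apply (frK L c x.2).injective
  have hFx := hF.homog x hx
  have hfF : framed c F (x.1, z) = frK L c x.2 (F x.1 x.2) := by simp only [framed, hz]
  have hfG : framed c G (x.1, z) = frK L c x.2 (G x.1 x.2) := by simp only [framed, hz]
  have hFx' : IsHomog 𝕜 p (framed c F (x.1, z)) := by rw [hfF]; exact (frK_homog hs).2 hFx
  rw [map_add, frK_mul hs (dys_homog hW hF hx), frK_mul hs hFx.par, (h p F hF).1, (h q G hG).1,
    (h _ _ (hF.mul hG)).1, X.app_congr (fun r hr => hF.framed_mul c (hbox hr)) hm,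
    X.app_mul uniqueDiffOn_box hm (fun i => (hF.smooth c i).mono hbox)
      (fun i => (hG.smooth c i).mono hbox) hFx', hFx'.par_eq, hFx.par_eq, hfF, hfG, map_sg]

theorem dys_one (hW : RelOpen W) (hx : x ∈ W) : dys L (fun _ _ => (1 : OddExt 𝕜 L.Alg)) x.1 x.2 = 0 := by
  have h := dys_mul hW Fn.one Fn.one hx
  simpa using h

theorem dys_zero (hW : RelOpen W) (hx : x ∈ W) : dys L (fun _ _ => (0 : OddExt 𝕜 L.Alg)) x.1 x.2 = 0 := by
  have h := dys_add hW (Fn.zero (q := 0)) Fn.zero hx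
  simpa using h

theorem dys_neg (hW : RelOpen W) (hF : Fn W p F) (hx : x ∈ W) :
    dys L (fun s y => -F s y) x.1 x.2 = -dys L F x.1 x.2 := by
  have h := dys_add hW hF hF.neg hx
  simp only [add_neg_cancel, dys_zero hW hx] at h
  exact (neg_eq_of_add_eq_zero_right h.symm).symm

theorem dys_sg (hW : RelOpen W) (n : ℤ) (hF : Fn W p F) (hx : x ∈ W) :
    dys L (fun s y => sg n (F s y)) x.1 x.2 = sg n (dys L F x.1 x.2) := by
  rcases sg_cases n with h | h <;> simp only [h]
  exact dys_neg hW hF hx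

theorem dys_sum (hW : RelOpen W) {ι : Type*} {t : Finset ι} {F : ι → ℝ → L.Body → OddExt 𝕜 L.Alg}
    (h : ∀ k ∈ t, Fn W q (F k)) (hx : x ∈ W) :
    dys L (fun s y => ∑ k ∈ t, F k s y) x.1 x.2 = ∑ k ∈ t, dys L (F k) x.1 x.2 := by
  classical
  induction t using Finset.induction_on with
  | empty => simpa using dys_zero hW hx
  | insert a t ha ih =>
    simp only [Finset.sum_insert ha]
    have h' : ∀ k ∈ t, Fn W q (F k) := fun k hk => h k (by simp [hk])
    rw [dys_add hW (h a (by simp)) (Fn.sum h') hx, ih h']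

end Rules

end Functions

/-! ### Matrices of functions -/

section FnMatrix

variable {𝕜 : Type} [RCLike 𝕜] {L : NQManifold 𝕜} {n : Type} {W W' : Set (ℝ × L.Body)}
  {x : ℝ × L.Body}

/-- The differential `d^y + d^s` of a matrix of functions. -/
def dM (L : NQManifold 𝕜) (F : ℝ → L.Body → Matrix n n (OddExt 𝕜 L.Alg)) (s : ℝ) (y : L.Body) :
    Matrix n n (OddExt 𝕜 L.Alg) :=
  Matrix.of fun α β => dys L (fun s y => F s y α β) s y

/-- A matrix of functions with entries of degree `l₂ β - l₁ α`. -/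
def FnM (W : Set (ℝ × L.Body)) (l₁ l₂ : n → ℤ) (F : ℝ → L.Body → Matrix n n (OddExt 𝕜 L.Alg)) :
    Prop := ∀ α β, Fn W (l₂ β - l₁ α) (fun s y => F s y α β)

namespace FnM

variable {l₁ l₂ l₃ : n → ℤ} {F G : ℝ → L.Body → Matrix n n (OddExt 𝕜 L.Alg)}

theorem congr (hF : FnM W l₁ l₂ F) (h : ∀ x ∈ W, G x.1 x.2 = F x.1 x.2) : FnM W l₁ l₂ G :=
  fun α β => (hF α β).congr fun x hx => by rw [h x hx]

theorem one [DecidableEq n] (l : n → ℤ) :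
    FnM W l l (fun _ _ => (1 : Matrix n n (OddExt 𝕜 L.Alg))) := by
  intro α β
  simp only [Matrix.one_apply]
  split_ifs with h
  · subst h; exact Fn.one.congr_deg (by ring)
  · exact Fn.zero

theorem mul [Fintype n] (hF : FnM W l₁ l₂ F) (hG : FnM W l₂ l₃ G) :
    FnM W l₁ l₃ (fun s y => F s y * G s y) := by
  intro α β
  simp only [Matrix.mul_apply]
  exact Fn.sum fun γ _ => ((hF α γ).mul (hG γ β)).congr_deg (by ring)

end FnM

variable {l₁ l₂ l₃ : n → ℤ} {F G : ℝ → L.Body → Matrix n n (OddExt 𝕜 L.Alg)}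

theorem dM_congr (hW : RelOpen W) (hF : FnM W l₁ l₂ F) (h : ∀ x ∈ W, G x.1 x.2 = F x.1 x.2)
    (hx : x ∈ W) : dM L G x.1 x.2 = dM L F x.1 x.2 := by
  ext1 α β
  exact dys_congr (G := fun s y => G s y α β) hW (hF α β) (fun x hx => by simp only [h x hx]) hx

theorem dM_one [DecidableEq n] (hW : RelOpen W) (hx : x ∈ W) :
    dM L (fun _ _ => (1 : Matrix n n (OddExt 𝕜 L.Alg))) x.1 x.2 = 0 := by
  ext1 α β
  simp only [dM, Matrix.of_apply, Matrix.one_apply, Matrix.zero_apply]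
  split_ifs
  · exact dys_one hW hx
  · exact dys_zero hW hx

theorem dM_mul [Fintype n] (hW : RelOpen W) (hF : FnM W l₁ l₂ F) (hG : FnM W l₂ l₃ G)
    (hx : x ∈ W) : dM L (fun s y => F s y * G s y) x.1 x.2 =
      dM L F x.1 x.2 * G x.1 x.2 + parM 𝕜 (F x.1 x.2) * dM L G x.1 x.2 := by
  ext1 α β
  simp only [dM, Matrix.of_apply, Matrix.mul_apply, Matrix.add_apply]
  rw [dys_sum hW (fun γ _ => ((hF α γ).mul (hG γ β)).congr_deg (q := l₃ β - l₁ α) (by ring)) hx,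
    ← Finset.sum_add_distrib]
  exact Finset.sum_congr rfl fun γ _ => dys_mul hW (hF α γ) (hG γ β) hx

end FnMatrix

/-! ### Path ordered exponentials of functions -/

section Families

variable {𝕜 : Type} [RCLike 𝕜] {L : NQManifold 𝕜} {W W' : Set (ℝ × L.Body)} {a b a' b' : ℝ}

/-- A family of functions of degree `q` on `W`, depending smoothly on a time in `[a, b]`. -/
structure Fam (W : Set (ℝ × L.Body)) (a b : ℝ) (q : ℤ) (G : ℝ → ℝ → L.Body → OddExt 𝕜 L.Alg) :
    Prop where
  homog : ∀ t ∈ Icc a b, ∀ x ∈ W, IsHomog 𝕜 q (G t x.1 x.2)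
  smooth : ∀ c, SmoothOn 𝕜
    (fun r : ℝ × (ℝ × EuclideanSpace ℝ (Fin L.dim)) => framed c (G r.1) r.2)
    (Icc a b ×ˢ chartSet W c)

namespace Fam

variable {q : ℤ} {G G' : ℝ → ℝ → L.Body → OddExt 𝕜 L.Alg}

theorem slice (hG : Fam W a b q G) {t : ℝ} (ht : t ∈ Icc a b) : Fn W q (G t) :=
  ⟨hG.homog t ht, fun c => SmoothOn.slice (G := fun t r => framed c (G t) r) (hG.smooth c) ht⟩

theorem congr_deg (hG : Fam W a b q G) {p : ℤ} (h : q = p) : Fam W a b p G := h ▸ hG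

theorem zero : Fam W a b q (fun _ _ _ => (0 : OddExt 𝕜 L.Alg)) :=
  ⟨fun _ _ _ _ => IsHomog.zero, fun c i => by
    simp only [framed, map_zero, cf_zero]; exact contDiffOn_const⟩

theorem neg (hG : Fam W a b q G) : Fam W a b q (fun t s y => -G t s y) :=
  ⟨fun t ht x hx => (hG.homog t ht x hx).neg, fun c i => by
    simp only [framed, map_neg, cf_neg]; exact (hG.smooth c i).neg⟩

theorem sgn (n : ℤ) (hG : Fam W a b q G) : Fam W a b q (fun t s y => sg n (G t s y)) := by
  rcases sg_cases n with h | h <;> simp only [h]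
  exacts [hG, hG.neg]

end Fam

variable {N : ℕ} {A B : ℝ → ℝ → L.Body → Matrix (Fin N) (Fin N) (OddExt 𝕜 L.Alg)}
  {lev : Fin N → ℤ}

/-- The local representative of a family of matrices. -/
def framedM (c : L.Chart) (A : ℝ → ℝ → L.Body → Matrix (Fin N) (Fin N) (OddExt 𝕜 L.Alg)) (t : ℝ)
    (r : ℝ × EuclideanSpace ℝ (Fin L.dim)) : Matrix (Fin N) (Fin N) (OddExt 𝕜 L.Alg) :=
  Matrix.of fun α β => framed c (fun s y => A t s y α β) r

/-- Frames vary with the point, so smoothness is only meaningful for framed entries, while `pexp` is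
formed from unframed ones. The lemma shows that the two operations commute. -/
theorem coeffCts_and_pexp_framedM {c : L.Chart} {r : ℝ × EuclideanSpace ℝ (Fin L.dim)}
    (hr : r ∈ chartSet W c) (hA : ∀ α β, Fam W a b (lev β - lev α) fun t s y => A t s y α β)
    (hab : a ≤ b) :
    CoeffCts 𝕜 (fun t => A t r.1 ((L.coord c).symm r.2)) (Icc a b) ∧ ∀ t ∈ Icc a b, ∀ α β,
      framed c (fun s y => pexp 𝕜 (fun t => A t s y) t a α β) r =
        pexp 𝕜 (fun t => framedM c A t r) t a α β := by
  have hs := mem_source_of_mem_target hr.1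
  have hc : CoeffCts 𝕜 (fun t => framedM c A t r) (Icc a b) := fun α β i =>
    continuousOn_slice ((hA α β).smooth c i).continuousOn hr
  -- The inverse frame is used because continuity in time is given for the framed exponent;
  -- continuity of the unframed one is a by-product.
  have key : ∀ t ∈ Icc a b, _ := fun t ht =>
    map_pexp (frK L c ((L.coord c).symm r.2)).symm.toLinearMap
    ((LinearEquiv.symm_apply_eq _).2 (frK_one _ _).symm)
    (fun p q x y hx hy => frK_symm_mul hs hx y) ht.1 (hc.mono (Icc_subset_Icc_right ht.2)) lev
    fun u hu α β => (frK_homog hs).2 ((hA α β).homog u ⟨hu.1, hu.2.trans ht.2⟩ _ hr.2)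
  have hm : ∀ u, (framedM c A u r).map (frK L c ((L.coord c).symm r.2)).symm.toLinearMap =
      A u r.1 ((L.coord c).symm r.2) := by
    intro u
    ext1 α β
    simp [framedM, framed]
  simp only [hm] at key
  refine ⟨(key b (right_mem_Icc.2 hab)).1, fun t ht α β => ?_⟩
  rw [framed, ← (key t ht).2]
  simp

theorem box_mem_nhdsWithin {n : ℕ} {q : ℝ × EuclideanSpace ℝ (Fin n)} {ε : ℝ} (hε : 0 < ε)
    {T : Set (ℝ × EuclideanSpace ℝ (Fin n))} (hT : ∀ r ∈ T, r.1 ∈ Icc (0 : ℝ) 1) :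
    box q ε ∈ 𝓝[T] q := by
  refine Metric.mem_nhdsWithin_iff.2 ⟨ε, hε, fun r hr => ?_⟩
  have h := hr.1
  rw [← ball_prod_same] at h
  exact ⟨⟨hT r hr.2, h.1⟩, h.2⟩

/-- Path ordered exponentials of functions are functions. -/
theorem fnM_pexp (hW : RelOpen W) (hab : a ≤ b)
    (hA : ∀ α β, Fam W a b (lev β - lev α) fun t s y => A t s y α β) :
    FnM W lev lev fun s y => pexp 𝕜 (fun t => A t s y) b a := by
  -- Pieces of length zero are allowed in a subdivision, but derivatives within [a, b] × P are only
  -- well determined for a < b.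
  rcases hab.eq_or_lt with rfl | hlt
  · simp only [pexp_self]; exact FnM.one lev
  intro α β
  refine ⟨fun x hx => pexp_homog lev hab (fun u hu α β => (hA α β).homog u hu x hx) α β,
    fun c i q hq => ?_⟩
  obtain ⟨ε, hε, hbox⟩ := exists_box hW c hq
  have h := (smoothOn_pexp_and_hasDWithin_pdir hlt convex_box uniqueDiffOn_box
    (P := box q ε) (F := framedM c A) (fun α β i => ((hA α β).smooth c i).mono
      (prod_mono subset_rfl hbox))).1 b (right_mem_Icc.2 hab) α β i
  have h1 := h q (mem_box hε (hW.mem_Icc hq.2))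
  refine (h1.congr (fun r hr => ?_) ?_).mono_of_mem_nhdsWithin
    (box_mem_nhdsWithin hε fun r hr => hW.mem_Icc hr.2)
  · rw [(coeffCts_and_pexp_framedM (hbox hr) hA hab).2 b (right_mem_Icc.2 hab)]
  · rw [(coeffCts_and_pexp_framedM hq hA hab).2 b (right_mem_Icc.2 hab)]

theorem coeffCts_of_fam {x : ℝ × L.Body} (hx : x ∈ W) (hab : a ≤ b)
    (hA : ∀ α β, Fam W a b (lev β - lev α) fun t s y => A t s y α β) :
    CoeffCts 𝕜 (fun t => A t x.1 x.2) (Icc a b) := by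
  obtain ⟨c, hc⟩ := L.cover x.2
  have hyz : (L.coord c).symm (L.coord c x.2) = x.2 := (L.coord c).left_inv hc
  have := (coeffCts_and_pexp_framedM (r := (x.1, L.coord c x.2)) (c := c) (W := W)
    ⟨(L.coord c).map_source hc, by rw [hyz]; exact hx⟩ hA hab).1
  simpa only [hyz] using this

/-- The differential of a path ordered exponential whose exponent satisfies
`d A = ∂_t B + par(A) B - B A`. -/
theorem dM_pexp (hW : RelOpen W) (hab : a ≤ b)
    (hA : ∀ α β, Fam W a b (lev β - lev α) fun t s y => A t s y α β)
    {x : ℝ × L.Body} (hx : x ∈ W) {lB : Fin N → Fin N → ℤ}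
    (hBh : ∀ t ∈ Icc a b, ∀ α β, IsHomog 𝕜 (lB α β) (B t x.1 x.2 α β))
    (hB : ∀ t ∈ Icc a b, HasMD 𝕜 (fun t => B t x.1 x.2)
      (dM L (A t) x.1 x.2 - parM 𝕜 (A t x.1 x.2) * B t x.1 x.2 + B t x.1 x.2 * A t x.1 x.2)
      (Icc a b) t) :
    dM L (fun s y => pexp 𝕜 (fun t => A t s y) b a) x.1 x.2 =
      -(B b x.1 x.2 * pexp 𝕜 (fun t => A t x.1 x.2) b a) +
        parM 𝕜 (pexp 𝕜 (fun t => A t x.1 x.2) b a) * B a x.1 x.2 := by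
  rcases hab.eq_or_lt with rfl | hlt
  · simp only [pexp_self, parM_one, dM_one hW hx]
    simp
  obtain ⟨c, z, ε, X, hmem, hz, hε, hbox, hm, h⟩ := exists_chart hW hx
  have hs := mem_source_of_mem_target hmem.1
  rw [hz] at hs
  set φ := frK L c x.2 with hφ
  have hφA : ∀ t, framedM c A t (x.1, z) = (A t x.1 x.2).map φ := by
    intro t; ext1 α β; simp only [framedM, framed, hz, Matrix.of_apply, Matrix.map_apply, hφ]
  have hUf := fnM_pexp hW hab hA
  have hpar : ∀ {p : ℤ} {k : OddExt 𝕜 L.Alg}, IsHomog 𝕜 p k →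
      φ (GrAlg.par (𝕜 := 𝕜) k) = GrAlg.par (𝕜 := 𝕜) (φ k) := fun {p k} hk => by
    rw [hk.par_eq, ((frK_homog hs).2 hk).par_eq, map_sg]
  have hAh : ∀ t ∈ Icc a b, ∀ α β, IsHomog 𝕜 (lev β - lev α) (A t x.1 x.2 α β) :=
    fun t ht α β => (hA α β).homog t ht x hx
  have hUx : (pexp 𝕜 (fun t => framedM c A t (x.1, z)) b a) =
      (pexp 𝕜 (fun t => A t x.1 x.2) b a).map φ := by
    ext1 α β
    rw [← (coeffCts_and_pexp_framedM hmem hA hab).2 b (right_mem_Icc.2 hab), framed]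
    simp only [hz, Matrix.map_apply, hφ]
  have hdA : ∀ t ∈ Icc a b, X.appM (box (x.1, z) ε) (framedM c A t) (x.1, z) =
      (dM L (A t) x.1 x.2).map φ := fun t ht => by
    ext1 α β
    exact ((h _ _ ((hA α β).slice ht)).1).symm
  -- The equation for `B` is carried into the chart. The degrees `lB` are arbitrary; homogeneity is
  -- needed only so that the frame passes through derivatives and products.
  have hB' : ∀ t ∈ Icc a b, HasMD 𝕜 (fun t => (B t x.1 x.2).map φ)
      (X.appM (box (x.1, z) ε) (framedM c A t) (x.1, z) -
        parM 𝕜 (framedM c A t (x.1, z)) * (B t x.1 x.2).map φ +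
        (B t x.1 x.2).map φ * framedM c A t (x.1, z)) (Icc a b) t := by
    intro t ht α β
    have h1 := (hB t ht α β).map φ.toLinearMap (fun u hu => hBh u hu α β) ht
      ((hB t ht α β).homog (uniqueDiffOn_Icc hlt t ht) (fun u hu => hBh u hu α β) ht)
    refine h1.congr_deriv ?_
    rw [hdA t ht, hφA]
    simp only [LinearEquiv.coe_coe, Matrix.add_apply, Matrix.sub_apply, Matrix.mul_apply,
      Matrix.map_apply, parM_apply, map_add, map_sub, map_sum]
    congr 1
    · congr 1
      refine Finset.sum_congr rfl fun γ _ => ?_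
      rw [hφ, frK_mul hs (hAh t ht α γ).par, ← hφ, hpar (hAh t ht α γ)]
    · refine Finset.sum_congr rfl fun γ _ => ?_
      rw [hφ, frK_mul hs (hBh t ht α γ)]
  have main := X.appM_pexp hlt convex_box uniqueDiffOn_box hm (F := framedM c A)
    (fun α β i => ((hA α β).smooth c i).mono (prod_mono subset_rfl hbox)) lev
    (fun t ht α β => by rw [hφA]; exact (frK_homog hs).2 (hAh t ht α β)) hB'
  rw [hUx] at main
  ext1 α β
  apply φ.injective
  have h1 := congrFun (congrFun main α) β
  rw [LocalField.appM, Matrix.of_apply, ← X.app_congr (fun r hr =>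
    (coeffCts_and_pexp_framedM (hbox hr) hA hab).2 b (right_mem_Icc.2 hab) α β) hm,
    ← (h _ _ (hUf α β)).1] at h1
  refine h1.trans ?_
  simp only [Matrix.add_apply, Matrix.neg_apply, Matrix.mul_apply,
      Matrix.map_apply, parM_apply, map_add, map_neg, map_sum]
  have hUh : ∀ α β, IsHomog 𝕜 (lev β - lev α) (pexp 𝕜 (fun t => A t x.1 x.2) b a α β) :=
    fun α β => (hUf α β).homog x hx
  congr 1
  · congr 1
    refine Finset.sum_congr rfl fun γ _ => ?_
    rw [hφ, frK_mul hs (hBh b (right_mem_Icc.2 hab) α γ)]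
  · refine Finset.sum_congr rfl fun γ _ => ?_
    rw [hφ, frK_mul hs (hUh α γ).par, ← hφ, hpar (hUh α γ)]

end Families

/-! ### Pull-backs along a homotopy -/

section Pullback

variable {𝕜 : Type} [RCLike 𝕜] {L M : NQManifold 𝕜} {I : Set ℝ}

theorem fam_of_smoothFam {W : Set (ℝ × L.Body)} {a b : ℝ} {q : ℤ}
    {G : ℝ → ℝ → L.Body → OddExt 𝕜 L.Alg} {V : Set ((ℝ × ℝ) × L.Body)}
    (hh : ∀ t ∈ Icc a b, ∀ x ∈ W, IsHomog 𝕜 q (G t x.1 x.2))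
    (h1 : L.SmoothFam V fun ts y => (G ts.1 ts.2 y).fst)
    (h2 : L.SmoothFam V fun ts y => (G ts.1 ts.2 y).snd)
    (hV : ∀ t ∈ Icc a b, ∀ x ∈ W, ((t, x.1), x.2) ∈ V) : Fam W a b q G := by
  refine ⟨hh, fun c => ?_⟩
  have hm : MapsTo (fun r : ℝ × (ℝ × EuclideanSpace ℝ (Fin L.dim)) => ((r.1, r.2.1), r.2.2))
      (Icc a b ×ˢ chartSet W c)
      {q | q.2 ∈ (L.coord c).target ∧ (q.1, (L.coord c).symm q.2) ∈ V} :=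
    fun r hr => ⟨hr.2.1, hV _ hr.1 _ hr.2.2⟩
  have hc : ContDiff ℝ ∞
      (fun r : ℝ × (ℝ × EuclideanSpace ℝ (Fin L.dim)) => ((r.1, r.2.1), r.2.2)) := by fun_prop
  rintro (i | i)
  · exact (h1 c i).comp hc.contDiffOn hm
  · exact (h2 c i).comp hc.contDiffOn hm

namespace Homotopy

variable (H : Homotopy L M I)

/-- The pull-back of a function along a homotopy. -/
def pb (f : M.Body → M.Alg) (t s : ℝ) (y : L.Body) : OddExt 𝕜 (OddExt 𝕜 L.Alg) :=
  H.pull t s y (f (H.body t s y))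

variable {H} {U : Set M.Body} {W : Set (ℝ × L.Body)} {a b : ℝ} {p : ℤ} {f : M.Body → M.Alg}

theorem pb_homog (hf : M.IsFn U p f) {t : ℝ} (ht : t ∈ I) {x : ℝ × L.Body}
    (hx : x.1 ∈ Icc (0 : ℝ) 1) (hU : H.body t x.1 x.2 ∈ U) : IsHomog 𝕜 p (H.pb f t x.1 x.2) :=
  H.homog t ht _ hx _ _ _ (hf.1 _ hU)

theorem pb_fst (hUo : IsOpen U) (hf : M.IsFn U p f) (hI : Icc a b ⊆ I)
    (hW : ∀ x ∈ W, x.1 ∈ Icc (0 : ℝ) 1)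
    (hU : ∀ t ∈ Icc a b, ∀ x ∈ W, H.body t x.1 x.2 ∈ U) :
    Fam W a b p fun t s y => (H.pb f t s y).fst := by
  obtain ⟨h1, h2, -, -⟩ := H.smooth U p f hUo hf
  exact fam_of_smoothFam (fun t ht x hx => (OddExt.isHomog_iff.1
    (pb_homog hf (hI ht) (hW x hx) (hU t ht x hx))).1) h1 h2
    fun t ht x hx => ⟨hI ht, hW x hx, hU t ht x hx⟩

theorem pb_snd (hUo : IsOpen U) (hf : M.IsFn U p f) (hI : Icc a b ⊆ I)
    (hW : ∀ x ∈ W, x.1 ∈ Icc (0 : ℝ) 1)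
    (hU : ∀ t ∈ Icc a b, ∀ x ∈ W, H.body t x.1 x.2 ∈ U) :
    Fam W a b (p - 1) fun t s y => (H.pb f t s y).snd := by
  obtain ⟨-, -, h1, h2⟩ := H.smooth U p f hUo hf
  exact fam_of_smoothFam (fun t ht x hx => (OddExt.isHomog_iff.1
    (pb_homog hf (hI ht) (hW x hx) (hU t ht x hx))).2) h1 h2
    fun t ht x hx => ⟨hI ht, hW x hx, hU t ht x hx⟩

theorem continuousOn_body_time {s : ℝ} (hs : s ∈ Icc (0 : ℝ) 1) (y : L.Body) :
    ContinuousOn (fun t => H.body t s y) I :=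
  H.cont.comp (f := fun t : ℝ => ((t, s), y)) (by fun_prop) fun _ ht => ⟨⟨ht, hs⟩, trivial⟩

/-- Pull-backs are differentiable in time. -/
theorem hasDWithin_pb_fst (hUo : IsOpen U) (hf : M.IsFn U p f) {t : ℝ} (ht : t ∈ I)
    {s : ℝ} {y : L.Body} (hs : s ∈ Icc (0 : ℝ) 1) (hU : H.body t s y ∈ U) :
    HasDWithin 𝕜 (fun t' => (H.pb f t' s y).fst)
      (dWithin 𝕜 I (fun t' => (H.pb f t' s y).fst) t) I t := by
  obtain ⟨h1, h2, -, -⟩ := H.smooth U p f hUo hf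
  obtain ⟨c, hc⟩ := L.cover y
  set z := L.coord c y with hz
  have hzt : z ∈ (L.coord c).target := (L.coord c).map_source hc
  have hyz : (L.coord c).symm z = y := (L.coord c).left_inv hc
  -- Smoothness is available only while the curve stays in `U`; by continuity these times form a
  -- neighbourhood of `t` in `I`, which suffices for a derivative.
  set J : Set ℝ := I ∩ (fun t => H.body t s y) ⁻¹' U with hJ
  have hJn : J ∈ 𝓝[I] t := inter_mem self_mem_nhdsWithin
    ((continuousOn_body_time hs y t ht).preimage_mem_nhdsWithin (hUo.mem_nhds hU))
  have hm : MapsTo (fun t' : ℝ => ((t', s), z)) J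
      {q | q.2 ∈ (L.coord c).target ∧ (q.1, (L.coord c).symm q.2) ∈
        {q : (ℝ × ℝ) × L.Body | q.1.1 ∈ I ∧ q.1.2 ∈ Icc 0 1 ∧ H.body q.1.1 q.1.2 q.2 ∈ U}} := by
    intro t' ht'
    refine ⟨hzt, ht'.1, hs, ?_⟩
    rw [hyz]; exact ht'.2
  have hcd : ContDiff ℝ ∞ (fun t' : ℝ => ((t', s), z)) := by fun_prop
  have hsm : ∀ i, ContDiffOn ℝ ∞ (fun t' => cf 𝕜 (frK L c y (H.pb f t' s y).fst) i) J := by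
    rintro (i | i)
    · refine ((h1 c i).comp hcd.contDiffOn hm).congr fun t' _ => ?_
      simp only [Function.comp, NManifold.rep, hyz]
      rfl
    · refine ((h2 c i).comp hcd.contDiffOn hm).congr fun t' _ => ?_
      simp only [Function.comp, NManifold.rep, hyz]
      rfl
  have hhom : ∀ t' ∈ J, IsHomog 𝕜 p (H.pb f t' s y).fst := fun t' ht' =>
    (OddExt.isHomog_iff.1 (pb_homog (x := (s, y)) hf ht'.1 hs ht'.2)).1
  have hco : ∀ i, DifferentiableWithinAt ℝ (fun t' => cf 𝕜 (H.pb f t' s y).fst i) I t := by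
    intro i
    -- By homogeneity the pull-back is a finite combination, with constant coefficients, of the
    -- framed coefficients, and these are the ones known to be smooth.
    have h3 : ∀ t' ∈ J, cf 𝕜 (H.pb f t' s y).fst i =
        ∑ j ∈ degSet (𝕜 := 𝕜) (R := OddExt 𝕜 L.Alg) p,
          cf 𝕜 (frK L c y (H.pb f t' s y).fst) j * cf 𝕜 ((frK L c y).symm (bas 𝕜 j)) i := by
      intro t' ht'
      have := ((frK_homog hc).2 (hhom t' ht')).cf_map (frK L c y).symm.toLinearMap i
      simpa using this
    have h4 : DifferentiableWithinAt ℝ (fun t' => cf 𝕜 (H.pb f t' s y).fst i) J t := by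
      refine DifferentiableWithinAt.congr (f := fun t' => _) ?_ h3 (h3 t ⟨ht, hU⟩)
      refine DifferentiableWithinAt.fun_sum fun j _ => ?_
      exact ((hsm j).differentiableOn (by simp) t ⟨ht, hU⟩).mul_const _
    exact h4.mono_of_mem_nhdsWithin hJn
  intro i
  have := (hco i).hasDerivWithinAt
  rwa [← show cf 𝕜 (dWithin 𝕜 I (fun t' => (H.pb f t' s y).fst) t) i = _ from cf_symm _ _] at this

/-- These are the two θ-components of the condition that the pull-back intertwines Q with D + d.
Since D = θ∂_t, the time derivative enters only through the θ-component. -/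
theorem pb_Q (hUo : IsOpen U) (hf : M.IsFn U p f) {t : ℝ} (ht : t ∈ I)
    {x : ℝ × L.Body} (hs : x.1 ∈ Icc (0 : ℝ) 1) (hU : H.body t x.1 x.2 ∈ U) :
    (H.pb (M.Q f) t x.1 x.2).fst = dys L (fun s y => (H.pb f t s y).fst) x.1 x.2 ∧
    HasDWithin 𝕜 (fun t' => (H.pb f t' x.1 x.2).fst)
      ((H.pb (M.Q f) t x.1 x.2).snd + dys L (fun s y => (H.pb f t s y).snd) x.1 x.2) I t := by
  have h := H.dga U p f hUo hf t ht x.1 hs x.2 hU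
  refine ⟨congrArg OddExt.fst h, (hasDWithin_pb_fst hUo hf ht hs hU).congr_deriv ?_⟩
  have h2 : (H.pb (M.Q f) t x.1 x.2).snd = _ := congrArg OddExt.snd h
  rw [h2]
  exact (sub_add_cancel _ _).symm

/-! #### The structure matrices along a homotopy -/

variable (H) {E : QBundle M}

/-- `T` at `θ = 0`. -/
def B (E : QBundle M) (i : E.Patch) (t s : ℝ) (y : L.Body) :
    Matrix (Fin E.rank) (Fin E.rank) (OddExt 𝕜 L.Alg) :=
  T0 E i (fun t => H.body t s y) (fun t => H.pull t s y) t

/-- The `θ`-component of `T`. -/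
def A (E : QBundle M) (i : E.Patch) (t s : ℝ) (y : L.Body) :
    Matrix (Fin E.rank) (Fin E.rank) (OddExt 𝕜 L.Alg) :=
  T1 E i (fun t => H.body t s y) (fun t => H.pull t s y) t

/-- `Ω` at `θ = 0`. -/
def Om (E : QBundle M) (i j : E.Patch) (t s : ℝ) (y : L.Body) :
    Matrix (Fin E.rank) (Fin E.rank) (OddExt 𝕜 L.Alg) :=
  Ω0 E i j (fun t => H.body t s y) (fun t => H.pull t s y) t

/-- The `θ`-component of `Ω`. -/
def Om1 (E : QBundle M) (i j : E.Patch) (t s : ℝ) (y : L.Body) :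
    Matrix (Fin E.rank) (Fin E.rank) (OddExt 𝕜 L.Alg) :=
  Matrix.of fun α β => (H.pb (fun m => E.Ω i j m α β) t s y).snd

/-- A homomorphism of graded algebras commutes with the parity involutions. -/
theorem pull_par {t : ℝ} (ht : t ∈ I) {s : ℝ} (hs : s ∈ Icc (0 : ℝ) 1) (y : L.Body) {p : ℤ}
    {a : M.Alg} (ha : IsHomog 𝕜 p a) :
    H.pull t s y (GrAlg.par (𝕜 := 𝕜) a) = GrAlg.par (𝕜 := 𝕜) (H.pull t s y a) := by
  rw [ha.par_eq, (H.homog t ht s hs y p a ha).par_eq, map_sg]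

end Homotopy

/-- The flatness equation with its level signs absorbed: after multiplication by (-1)^α the
remaining sign is the parity of the entry. In this form it can be pulled back by an algebra
homomorphism. -/
theorem QBundle.Q_T (E : QBundle M) (i : E.Patch) {m : M.Body} (hm : m ∈ E.dom i) (α β) :
    M.Q (fun m => E.T i m α β) m = ∑ γ, GrAlg.par (𝕜 := 𝕜) (E.T i m α γ) * E.T i m γ β := by
  have h := congrArg (sg (E.lev α)) (E.flat i m hm α β)
  rw [sg_add, sg_self, sg_zero, sg_sum] at h
  rw [eq_neg_of_add_eq_zero_left h, ← Finset.sum_neg_distrib]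
  refine Finset.sum_congr rfl fun γ _ => ?_
  rw [((E.T_fn i α γ).1 m hm).par_eq, sg_mul, sg_sg, ← sg_succ]
  exact sg_congr ⟨E.lev α, by ring⟩ _

theorem QBundle.Q_Ω (E : QBundle M) (i j : E.Patch) {m : M.Body} (hm : m ∈ E.dom i ∩ E.dom j)
    (α β) : M.Q (fun m => E.Ω i j m α β) m =
      ∑ γ, GrAlg.par (𝕜 := 𝕜) (E.Ω i j m α γ) * E.T j m γ β - ∑ γ, E.T i m α γ * E.Ω i j m γ β := by
  have h := congrArg (sg (E.lev α)) (E.gauge i j m hm α β)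
  rw [sg_add, sg_self, sg_sum, sg_sum] at h
  simp only [sg_self] at h
  rw [eq_sub_iff_add_eq, ← h]
  refine Finset.sum_congr rfl fun γ _ => ?_
  rw [((E.Ω_fn i j α γ).1 m hm).par_eq, sg_mul, sg_sg]
  exact sg_congr ⟨E.lev α, by ring⟩ _

namespace Homotopy

variable (H : Homotopy L M I) {E : QBundle M} {W : Set (ℝ × L.Body)} {a b t : ℝ} {i j : E.Patch}
  {x : ℝ × L.Body}

theorem fam_A (hI : Icc a b ⊆ I) (hW : ∀ x ∈ W, x.1 ∈ Icc (0 : ℝ) 1)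
    (hU : ∀ t ∈ Icc a b, ∀ x ∈ W, H.body t x.1 x.2 ∈ E.dom i) (α β) :
    Fam W a b (E.lev β - E.lev α) fun t s y => H.A E i t s y α β :=
  (pb_snd (E.dom_open i) (E.T_fn i α β) hI hW hU).congr_deg (by ring)

theorem fam_Om (hI : Icc a b ⊆ I) (hW : ∀ x ∈ W, x.1 ∈ Icc (0 : ℝ) 1)
    (hU : ∀ t ∈ Icc a b, ∀ x ∈ W, H.body t x.1 x.2 ∈ E.dom i ∩ E.dom j) (α β) :
    Fam W a b (E.lev β - E.lev α) fun t s y => H.Om E i j t s y α β :=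
  pb_fst ((E.dom_open i).inter (E.dom_open j)) (E.Ω_fn i j α β) hI hW hU

theorem fam_Om1 (hI : Icc a b ⊆ I) (hW : ∀ x ∈ W, x.1 ∈ Icc (0 : ℝ) 1)
    (hU : ∀ t ∈ Icc a b, ∀ x ∈ W, H.body t x.1 x.2 ∈ E.dom i ∩ E.dom j) (α β) :
    Fam W a b (E.lev β - E.lev α - 1) fun t s y => H.Om1 E i j t s y α β :=
  pb_snd ((E.dom_open i).inter (E.dom_open j)) (E.Ω_fn i j α β) hI hW hU

theorem fnM_Om (ht : t ∈ I) (hW : ∀ x ∈ W, x.1 ∈ Icc (0 : ℝ) 1)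
    (hU : ∀ x ∈ W, H.body t x.1 x.2 ∈ E.dom i ∩ E.dom j) :
    FnM W E.lev E.lev (H.Om E i j t) := fun α β =>
  (H.fam_Om (a := t) (b := t) (by simpa using ht) hW (by simpa using hU) α β).slice (by simp)

theorem B_homog (ht : t ∈ I) (hs : x.1 ∈ Icc (0 : ℝ) 1) (hU : H.body t x.1 x.2 ∈ E.dom i) (α β) :
    IsHomog 𝕜 (1 + E.lev β - E.lev α) (H.B E i t x.1 x.2 α β) :=
  (OddExt.isHomog_iff.1 (pb_homog (E.T_fn i α β) ht hs hU)).1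

/-- Substitution of T = B + θA into QT = par(T)T and separation by powers of θ. The parity of θA is
-θ par(A), which explains the minus sign. -/
theorem pb_Q_T (ht : t ∈ I) (hs : x.1 ∈ Icc (0 : ℝ) 1) (hU : H.body t x.1 x.2 ∈ E.dom i) (α β) :
    H.pb (M.Q fun m => E.T i m α β) t x.1 x.2 =
      ⟨(parM 𝕜 (H.B E i t x.1 x.2) * H.B E i t x.1 x.2) α β,
        (-(parM 𝕜 (H.A E i t x.1 x.2) * H.B E i t x.1 x.2) +
          H.B E i t x.1 x.2 * H.A E i t x.1 x.2) α β⟩ := by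
  rw [pb, E.Q_T i hU, map_sum]
  have hp : ∀ γ, H.pull t x.1 x.2 (GrAlg.par (𝕜 := 𝕜) (E.T i (H.body t x.1 x.2) α γ)) =
      GrAlg.par (𝕜 := 𝕜) (H.pull t x.1 x.2 (E.T i (H.body t x.1 x.2) α γ)) := fun γ =>
    H.pull_par ht hs x.2 ((E.T_fn i α γ).1 _ hU)
  simp only [map_mul, hp]
  ext1
  · simp only [fst_sum, OddExt.fst_mul, OddExt.fst_par, Matrix.mul_apply, parM_apply]
    rfl
  · simp only [snd_sum, OddExt.snd_mul, OddExt.fst_par, OddExt.snd_par, OddExt.par_par,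
      Matrix.add_apply, Matrix.neg_apply, Matrix.mul_apply, parM_apply, Finset.sum_add_distrib,
      neg_mul, Finset.sum_neg_distrib]
    rfl

theorem pb_Q_Ω (ht : t ∈ I) (hs : x.1 ∈ Icc (0 : ℝ) 1)
    (hU : H.body t x.1 x.2 ∈ E.dom i ∩ E.dom j) (α β) :
    H.pb (M.Q fun m => E.Ω i j m α β) t x.1 x.2 =
      ⟨(parM 𝕜 (H.Om E i j t x.1 x.2) * H.B E j t x.1 x.2 -
          H.B E i t x.1 x.2 * H.Om E i j t x.1 x.2) α β,
        (-(parM 𝕜 (H.Om1 E i j t x.1 x.2) * H.B E j t x.1 x.2) +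
          H.Om E i j t x.1 x.2 * H.A E j t x.1 x.2 -
          (H.A E i t x.1 x.2 * H.Om E i j t x.1 x.2 +
          parM 𝕜 (H.B E i t x.1 x.2) * H.Om1 E i j t x.1 x.2)) α β⟩ := by
  rw [pb, E.Q_Ω i j hU, map_sub, map_sum, map_sum]
  have hp : ∀ γ, H.pull t x.1 x.2 (GrAlg.par (𝕜 := 𝕜) (E.Ω i j (H.body t x.1 x.2) α γ)) =
      GrAlg.par (𝕜 := 𝕜) (H.pull t x.1 x.2 (E.Ω i j (H.body t x.1 x.2) α γ)) := fun γ =>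
    H.pull_par ht hs x.2 ((E.Ω_fn i j α γ).1 _ hU)
  simp only [map_mul, hp]
  ext1
  · simp only [fst_sum, OddExt.fst_mul, OddExt.fst_par, OddExt.fst_sub, Matrix.mul_apply,
      parM_apply, Matrix.sub_apply]
    rfl
  · simp only [snd_sum, OddExt.snd_mul, OddExt.fst_par, OddExt.snd_par, OddExt.par_par,
      OddExt.snd_sub, Matrix.sub_apply,
      Matrix.add_apply, Matrix.neg_apply, Matrix.mul_apply, parM_apply, Finset.sum_add_distrib,
      neg_mul, Finset.sum_neg_distrib]
    rfl

/-- The θ-component of flatness, which is precisely what `dM_pexp` requires. Only this component of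
flatness is used. -/
theorem hasMD_B (ht : t ∈ I) (hs : x.1 ∈ Icc (0 : ℝ) 1) (hU : H.body t x.1 x.2 ∈ E.dom i) :
    HasMD 𝕜 (fun t => H.B E i t x.1 x.2) (dM L (H.A E i t) x.1 x.2 -
      parM 𝕜 (H.A E i t x.1 x.2) * H.B E i t x.1 x.2 + H.B E i t x.1 x.2 * H.A E i t x.1 x.2) I t := by
  intro α β
  refine (pb_Q (E.dom_open i) (E.T_fn i α β) ht hs hU).2.congr_deriv ?_
  rw [H.pb_Q_T ht hs hU]
  simp only [Matrix.add_apply, Matrix.sub_apply, Matrix.neg_apply, dM, Matrix.of_apply]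
  exact (by intros; abel : ∀ u v w : OddExt 𝕜 L.Alg, -u + v + w = w - u + v) _ _ _

/-- The θ = 0 part of the gauge equation: a transition matrix at a point is itself a parallel
transport between two patches. -/
theorem dM_Om (ht : t ∈ I) (hs : x.1 ∈ Icc (0 : ℝ) 1)
    (hU : H.body t x.1 x.2 ∈ E.dom i ∩ E.dom j) :
    dM L (H.Om E i j t) x.1 x.2 = parM 𝕜 (H.Om E i j t x.1 x.2) * H.B E j t x.1 x.2 -
          H.B E i t x.1 x.2 * H.Om E i j t x.1 x.2 := by
  ext1 α β
  exact (pb_Q ((E.dom_open i).inter (E.dom_open j)) (E.Ω_fn i j α β) ht hs hU).1.symm.trans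
    (congrArg OddExt.fst (H.pb_Q_Ω ht hs hU α β))

/-- The θ-component of the gauge equation. It is not needed for splicing, and enters as the
off-diagonal block when patches are changed. -/
theorem hasMD_Om (ht : t ∈ I) (hs : x.1 ∈ Icc (0 : ℝ) 1)
    (hU : H.body t x.1 x.2 ∈ E.dom i ∩ E.dom j) :
    HasMD 𝕜 (fun t => H.Om E i j t x.1 x.2) (dM L (H.Om1 E i j t) x.1 x.2 -
      parM 𝕜 (H.Om1 E i j t x.1 x.2) * H.B E j t x.1 x.2 +
      H.Om E i j t x.1 x.2 * H.A E j t x.1 x.2 - H.A E i t x.1 x.2 * H.Om E i j t x.1 x.2 -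
      parM 𝕜 (H.B E i t x.1 x.2) * H.Om1 E i j t x.1 x.2) I t := by
  intro α β
  refine (pb_Q ((E.dom_open i).inter (E.dom_open j)) (E.Ω_fn i j α β) ht hs hU).2.congr_deriv ?_
  rw [H.pb_Q_Ω ht hs hU]
  simp only [Matrix.add_apply, Matrix.sub_apply, Matrix.neg_apply, dM, Matrix.of_apply]
  exact (by intros; abel : ∀ u v w r q : OddExt 𝕜 L.Alg, -u + v - (w + r) + q = q - u + v - w - r) _ _ _ _ _

theorem Om_self (hU : H.body t x.1 x.2 ∈ E.dom i) : H.Om E i i t x.1 x.2 = 1 := by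
  ext1 α β
  simp only [Om, Ω0, Matrix.of_apply, E.Ω_self i _ hU, Matrix.one_apply]
  split_ifs <;> simp

theorem Om_mul_Om {k : E.Patch} (hU : H.body t x.1 x.2 ∈ E.dom i ∩ E.dom j ∩ E.dom k) :
    H.Om E i j t x.1 x.2 * H.Om E j k t x.1 x.2 = H.Om E i k t x.1 x.2 := by
  ext1 α β
  simp only [Om, Ω0, Matrix.of_apply, Matrix.mul_apply, ← E.Ω_cocycle i j k _ hU, map_sum,
    fst_sum, map_mul, OddExt.fst_mul]

end Homotopy

end Pullback

/-! ### Wilson lines of a homotopy -/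

section Lines

variable {𝕜 : Type} [RCLike 𝕜] {L M : NQManifold 𝕜} {I : Set ℝ}

theorem relOpen_of_mem_nhdsWithin {W : Set (ℝ × L.Body)} (h : ∀ x ∈ W, x.1 ∈ Icc (0 : ℝ) 1)
    (hW : ∀ x ∈ W, W ∈ 𝓝[Icc 0 1 ×ˢ univ] x) : RelOpen W := by
  choose! O hO hx hs using fun x hx => mem_nhdsWithin.1 (hW x hx)
  refine ⟨⋃ x ∈ W, O x, isOpen_biUnion hO, ?_⟩
  ext x
  simp only [mem_inter_iff, mem_iUnion₂, mem_prod, mem_univ, and_true]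
  constructor
  · exact fun hxW => ⟨⟨x, hxW, hx x hxW⟩, h x hxW⟩
  · rintro ⟨⟨x', hx', hm⟩, hI⟩
    exact hs x' hx' ⟨hm, hI, trivial⟩

namespace Homotopy

variable (H : Homotopy L M I) {E : QBundle M}

/-- The points where a piece of the curve stays in an open set. -/
theorem eventually_forall_body_mem (hI : Icc (0 : ℝ) 1 ⊆ I) {a b : ℝ} (hab : Icc a b ⊆ Icc 0 1)
    {U : Set M.Body} (hU : IsOpen U) {x : ℝ × L.Body} (hx : x.1 ∈ Icc (0 : ℝ) 1)
    (h : ∀ t ∈ Icc a b, H.body t x.1 x.2 ∈ U) :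
    ∀ᶠ x' in 𝓝[Icc 0 1 ×ˢ univ] x, ∀ t ∈ Icc a b, H.body t x'.1 x'.2 ∈ U := by
  obtain ⟨G, hG, hGe⟩ := (continuousOn_iff'.1 H.cont) U hU
  have hmem : ∀ {t : ℝ} {x' : ℝ × L.Body}, t ∈ Icc a b → x'.1 ∈ Icc (0 : ℝ) 1 →
      (H.body t x'.1 x'.2 ∈ U ↔ ((t, x'.1), x'.2) ∈ G) := by
    intro t x' ht hx'
    have := Set.ext_iff.1 hGe ((t, x'.1), x'.2)
    simpa [hI (hab ht), hx'.1, hx'.2] using this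
  have hG' : IsOpen {q : (ℝ × L.Body) × ℝ | ((q.2, q.1.1), q.1.2) ∈ G} :=
    hG.preimage (by fun_prop)
  -- The tube lemma: compactness of the time interval gives one neighbourhood that works for all
  -- times.
  have h1 : ∀ᶠ x' in 𝓝 x, ∀ t ∈ Icc a b, ((t, x'.1), x'.2) ∈ G :=
    isCompact_Icc.eventually_forall_of_forall_eventually fun t ht =>
      hG'.mem_nhds ((hmem ht hx).1 (h t ht))
  filter_upwards [nhdsWithin_le_nhds h1, self_mem_nhdsWithin] with x' hx' hI' t ht
  exact (hmem ht hI'.1).2 (hx' t ht)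

/-- The points `(s, y)` to which a subdivision is adapted. -/
def adaptedSet (P : Subdivision E) : Set (ℝ × L.Body) :=
  {x | x.1 ∈ Icc (0 : ℝ) 1 ∧ P.Adapted fun t => H.body t x.1 x.2}

end Homotopy

/-! ### Elementary properties of subdivisions -/

namespace Subdivision

variable {E : QBundle M} (P : Subdivision E)

theorem τ_le {k l : ℕ} (h : k ≤ l) (hl : l ≤ P.n) : P.τ k ≤ P.τ l := by
  induction l, h using Nat.le_induction with
  | base => exact le_rfl
  | succ l _ ih => exact (ih (by omega)).trans (P.mono l (by omega))

theorem τ_nonneg {k : ℕ} (hk : k ≤ P.n) : 0 ≤ P.τ k := P.start ▸ P.τ_le (Nat.zero_le k) hk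

theorem τ_le_one {k : ℕ} (hk : k ≤ P.n) : P.τ k ≤ 1 := P.finish ▸ P.τ_le hk le_rfl

theorem n_pos : 0 < P.n := by
  by_contra h
  have h1 := P.finish
  rw [Nat.eq_zero_of_not_pos h, P.start] at h1
  exact zero_ne_one h1

theorem Icc_subset {k : ℕ} (hk : k < P.n) : Icc (P.τ k) (P.τ (k + 1)) ⊆ Icc 0 1 :=
  Icc_subset_Icc (P.τ_nonneg hk.le) (P.τ_le_one hk)

theorem mem_first {γ : ℝ → M.Body} (h : P.Adapted γ) : γ 0 ∈ E.dom P.first :=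
  h 0 P.n_pos 0 ⟨P.start.le, P.τ_nonneg P.n_pos⟩

theorem mem_last {γ : ℝ → M.Body} (h : P.Adapted γ) : γ 1 ∈ E.dom P.last := by
  have hn : P.n - 1 + 1 = P.n := Nat.sub_add_cancel P.n_pos
  exact h (P.n - 1) (Nat.sub_lt P.n_pos one_pos) 1
    ⟨P.τ_le_one (Nat.sub_le _ _), by rw [hn, P.finish]⟩

theorem mem_prev {γ : ℝ → M.Body} (h : P.Adapted γ) {k : ℕ} (hk : k < P.n) :
    γ (P.τ k) ∈ E.dom (P.patch k) ∩ E.dom (P.patch (k - 1)) := by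
  refine ⟨h k hk _ (left_mem_Icc.2 (P.mono k hk)), ?_⟩
  -- For k = 0 natural subtraction makes the preceding patch equal to the first one, so the
  -- transition at the starting point is trivial.
  rcases k with - | k
  · exact h 0 hk _ (left_mem_Icc.2 (P.mono 0 hk))
  · exact h k (by omega) _ (right_mem_Icc.2 (P.mono k (by omega)))

end Subdivision

/-! ### Parallel transport along subdivided curves -/

namespace Homotopy

variable (H : Homotopy L M I) {E : QBundle M} (P : Subdivision E) {W : Set (ℝ × L.Body)}

theorem relOpen_adaptedSet (hI : Icc (0 : ℝ) 1 ⊆ I) : RelOpen (H.adaptedSet P) := by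
  refine relOpen_of_mem_nhdsWithin (fun x hx => hx.1) fun x hx => ?_
  have h1 : ∀ᶠ x' in 𝓝[Icc 0 1 ×ˢ univ] x, ∀ k < P.n, ∀ t ∈ Icc (P.τ k) (P.τ (k + 1)),
      H.body t x'.1 x'.2 ∈ E.dom (P.patch k) :=
    (eventually_all_finite (finite_lt_nat P.n)).2 fun k hk =>
      H.eventually_forall_body_mem hI (P.Icc_subset hk) (E.dom_open _) hx.1 (hx.2 k hk)
  filter_upwards [h1, self_mem_nhdsWithin] with x' hx' hI'
  exact ⟨hI'.1, hx'⟩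

variable {H P} {a b t : ℝ} {i j : E.Patch} {x : ℝ × L.Body}

/-- The path ordered exponential of the connection in one patch. -/
def U (H : Homotopy L M I) (E : QBundle M) (i : E.Patch) (b a s : ℝ) (y : L.Body) :
    Matrix (Fin E.rank) (Fin E.rank) (OddExt 𝕜 L.Alg) := pexp 𝕜 (fun t => H.A E i t s y) b a

theorem fnM_U (hW : RelOpen W) (hI : Icc a b ⊆ I) (hab : a ≤ b)
    (hU : ∀ t ∈ Icc a b, ∀ x ∈ W, H.body t x.1 x.2 ∈ E.dom i) :
    FnM W E.lev E.lev (H.U E i b a) :=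
  fnM_pexp hW hab (H.fam_A hI (fun _ => hW.mem_Icc) hU)

theorem dM_U (hW : RelOpen W) (hI : Icc a b ⊆ I) (hab : a ≤ b)
    (hU : ∀ t ∈ Icc a b, ∀ x ∈ W, H.body t x.1 x.2 ∈ E.dom i) (hx : x ∈ W) :
    dM L (H.U E i b a) x.1 x.2 = -(H.B E i b x.1 x.2 * H.U E i b a x.1 x.2) +
      parM 𝕜 (H.U E i b a x.1 x.2) * H.B E i a x.1 x.2 :=
  dM_pexp hW hab (H.fam_A hI (fun _ => hW.mem_Icc) hU) hx
    (fun t ht α β => H.B_homog (hI ht) (hW.mem_Icc hx) (hU t ht x hx) α β)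
    fun t ht => (H.hasMD_B (hI ht) (hW.mem_Icc hx) (hU t ht x hx)).mono hI

/-- The Wilson line over the first `k` pieces. -/
def lineUpTo (H : Homotopy L M I) (P : Subdivision E) (k : ℕ) (s : ℝ) (y : L.Body) :
    Matrix (Fin E.rank) (Fin E.rank) (OddExt 𝕜 L.Alg) :=
  wilsonUpTo P (fun t => H.body t s y) (fun t => H.pull t s y) k

/-- The Wilson line over `[0, t]`, where `t` lies in the piece `k`. -/
def lineTo (H : Homotopy L M I) (P : Subdivision E) (k : ℕ) (t s : ℝ) (y : L.Body) :
    Matrix (Fin E.rank) (Fin E.rank) (OddExt 𝕜 L.Alg) :=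
  H.U E (P.patch k) t (P.τ k) s y * (H.Om E (P.patch k) (P.patch (k - 1)) (P.τ k) s y *
    H.lineUpTo P k s y)

theorem lineUpTo_succ (k : ℕ) (s : ℝ) (y : L.Body) :
    H.lineUpTo P (k + 1) s y = H.lineTo P k (P.τ (k + 1)) s y := by
  rw [lineTo, ← mul_assoc]
  rfl

/-- `F` satisfies the equation of a parallel transport from the patch `j` at the time `a` to the
patch `i` at the time `b`. -/
structure IsTransport (H : Homotopy L M I) (E : QBundle M) (W : Set (ℝ × L.Body)) (i : E.Patch)
    (b : ℝ) (j : E.Patch) (a : ℝ)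
    (F : ℝ → L.Body → Matrix (Fin E.rank) (Fin E.rank) (OddExt 𝕜 L.Alg)) : Prop where
  fnM : FnM W E.lev E.lev F
  dM_eq : ∀ x ∈ W, dM L F x.1 x.2 =
    -(H.B E i b x.1 x.2 * F x.1 x.2) + parM 𝕜 (F x.1 x.2) * H.B E j a x.1 x.2

namespace IsTransport

variable {k : E.Patch} {c : ℝ}
  {F G : ℝ → L.Body → Matrix (Fin E.rank) (Fin E.rank) (OddExt 𝕜 L.Alg)}

/-- In dF·G + par(F)·dG the two terms par(F)B_jG at the common endpoint cancel. Because of this,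
transports over pieces and transition matrices can be multiplied freely. -/
theorem mul (hW : RelOpen W) (hF : IsTransport H E W i b j a F) (hG : IsTransport H E W j a k c G) :
    IsTransport H E W i b k c (fun s y => F s y * G s y) := by
  refine ⟨hF.fnM.mul hG.fnM, fun x hx => ?_⟩
  rw [dM_mul hW hF.fnM hG.fnM hx, hF.dM_eq x hx, hG.dM_eq x hx, parM_mul]
  noncomm_ring

theorem congr (hW : RelOpen W) (hF : IsTransport H E W i b j a F)
    (h : ∀ x ∈ W, G x.1 x.2 = F x.1 x.2) : IsTransport H E W i b j a G :=
  ⟨hF.fnM.congr h, fun x hx => by rw [dM_congr hW hF.fnM h hx, hF.dM_eq x hx, h x hx]⟩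

theorem one (hW : RelOpen W) : IsTransport H E W i a i a (fun _ _ => 1) :=
  ⟨FnM.one _, fun x hx => by rw [dM_one hW hx, parM_one]; simp⟩

theorem U (hW : RelOpen W) (hI : Icc a b ⊆ I) (hab : a ≤ b)
    (hU : ∀ t ∈ Icc a b, ∀ x ∈ W, H.body t x.1 x.2 ∈ E.dom i) :
    IsTransport H E W i b i a (H.U E i b a) :=
  ⟨fnM_U hW hI hab hU, fun _ hx => dM_U hW hI hab hU hx⟩

theorem Om (hW : RelOpen W) (ht : t ∈ I)
    (hU : ∀ x ∈ W, H.body t x.1 x.2 ∈ E.dom i ∩ E.dom j) :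
    IsTransport H E W i t j t (H.Om E i j t) :=
  ⟨H.fnM_Om ht (fun _ => hW.mem_Icc) hU, fun x hx => by
    rw [H.dM_Om ht (hW.mem_Icc hx) (hU x hx)]; abel⟩

theorem lineTo_of_lineUpTo (hW : RelOpen W) (hI : Icc (0 : ℝ) 1 ⊆ I) (hP : W ⊆ H.adaptedSet P)
    {k : ℕ} (hk : k < P.n) (ht : t ∈ Icc (P.τ k) (P.τ (k + 1)))
    (h : IsTransport H E W (P.patch (k - 1)) (P.τ k) P.first 0 (H.lineUpTo P k)) :
    IsTransport H E W (P.patch k) t P.first 0 (H.lineTo P k t) := by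
  have hs : Icc (P.τ k) t ⊆ Icc (P.τ k) (P.τ (k + 1)) := Icc_subset_Icc_right ht.2
  refine (U hW (hs.trans ((P.Icc_subset hk).trans hI)) ht.1
    fun u hu x hx => (hP hx).2 k hk u (hs hu)).mul hW ((Om hW (hI ?_) ?_).mul hW h)
  · exact P.Icc_subset hk (left_mem_Icc.2 (P.mono k hk))
  · exact fun x hx => P.mem_prev (hP hx).2 hk

theorem lineUpTo (hW : RelOpen W) (hI : Icc (0 : ℝ) 1 ⊆ I) (hP : W ⊆ H.adaptedSet P)
    {k : ℕ} (hk : k ≤ P.n) :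
    IsTransport H E W (P.patch (k - 1)) (P.τ k) P.first 0 (H.lineUpTo P k) := by
  induction k with
  -- Here `0 - 1 = 0`, so the target patch is the first patch and the empty product is the trivial
  -- transport.
  | zero => rw [P.start]; exact one hW
  | succ k ih =>
    exact (lineTo_of_lineUpTo hW hI hP hk (right_mem_Icc.2 (P.mono k hk)) (ih (by omega))).congr hW
      fun x _ => lineUpTo_succ k x.1 x.2

theorem lineTo (hW : RelOpen W) (hI : Icc (0 : ℝ) 1 ⊆ I) (hP : W ⊆ H.adaptedSet P)
    {k : ℕ} (hk : k < P.n) (ht : t ∈ Icc (P.τ k) (P.τ (k + 1))) :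
    IsTransport H E W (P.patch k) t P.first 0 (H.lineTo P k t) :=
  lineTo_of_lineUpTo hW hI hP hk ht (lineUpTo hW hI hP hk.le)

theorem line (hW : RelOpen W) (hI : Icc (0 : ℝ) 1 ⊆ I) (hP : W ⊆ H.adaptedSet P) :
    IsTransport H E W P.last 1 P.first 0 (H.line P) := by
  have := lineUpTo hW hI hP le_rfl
  rwa [P.finish] at this

end IsTransport

/-! #### The change of the Wilson line -/

/-- The ϑ-component of the transport equation, with the parity of the entry F_αγ written as the sign
(-1)^(α+γ). -/
theorem IsTransport.hasDWithin {F : ℝ → L.Body → Matrix (Fin E.rank) (Fin E.rank) (OddExt 𝕜 L.Alg)}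
    (hW : RelOpen W) (hF : IsTransport H E W i b j a F) (hx : x ∈ W) (α β) :
    HasDWithin 𝕜 (fun s' => bot (F s' x.2) α β)
      (L.Q (fun y' => iot (F x.1 y') α β) x.2 + iot (Matrix.of fun α β =>
        -∑ δ, H.B E i b x.1 x.2 α δ * F x.1 x.2 δ β +
          ∑ γ, sg (E.lev α + E.lev γ) (F x.1 x.2 α γ * H.B E j a x.1 x.2 γ β)) α β)
      (Icc 0 1) x.1 := by
  refine ((hF.fnM α β).hasDWithin_fst hW hx).congr_deriv ?_
  rw [add_comm]
  congr 1
  have h := congrArg OddExt.snd (congrFun (congrFun (hF.dM_eq x hx) α) β)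
  refine Eq.trans h ?_
  simp only [iot, Matrix.map_apply, Matrix.of_apply, Matrix.add_apply, Matrix.neg_apply,
    Matrix.mul_apply]
  refine congrArg OddExt.snd (congrArg₂ (· + ·) rfl (Finset.sum_congr rfl fun γ _ => ?_))
  rw [parM_apply, ((hF.fnM α γ).homog x hx).par_eq, sg_mul]
  exact sg_congr ⟨-E.lev α, by ring⟩ _

theorem IsTransport.isFn {F : ℝ → L.Body → Matrix (Fin E.rank) (Fin E.rank) (OddExt 𝕜 L.Alg)}
    (hF : IsTransport H E W i b j a F) {s : ℝ} (α β) :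
    L.IsFn {y | (s, y) ∈ W} (E.lev β - E.lev α) (fun y => bot (F s y) α β) ∧
    L.IsFn {y | (s, y) ∈ W} (E.lev β - E.lev α - 1) (fun y => iot (F s y) α β) := by
  have hsl : ∀ c', MapsTo (fun w => (s, w))
      ((L.coord c').target ∩ (L.coord c').symm ⁻¹' {y | (s, y) ∈ W}) (chartSet W c') :=
    fun c' w hw => hw
  refine ⟨⟨fun y hy => (OddExt.isHomog_iff.1 ((hF.fnM α β).homog (s, y) hy)).1, fun c i => ?_⟩,
    ⟨fun y hy => (OddExt.isHomog_iff.1 ((hF.fnM α β).homog (s, y) hy)).2, fun c i => ?_⟩⟩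
  · exact ((hF.fnM α β).smooth c (Sum.inl i)).comp (contDiff_prodMk_right s).contDiffOn (hsl c)
  · exact ((hF.fnM α β).smooth c (Sum.inr i)).comp (contDiff_prodMk_right s).contDiffOn (hsl c)

/-- The ϑ-coefficient is regarded as a function without ϑ-part, so that the rules for `dys` yield
rules for d^y on it. -/
theorem fn_snd {q : ℤ} {G : ℝ → L.Body → OddExt 𝕜 L.Alg} (hG : Fn W q G) :
    Fn W (q - 1) fun s y => (⟨(G s y).snd, 0⟩ : OddExt 𝕜 L.Alg) := by
  refine ⟨fun x hx => OddExt.isHomog_iff.2 ⟨(OddExt.isHomog_iff.1 (hG.homog x hx)).2, IsHomog.zero⟩,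
    fun c => ?_⟩
  rintro (i | i)
  · exact hG.smooth c (Sum.inr i)
  · refine contDiffOn_const (c := (0 : 𝕜)) |>.congr fun r _ => ?_
    rw [cf_inr, framed, frK_snd, map_zero, cf_zero]

/-- `L.Q` is a bare map whose linearity is known only on functions, through its local form; hence
the detour through `dys`. -/
theorem Q_sg_snd {q : ℤ} {G : ℝ → L.Body → OddExt 𝕜 L.Alg} (hW : RelOpen W) (hG : Fn W q G)
    (hx : x ∈ W) (n : ℤ) : L.Q (fun y => sg n (G x.1 y).snd) x.2 =
      sg n (L.Q (fun y => (G x.1 y).snd) x.2) := by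
  have h := congrArg OddExt.fst (dys_sg hW n (fn_snd hG) hx)
  simp only [dys, OddExt.fst_sg] at h
  exact h

/-- The change of the Wilson line is exact. -/
theorem IsTransport.hasDsEnd {F : ℝ → L.Body → Matrix (Fin E.rank) (Fin E.rank) (OddExt 𝕜 L.Alg)}
    (hW : RelOpen W) (hF : IsTransport H E W i b j a F) (hx : x ∈ W)
    (hB : ∀ α β, IsHomog 𝕜 (1 + E.lev β - E.lev α) (H.B E i b x.1 x.2 α β)) :
    HasDsEnd (iot (H.B E i b x.1 x.2)) (iot (H.B E j a x.1 x.2)) (fun s' => bot (F s' x.2))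
      (dEnd (bot (H.B E i b x.1 x.2)) (bot (H.B E j a x.1 x.2))
        (fun y' => Matrix.of fun α β => sg (E.lev α) (iot (F x.1 y') α β)) x.2) x.1 := by
  intro α β
  refine (hF.hasDWithin hW hx α β).congr_deriv ?_
  have hFh := fun α β => OddExt.isHomog_iff.1 ((hF.fnM α β).homog x hx)
  -- In the ϑ-component of -BF + par(F)B, the terms with ι B are the motion of the frames ζ under
  -- ∂_s (for the initial point this is `h3`), and the terms with ι F are the action of d^y on the
  -- frames (`h1`, `h2`).
  have h1 : ∀ γ, GrAlg.par (𝕜 := 𝕜) (H.B E i b x.1 x.2 α γ).fst * (F x.1 x.2 γ β).snd =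
      -sg (E.lev α) ((H.B E i b x.1 x.2 α γ).fst * sg (E.lev γ) (F x.1 x.2 γ β).snd) := fun γ => by
    rw [(OddExt.isHomog_iff.1 (hB α γ)).1.par_eq, sg_mul, mul_sg, sg_sg, ← sg_succ]
    exact sg_congr ⟨-E.lev α, by ring⟩ _
  have h2 : ∀ γ, sg (E.lev α) (GrAlg.par (𝕜 := 𝕜) (sg (E.lev α) (F x.1 x.2 α γ).snd) *
      (H.B E j a x.1 x.2 γ β).fst) =
      -sg (E.lev α + E.lev γ) ((F x.1 x.2 α γ).snd * (H.B E j a x.1 x.2 γ β).fst) := fun γ => by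
    rw [map_sg, (hFh α γ).2.par_eq, sg_sg, sg_mul, sg_sg, ← sg_succ]
    exact sg_congr ⟨-1 , by ring⟩ _
  have h3 : ∀ γ, sg (E.lev α + E.lev γ) (GrAlg.par (𝕜 := 𝕜) (F x.1 x.2 α γ).fst *
      (H.B E j a x.1 x.2 γ β).snd) = (F x.1 x.2 α γ).fst * (H.B E j a x.1 x.2 γ β).snd := fun γ => by
    rw [(hFh α γ).1.par_eq, sg_mul, sg_sg, sg_even ⟨E.lev γ, by ring⟩]
  simp only [iot, bot, dEnd, Matrix.map_apply, Matrix.of_apply, Matrix.add_apply,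
    Matrix.sub_apply, Matrix.mul_apply, OddExt.snd_add, OddExt.snd_neg, snd_sum, OddExt.snd_sg,
    OddExt.snd_mul, h1, h2, h3, sg_add, Finset.sum_add_distrib, Q_sg_snd hW (hF.fnM α β) hx,
    sg_self, Finset.sum_neg_distrib]
  abel

/-- The change of the Wilson line under a homotopy. -/
theorem line_variation (H : Homotopy L M (Icc 0 1)) (s : ℝ) (y : L.Body) (P : Subdivision E)
    (hs : s ∈ Icc (0 : ℝ) 1) (hP : P.Adapted fun t => H.body t s y) :
    (∃ V : Set L.Body, IsOpen V ∧ y ∈ V ∧ ∀ α β,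
      L.IsFn V (E.lev β - E.lev α) (fun y' => bot (H.line P s y') α β) ∧
      L.IsFn V (E.lev β - E.lev α - 1) (fun y' => iot (H.line P s y') α β)) ∧
    (∀ α β, HasDWithin 𝕜 (fun s' => bot (H.line P s' y) α β)
      (L.Q (fun y' => iot (H.line P s y') α β) y +
        iot (Matrix.of fun α β => -∑ δ, H.Tfin P s y α δ * H.line P s y δ β +
          ∑ γ, sg (E.lev α + E.lev γ) (H.line P s y α γ * H.Tinit P s y γ β)) α β)
      (Icc 0 1) s) ∧
    HasDsEnd (iot (H.Tfin P s y)) (iot (H.Tinit P s y)) (fun s' => bot (H.line P s' y))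
      (dEnd (bot (H.Tfin P s y)) (bot (H.Tinit P s y))
        (fun y' => Matrix.of fun α β => sg (E.lev α) (iot (H.line P s y') α β)) y) s := by
  have hW := H.relOpen_adaptedSet P subset_rfl
  have hx : (s, y) ∈ H.adaptedSet P := ⟨hs, hP⟩
  have hF := IsTransport.line hW subset_rfl subset_rfl (H := H) (P := P)
  exact ⟨⟨_, hW.isOpen_slice hs, hx, hF.isFn⟩, hF.hasDWithin hW hx,
    hF.hasDsEnd hW hx fun α β => H.B_homog (right_mem_Icc.2 zero_le_one) hs (P.mem_last hP) α β⟩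

end Homotopy
end Lines

/-! ### Supertraces -/

section Supertrace

variable {𝕜 : Type} [RCLike 𝕜] {R : Type} [Ring R] [Algebra 𝕜 R] [GrAlg 𝕜 R] {n : Type}

/-- The sign `(-1)^α` acting on the rows of a matrix. -/
def jM (lev : n → ℤ) (X : Matrix n n R) : Matrix n n R := Matrix.of fun α β => sg (lev α) (X α β)

variable {lev : n → ℤ} {X Y : Matrix n n R}

theorem jM_apply (α β) : jM lev X α β = sg (lev α) (X α β) := rfl

theorem jM_sub : jM lev (X - Y) = jM lev X - jM lev Y := by
  ext; simp only [jM_apply, Matrix.sub_apply, sg_sub]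

variable [Fintype n]

theorem jM_mul : jM lev X * Y = jM lev (X * Y) := by
  ext; simp only [jM_apply, Matrix.mul_apply, sg_mul, sg_sum]

/-- The parity (-1)^(p+γ-α) of X_αγ turns the row sign at γ into the row sign at α, up to the
overall sign (-1)^p. -/
theorem parM_mul_jM {p : ℤ} (hX : ∀ α β, IsHomog 𝕜 (p + lev β - lev α) (X α β)) :
    parM 𝕜 X * jM lev Y = (jM lev (X * Y)).map (sg p) := by
  ext α β
  simp only [jM_apply, Matrix.mul_apply, parM_apply, Matrix.map_apply, sg_sum]
  refine Finset.sum_congr rfl fun γ _ => ?_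
  rw [(hX α γ).par_eq, sg_mul, mul_sg, sg_sg, sg_sg]
  exact sg_congr ⟨lev γ - lev α, by ring⟩ _

/-- The supertrace. -/
def str (lev : n → ℤ) (X : Matrix n n R) : R := ∑ α, sg (lev α) (X α α)

theorem str_eq_trace : str lev X = (jM lev X).trace := rfl

theorem str_add : str lev (X + Y) = str lev X + str lev Y := by
  simp only [str, Matrix.add_apply, sg_add, Finset.sum_add_distrib]

theorem str_sub : str lev (X - Y) = str lev X - str lev Y := by
  simp only [str, Matrix.sub_apply, sg_sub, Finset.sum_sub_distrib]

theorem str_neg : str lev (-X) = -str lev X := by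
  simp only [str, Matrix.neg_apply, sg_neg, Finset.sum_neg_distrib]

/-- Exchanging the entries costs (-1)^(n²) with n = β - α. As n² and n have the same parity, this is
the difference of the two row signs. -/
theorem str_mul_comm [FinGr 𝕜 R] (hX : ∀ α β, IsHomog 𝕜 (lev β - lev α) (X α β))
    (hY : ∀ α β, IsHomog 𝕜 (lev β - lev α) (Y α β)) : str lev (X * Y) = str lev (Y * X) := by
  simp only [str, Matrix.mul_apply, sg_sum]
  rw [Finset.sum_comm]
  refine Finset.sum_congr rfl fun β _ => Finset.sum_congr rfl fun α _ => ?_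
  rw [FinGr.comm (𝕜 := 𝕜) _ _ _ _ (hX α β) (hY β α), sg_sg]
  refine sg_congr ?_ _
  obtain ⟨m, hm⟩ := Int.even_mul_succ_self (lev β - lev α)
  exact ⟨-m + (lev α - lev α), by linear_combination -hm⟩

/-- The boundary terms of a closed transport cancel for this reason: the parity of X and the
exchange sign together again amount to (-1)^(β-α). -/
theorem str_parM_mul [FinGr 𝕜 R] (hX : ∀ α β, IsHomog 𝕜 (lev β - lev α) (X α β))
    (hY : ∀ α β, IsHomog 𝕜 (1 + lev β - lev α) (Y α β)) :
    str lev (parM 𝕜 X * Y) = str lev (Y * X) := by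
  simp only [str, Matrix.mul_apply, sg_sum]
  rw [Finset.sum_comm]
  refine Finset.sum_congr rfl fun β _ => Finset.sum_congr rfl fun α _ => ?_
  rw [parM_apply, FinGr.comm (𝕜 := 𝕜) _ _ _ _ (hX α β).par (hY β α), (hX α β).par_eq, mul_sg,
    sg_sg, sg_sg]
  refine sg_congr ?_ _
  obtain ⟨m, hm⟩ := Int.even_mul_succ_self (lev β - lev α)
  exact ⟨-m + (lev β - lev α), by linear_combination -hm⟩

/-- The two entries have opposite degrees ±n, so the exchange sign (-1)^(n²) is cancelled by the
parity (-1)^n and the ordinary trace suffices. -/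
theorem trace_parM_mul [FinGr 𝕜 R] (hX : ∀ α β, IsHomog 𝕜 (lev β - lev α - 1) (X α β))
    (hY : ∀ α β, IsHomog 𝕜 (1 + lev β - lev α) (Y α β)) :
    (parM 𝕜 X * Y).trace = (Y * X).trace := by
  simp only [Matrix.trace, Matrix.diag, Matrix.mul_apply]
  rw [Finset.sum_comm]
  refine Finset.sum_congr rfl fun β _ => Finset.sum_congr rfl fun α _ => ?_
  rw [parM_apply, FinGr.comm (𝕜 := 𝕜) _ _ _ _ (hX α β).par (hY β α), (hX α β).par_eq, mul_sg]
  refine (sg_sg _ _ _).trans (sg_even ?_ _)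
  obtain ⟨m, hm⟩ := Int.even_mul_succ_self (lev β - lev α)
  exact ⟨-m + 2 * (lev β - lev α) - 1, by linear_combination -hm⟩

end Supertrace

namespace Homotopy

variable {𝕜 : Type} [RCLike 𝕜] {L M : NQManifold 𝕜} {I : Set ℝ} {H : Homotopy L M I}
  {E : QBundle M} {W : Set (ℝ × L.Body)} {a b c t : ℝ} {i j k : E.Patch} {x : ℝ × L.Body}

/-! #### Change of the patch -/

theorem hasMD_jM {N : Type} {lev : N → ℤ} {R : Type} [Ring R] [Algebra 𝕜 R] [GrAlg 𝕜 R]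
    {X : ℝ → Matrix N N R} {X' : Matrix N N R} {S : Set ℝ} (hX : HasMD 𝕜 X X' S t) :
    HasMD 𝕜 (fun t => jM lev (X t)) (jM lev X') S t := fun α β => (hX α β).sgn _

/-- Path ordered exponentials in two patches agree up to transition matrices and an exact term. -/
theorem exists_patch_homotopy (hW : RelOpen W) (hI : Icc a b ⊆ I) (hab : a ≤ b)
    (hU : ∀ t ∈ Icc a b, ∀ x ∈ W, H.body t x.1 x.2 ∈ E.dom j ∩ E.dom i) :
    ∃ Z : ℝ → L.Body → Matrix (Fin E.rank) (Fin E.rank) (OddExt 𝕜 L.Alg),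
      FnM W E.lev (fun β => E.lev β - 1) Z ∧ ∀ x ∈ W,
      jM E.lev (H.Om E j i b x.1 x.2 * H.U E i b a x.1 x.2 -
        H.U E j b a x.1 x.2 * H.Om E j i a x.1 x.2) =
      -(dM L Z x.1 x.2 + H.B E j b x.1 x.2 * Z x.1 x.2 -
        parM 𝕜 (Z x.1 x.2) * H.B E i a x.1 x.2) := by
  have hUj := fun t ht x hx => (hU t ht x hx).1
  have hUi := fun t ht x hx => (hU t ht x hx).2
  set e : Fin E.rank ⊕ Fin E.rank ≃ Fin (E.rank + E.rank) := finSumFinEquiv with he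
  -- The shift by one in the second block gives the off-diagonal blocks, Ω at θ = 0 in `B₀` and its
  -- θ-component in `A₀`, the degrees required of such matrices.
  set lv : Fin E.rank ⊕ Fin E.rank → ℤ := Sum.elim E.lev fun β => E.lev β - 1 with hlv
  set lev : Fin (E.rank + E.rank) → ℤ := fun α => lv (e.symm α) with hlev
  -- The mapping cone of Ω: T of both patches on the diagonal and Ω, with the row sign J, above it.
  -- The gauge equation makes this block matrix flat.
  set A₀ : ℝ → ℝ → L.Body → Matrix (Fin E.rank ⊕ Fin E.rank) (Fin E.rank ⊕ Fin E.rank)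
      (OddExt 𝕜 L.Alg) := fun t s y => Matrix.fromBlocks (H.A E j t s y)
        (jM E.lev (H.Om1 E j i t s y)) 0 (H.A E i t s y) with hA₀
  set B₀ : ℝ → ℝ → L.Body → Matrix (Fin E.rank ⊕ Fin E.rank) (Fin E.rank ⊕ Fin E.rank)
      (OddExt 𝕜 L.Alg) := fun t s y => Matrix.fromBlocks (H.B E j t s y)
        (jM E.lev (H.Om E j i t s y)) 0 (H.B E i t s y) with hB₀
  set A := fun t s y => (A₀ t s y).submatrix e.symm e.symm with hA
  set B := fun t s y => (B₀ t s y).submatrix e.symm e.symm with hB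
  have hIcc := fun x (hx : x ∈ W) => hW.mem_Icc hx
  have hAf₀ : ∀ α β, Fam W a b (lv β - lv α) fun t s y => A₀ t s y α β := by
    rintro (α | α) (β | β)
    · exact H.fam_A hI hIcc hUj α β
    · exact ((H.fam_Om1 hI hIcc hU α β).sgn _).congr_deg (by simp only [hlv, Sum.elim_inl, Sum.elim_inr]; ring)
    · exact Fam.zero
    · exact (H.fam_A hI hIcc hUi α β).congr_deg (by simp only [hlv, Sum.elim_inr]; ring)
  have hAf : ∀ α β, Fam W a b (lev β - lev α) fun t s y => A t s y α β := fun α β => hAf₀ _ _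
  have hBh₀ : ∀ t ∈ Icc a b, ∀ x ∈ W, ∀ α β, IsHomog 𝕜 (1 + lv β - lv α) (B₀ t x.1 x.2 α β) := by
    rintro t ht x hx (α | α) (β | β)
    · exact H.B_homog (hI ht) (hIcc x hx) (hUj t ht x hx) α β
    · exact (((H.fam_Om hI hIcc hU α β).homog t ht x hx).sgn _).congr (by simp only [hlv, Sum.elim_inl, Sum.elim_inr]; ring)
    · exact IsHomog.zero
    · exact (H.B_homog (hI ht) (hIcc x hx) (hUi t ht x hx) α β).congr (by simp only [hlv, Sum.elim_inr]; ring)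
  -- Flatness of the cone. The diagonal blocks are `hasMD_B` for the two patches, the upper right
  -- block is `hasMD_Om` multiplied by J.
  have hBd₀ : ∀ t ∈ Icc a b, ∀ x ∈ W, HasMD 𝕜 (fun t => B₀ t x.1 x.2)
      (dM L (A₀ t) x.1 x.2 - parM 𝕜 (A₀ t x.1 x.2) * B₀ t x.1 x.2 +
        B₀ t x.1 x.2 * A₀ t x.1 x.2) (Icc a b) t := by
    intro t ht x hx
    have hd : dM L (A₀ t) x.1 x.2 = Matrix.fromBlocks (dM L (H.A E j t) x.1 x.2)
        (jM E.lev (dM L (H.Om1 E j i t) x.1 x.2)) 0 (dM L (H.A E i t) x.1 x.2) := by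
      ext1 α β
      rcases α with α | α <;> rcases β with β | β
      · rfl
      · exact dys_sg hW _ ((H.fam_Om1 hI hIcc hU α β).slice ht) hx
      · exact dys_zero hW hx
      · rfl
    have hp : parM 𝕜 (A₀ t x.1 x.2) = Matrix.fromBlocks (parM 𝕜 (H.A E j t x.1 x.2))
        (jM E.lev (parM 𝕜 (H.Om1 E j i t x.1 x.2))) 0 (parM 𝕜 (H.A E i t x.1 x.2)) := by
      ext1 α β
      rcases α with α | α <;> rcases β with β | β
      · rfl
      · exact map_sg (GrAlg.par (𝕜 := 𝕜)) _ _
      · exact map_zero (GrAlg.par (𝕜 := 𝕜))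
      · rfl
    have hAj : parM 𝕜 (H.A E j t x.1 x.2) * jM E.lev (H.Om E j i t x.1 x.2) =
        jM E.lev (H.A E j t x.1 x.2 * H.Om E j i t x.1 x.2) := by
      rw [parM_mul_jM (p := 0) fun α β =>
        ((H.fam_A hI hIcc hUj α β).homog t ht x hx).congr (by ring)]
      ext1 α β; simp only [Matrix.map_apply, sg_even (Even.zero)]
    have hBj : H.B E j t x.1 x.2 * jM E.lev (H.Om1 E j i t x.1 x.2) =
        -jM E.lev (parM 𝕜 (H.B E j t x.1 x.2) * H.Om1 E j i t x.1 x.2) := by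
      have h := parM_mul_jM (𝕜 := 𝕜) (p := 1) (X := parM 𝕜 (H.B E j t x.1 x.2))
        (Y := H.Om1 E j i t x.1 x.2) fun α β =>
          (H.B_homog (hI ht) (hIcc x hx) (hUj t ht x hx) α β).par
      rw [parM_parM] at h
      rw [h]
      ext1 α β; simp only [Matrix.map_apply, Matrix.neg_apply, sg_odd odd_one]
    rw [hd, hp]
    simp only [hA₀, hB₀, Matrix.fromBlocks_multiply, Matrix.mul_zero, Matrix.zero_mul, add_zero,
      zero_add, hAj, hBj, jM_mul]
    have hj := (H.hasMD_B (hI ht) (hIcc x hx) (hUj t ht x hx)).mono hI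
    have hi := (H.hasMD_B (hI ht) (hIcc x hx) (hUi t ht x hx)).mono hI
    have ho := hasMD_jM (lev := E.lev) ((H.hasMD_Om (hI ht) (hIcc x hx) (hU t ht x hx)).mono hI)
    rintro (α | α) (β | β)
    · exact hj α β
    · refine (ho α β).congr_deriv ?_
      simp only [Matrix.add_apply, Matrix.sub_apply, Matrix.fromBlocks_apply₁₂, Matrix.neg_apply,
        jM_apply, sg_add, sg_sub]
      abel
    · refine (HasDWithin.const 0).congr_deriv ?_
      simp
    · exact hi α β
  have hU₀ := fnM_pexp hW hab hAf
  set V : ℝ → ℝ → L.Body → Matrix (Fin E.rank ⊕ Fin E.rank) (Fin E.rank ⊕ Fin E.rank)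
      (OddExt 𝕜 L.Alg) := fun t s y => (pexp 𝕜 (fun t => A t s y) t a).submatrix e e with hV
  have hVd : ∀ x ∈ W, ∀ t ∈ Icc a b, HasMD 𝕜 (fun t => V t x.1 x.2)
      (-(A₀ t x.1 x.2 * V t x.1 x.2)) (Icc a b) t := by
    intro x hx t ht α β
    refine (hasDWithin_pexp hab (coeffCts_of_fam hx hab hAf) ht (e α) (e β)).congr_deriv ?_
    rw [Matrix.neg_apply, Matrix.mul_apply, Matrix.mul_apply, ← e.sum_comp]
    simp [hA, hV]
  have hV1 : ∀ x : ℝ × L.Body, V a x.1 x.2 = 1 := fun x => by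
    simp only [hV, pexp_self]
    exact Matrix.submatrix_one_equiv e
  -- The exponential is block triangular: each of the three other blocks solves a linear equation of
  -- its own, so uniqueness identifies it. The lower left block comes first because it enters the
  -- equation of the upper left one.
  have hblk : ∀ x ∈ W, ∀ t ∈ Icc a b, ∃ Z, V t x.1 x.2 =
      Matrix.fromBlocks (H.U E j t a x.1 x.2) Z 0 (H.U E i t a x.1 x.2) := by
    intro x hx t ht
    have hmul : ∀ t, A₀ t x.1 x.2 * V t x.1 x.2 = Matrix.fromBlocks
        (H.A E j t x.1 x.2 * (V t x.1 x.2).toBlocks₁₁ +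
          jM E.lev (H.Om1 E j i t x.1 x.2) * (V t x.1 x.2).toBlocks₂₁)
        (H.A E j t x.1 x.2 * (V t x.1 x.2).toBlocks₁₂ +
          jM E.lev (H.Om1 E j i t x.1 x.2) * (V t x.1 x.2).toBlocks₂₂)
        (H.A E i t x.1 x.2 * (V t x.1 x.2).toBlocks₂₁)
        (H.A E i t x.1 x.2 * (V t x.1 x.2).toBlocks₂₂) := fun t => by
      conv_lhs => rw [← Matrix.fromBlocks_toBlocks (V t x.1 x.2)]
      simp only [hA₀, Matrix.fromBlocks_multiply, Matrix.zero_mul, zero_add]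
    have hci := coeffCts_of_fam hx hab (H.fam_A hI hIcc hUi)
    have hcj := coeffCts_of_fam hx hab (H.fam_A hI hIcc hUj)
    have h21 : ∀ t ∈ Icc a b, (V t x.1 x.2).toBlocks₂₁ = 0 := fun t ht => by
      rw [eq_pexp_mul (X := fun t => (V t x.1 x.2).toBlocks₂₁) hab hci (fun t ht α β => ?_) ht]
      · rw [hV1, ← Matrix.fromBlocks_one, Matrix.toBlocks_fromBlocks₂₁, Matrix.mul_zero]
      · refine (hVd x hx t ht (Sum.inr α) (Sum.inl β)).congr_deriv ?_
        rw [hmul]; rfl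
    have h22 : ∀ t ∈ Icc a b, (V t x.1 x.2).toBlocks₂₂ = H.U E i t a x.1 x.2 := fun t ht => by
      refine pexp_unique (X := fun t => (V t x.1 x.2).toBlocks₂₂) hab hci (fun t ht α β => ?_) ?_ ht
      · refine (hVd x hx t ht (Sum.inr α) (Sum.inr β)).congr_deriv ?_
        rw [hmul]; rfl
      · rw [hV1, ← Matrix.fromBlocks_one, Matrix.toBlocks_fromBlocks₂₂]
    have h11 : ∀ t ∈ Icc a b, (V t x.1 x.2).toBlocks₁₁ = H.U E j t a x.1 x.2 := fun t ht => by
      refine pexp_unique (X := fun t => (V t x.1 x.2).toBlocks₁₁) hab hcj (fun t ht α β => ?_) ?_ ht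
      · refine (hVd x hx t ht (Sum.inl α) (Sum.inl β)).congr_deriv ?_
        rw [hmul, h21 t ht, Matrix.mul_zero, add_zero]; rfl
      · rw [hV1, ← Matrix.fromBlocks_one, Matrix.toBlocks_fromBlocks₁₁]
    refine ⟨(V t x.1 x.2).toBlocks₁₂, ?_⟩
    rw [← h11 t ht, ← h22 t ht, ← h21 t ht, Matrix.fromBlocks_toBlocks]
  -- The primitive is the upper right block; the claim is the upper right block of the transport
  -- equation for the cone.
  refine ⟨fun s y => (V b s y).toBlocks₁₂, fun α β => ?_, fun x hx => ?_⟩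
  · refine (hU₀ (e (Sum.inl α)) (e (Sum.inr β))).congr_deg ?_
    simp [hlev, hlv]
  · have hbb := right_mem_Icc.2 hab
    have haa := left_mem_Icc.2 hab
    have hdU := dM_pexp (B := B) hW hab hAf hx (lB := fun α β => 1 + lev β - lev α)
      (fun t ht α β => hBh₀ t ht x hx _ _) fun t ht α β => by
        refine (hBd₀ t ht x hx (e.symm α) (e.symm β)).congr_deriv ?_
        rw [Matrix.add_apply, Matrix.add_apply, Matrix.sub_apply, Matrix.sub_apply,
          Matrix.mul_apply, Matrix.mul_apply, Matrix.mul_apply, Matrix.mul_apply,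
          ← e.sum_comp, ← e.sum_comp]
        simp only [hA, hB, parM_apply, Matrix.submatrix_apply, Equiv.symm_apply_apply]
        rfl
    have hdV : dM L (V b) x.1 x.2 = -(B₀ b x.1 x.2 * V b x.1 x.2) +
        parM 𝕜 (V b x.1 x.2) * B₀ a x.1 x.2 := by
      ext1 α β
      refine (congrFun (congrFun hdU (e α)) (e β)).trans ?_
      rw [Matrix.add_apply, Matrix.add_apply, Matrix.neg_apply, Matrix.neg_apply,
          Matrix.mul_apply, Matrix.mul_apply, Matrix.mul_apply, Matrix.mul_apply,
          ← e.sum_comp, ← e.sum_comp]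
      simp only [hV, hB, parM_apply, Matrix.submatrix_apply, Equiv.symm_apply_apply]
    obtain ⟨Z, hZ⟩ := hblk x hx b hbb
    have hp : parM 𝕜 (V b x.1 x.2) = Matrix.fromBlocks (parM 𝕜 (H.U E j b a x.1 x.2))
        (parM 𝕜 Z) 0 (parM 𝕜 (H.U E i b a x.1 x.2)) := by
      rw [hZ]
      ext1 α β
      rcases α with α | α <;> rcases β with β | β
      · rfl
      · rfl
      · exact map_zero (GrAlg.par (𝕜 := 𝕜))
      · rfl
    have hUj' : parM 𝕜 (H.U E j b a x.1 x.2) * jM E.lev (H.Om E j i a x.1 x.2) =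
        jM E.lev (H.U E j b a x.1 x.2 * H.Om E j i a x.1 x.2) := by
      rw [parM_mul_jM (p := 0) fun α β =>
        ((fnM_U hW hI hab hUj α β).homog x hx).congr (by ring)]
      ext1 α β; simp only [Matrix.map_apply, sg_even (Even.zero)]
    have hd12 : dM L (fun s y => (V b s y).toBlocks₁₂) x.1 x.2 =
        (dM L (V b) x.1 x.2).toBlocks₁₂ := rfl
    have hZ' : (V b x.1 x.2).toBlocks₁₂ = Z := by rw [hZ, Matrix.toBlocks_fromBlocks₁₂]
    rw [hd12, hdV, hp]
    dsimp only
    rw [hZ', hZ]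
    simp only [hB₀, Matrix.fromBlocks_multiply, Matrix.fromBlocks_neg, Matrix.fromBlocks_add,
      Matrix.toBlocks_fromBlocks₁₂, hUj', jM_mul, jM_sub]
    abel

end Homotopy

namespace Homotopy

/-! ### Wilson loops of a homotopy -/

variable {𝕜 : Type} [RCLike 𝕜] {L M : NQManifold 𝕜} {I : Set ℝ} {H : Homotopy L M I}
  {E : QBundle M} {W : Set (ℝ × L.Body)} {a b c t : ℝ} {i j k : E.Patch} {x : ℝ × L.Body}
  {P P' : Subdivision E}

/-- There are no nonzero functions of negative degree. This kills exact terms with a primitive of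
degree -1. -/
theorem dys_eq_zero_of_neg (hW : RelOpen W) {q : ℤ} {G : ℝ → L.Body → OddExt 𝕜 L.Alg}
    (hG : Fn W q G) (hq : q < 0) (hx : x ∈ W) : dys L G x.1 x.2 = 0 := by
  rw [dys_congr (F := fun _ _ => 0) hW (Fn.zero (q := q))
    (fun x hx => (hG.homog x hx).eq_zero_of_neg hq) hx, dys_zero hW hx]

/-- The supertrace of a parallel transport along a loop does not change if one of the patches is
replaced by another one. -/
theorem str_patch (hW : RelOpen W) (hI : Icc a b ⊆ I) (hab : a ≤ b)
    (hU : ∀ t ∈ Icc a b, ∀ x ∈ W, H.body t x.1 x.2 ∈ E.dom j ∩ E.dom i)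
    (hc : c ∈ I) (hk : ∀ x ∈ W, H.body c x.1 x.2 ∈ E.dom k)
    {X Y : ℝ → L.Body → Matrix (Fin E.rank) (Fin E.rank) (OddExt 𝕜 L.Alg)}
    (hX : IsTransport H E W k c j b X) (hY : IsTransport H E W i a k c Y) (hx : x ∈ W) :
    str E.lev (X x.1 x.2 * (H.Om E j i b x.1 x.2 * H.U E i b a x.1 x.2) * Y x.1 x.2) =
      str E.lev (X x.1 x.2 * (H.U E j b a x.1 x.2 * H.Om E j i a x.1 x.2) * Y x.1 x.2) := by
  obtain ⟨Z, hZ, hΔ⟩ := exists_patch_homotopy hW hI hab hU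
  -- Only differences of levels matter, so the factor Y may be regraded to match the shifted columns
  -- of Z.
  have hY' : FnM W (fun β => E.lev β - 1) (fun β => E.lev β - 1) Y := fun α β =>
    (hY.fnM α β).congr_deg (by ring)
  have hM := (hX.fnM.mul hZ).mul hY'
  have hdM : dM L (fun s y => X s y * Z s y * Y s y) x.1 x.2 = _ := dM_mul hW (hX.fnM.mul hZ) hY' hx
  rw [dM_mul hW hX.fnM hZ hx, hX.dM_eq x hx, hY.dM_eq x hx, parM_mul] at hdM
  -- The diagonal entries of XZY have degree -1, hence vanish together with their differentials.
  have htr : (dM L (fun s y => X s y * Z s y * Y s y) x.1 x.2).trace = 0 :=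
    Finset.sum_eq_zero fun α _ => dys_eq_zero_of_neg hW (hM α α) (by simp) hx
  have hcomm := trace_parM_mul (𝕜 := 𝕜) (lev := E.lev) (X := X x.1 x.2 * Z x.1 x.2 * Y x.1 x.2)
    (Y := H.B E k c x.1 x.2) (fun α β => ((hM α β).homog x hx).congr (by ring))
    (H.B_homog hc (hW.mem_Icc hx) (hk x hx))
  rw [← sub_eq_zero, ← str_sub, ← sub_mul, ← mul_sub]
  set Δ := H.Om E j i b x.1 x.2 * H.U E i b a x.1 x.2 -
    H.U E j b a x.1 x.2 * H.Om E j i a x.1 x.2 with hΔdef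
  have h1 : jM E.lev (X x.1 x.2 * Δ * Y x.1 x.2) =
      parM 𝕜 (X x.1 x.2) * jM E.lev Δ * Y x.1 x.2 := by
    rw [parM_mul_jM (p := 0) fun α β => ((hX.fnM α β).homog x hx).congr (by ring), ← jM_mul]
    congr 1
    ext1 α β; simp only [Matrix.map_apply, sg_even (Even.zero)]
  -- By the Leibniz rule the twisting terms of dZ at both ends of the piece are absorbed by dX and
  -- dY; only those at the base point `c` of the loop survive, and their trace is zero by `hcomm`.
  have h2 : parM 𝕜 (X x.1 x.2) * jM E.lev Δ * Y x.1 x.2 =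
      -dM L (fun s y => X s y * Z s y * Y s y) x.1 x.2 +
      (parM 𝕜 (X x.1 x.2 * Z x.1 x.2 * Y x.1 x.2) * H.B E k c x.1 x.2 -
        H.B E k c x.1 x.2 * (X x.1 x.2 * Z x.1 x.2 * Y x.1 x.2)) := by
    rw [hΔ x hx, hdM, parM_mul, parM_mul]
    noncomm_ring
  rw [str_eq_trace, h1, h2, Matrix.trace_add, Matrix.trace_neg, htr, Matrix.trace_sub, hcomm]
  simp

theorem lineTo_eq (hW : RelOpen W) (hI : Icc (0 : ℝ) 1 ⊆ I) (hP : W ⊆ H.adaptedSet P) {k : ℕ}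
    (hk : k < P.n) {t₀ : ℝ} (h₀ : P.τ k ≤ t₀) (ht : t₀ ≤ t) (h₁ : t ≤ P.τ (k + 1)) (hx : x ∈ W) :
    H.lineTo P k t x.1 x.2 = H.U E (P.patch k) t t₀ x.1 x.2 * H.lineTo P k t₀ x.1 x.2 := by
  have hs : Icc (P.τ k) t ⊆ Icc (P.τ k) (P.τ (k + 1)) := Icc_subset_Icc_right h₁
  have h := pexp_mul_pexp h₀ ht (coeffCts_of_fam hx (h₀.trans ht)
    (H.fam_A (hs.trans ((P.Icc_subset hk).trans hI)) (fun _ => hW.mem_Icc)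
      fun u hu x hx => (hP hx).2 k hk u (hs hu)))
  rw [lineTo, lineTo, U, ← h, mul_assoc]
  rfl

theorem lineTo_zero (hP : W ⊆ H.adaptedSet P) (hx : x ∈ W) : H.lineTo P 0 0 x.1 x.2 = 1 := by
  have h1 : H.U E (P.patch 0) 0 (P.τ 0) x.1 x.2 = 1 := by rw [U, P.start, pexp_self]
  have h2 : H.Om E (P.patch 0) (P.patch (0 - 1)) (P.τ 0) x.1 x.2 = 1 := by
    rw [P.start]; exact H.Om_self (P.mem_first (hP hx).2)
  have h3 : H.lineUpTo P 0 x.1 x.2 = 1 := rfl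
  rw [lineTo, h1, h2, h3, mul_one, mul_one]

theorem lineTo_succ (k : ℕ) (s : ℝ) (y : L.Body) : H.lineTo P (k + 1) (P.τ (k + 1)) s y =
    H.Om E (P.patch (k + 1)) (P.patch k) (P.τ (k + 1)) s y * H.lineTo P k (P.τ (k + 1)) s y := by
  rw [lineTo, U, pexp_self, one_mul, lineUpTo_succ, Nat.add_sub_cancel]

/-- Wilson lines of two subdivisions agree in the supertrace of a parallel transport along a
loop. -/
theorem str_lineTo (hW : RelOpen W) (hI : Icc (0 : ℝ) 1 ⊆ I) (hP : W ⊆ H.adaptedSet P)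
    (hP' : W ⊆ H.adaptedSet P') (m : ℕ) : ∀ (k l : ℕ) (t : ℝ), k + l = m → k < P.n → l < P'.n →
      t ∈ Icc (P.τ k) (P.τ (k + 1)) → t ∈ Icc (P'.τ l) (P'.τ (l + 1)) →
      ∀ X, IsTransport H E W P.first 0 (P'.patch l) t X → ∀ x ∈ W,
        str E.lev (X x.1 x.2 * (H.Om E (P'.patch l) (P.patch k) t x.1 x.2 *
          H.lineTo P k t x.1 x.2)) =
        str E.lev (X x.1 x.2 * (H.lineTo P' l t x.1 x.2 * H.Om E P'.first P.first 0 x.1 x.2)) := by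
  -- The induction runs backwards in time over the breakpoints of both subdivisions. It is essential
  -- that X is arbitrary, since it absorbs the part of the `P'` line already treated.
  induction m using Nat.strong_induction_on with
  | _ m ih =>
  intro k l t hm hk hl ht ht' X hX x hx
  -- The latest breakpoint before `t`: on [t₀, t] both subdivisions use a single patch each, so
  -- `str_patch` applies.
  set t₀ := max (P.τ k) (P'.τ l) with ht₀
  have h0 : t₀ ≤ t := max_le ht.1 ht'.1
  have hk0 : P.τ k ≤ t₀ := le_max_left _ _
  have hl0 : P'.τ l ≤ t₀ := le_max_right _ _
  have hs : Icc t₀ t ⊆ Icc (P.τ k) (P.τ (k + 1)) := Icc_subset_Icc hk0 ht.2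
  have hs' : Icc t₀ t ⊆ Icc (P'.τ l) (P'.τ (l + 1)) := Icc_subset_Icc hl0 ht'.2
  have hIs := hs.trans ((P.Icc_subset hk).trans hI)
  have hm0 := left_mem_Icc.2 h0
  -- it suffices to treat the time `t₀`
  suffices h : ∀ X, IsTransport H E W P.first 0 (P'.patch l) t₀ X → ∀ x ∈ W,
      str E.lev (X x.1 x.2 * (H.Om E (P'.patch l) (P.patch k) t₀ x.1 x.2 *
        H.lineTo P k t₀ x.1 x.2)) =
      str E.lev (X x.1 x.2 * (H.lineTo P' l t₀ x.1 x.2 * H.Om E P'.first P.first 0 x.1 x.2)) by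
    -- The exponential over [t₀, t] in the patch of `P'` joins X, after `str_patch` has moved the
    -- transition matrix from `t` to `t₀`.
    have hXU := hX.mul hW (IsTransport.U hW hIs h0 fun u hu x hx => (hP' hx).2 l hl u (hs' hu))
    have h1 := str_patch hW hIs h0
      (fun u hu x hx => ⟨(hP' hx).2 l hl u (hs' hu), (hP hx).2 k hk u (hs hu)⟩)
      (hI (left_mem_Icc.2 zero_le_one)) (fun x hx => P.mem_first (hP hx).2) hX
      (IsTransport.lineTo hW hI hP hk (hs hm0)) hx
    have h2 := h _ hXU x hx
    rw [lineTo_eq hW hI hP hk hk0 h0 ht.2 hx, lineTo_eq hW hI hP' hl hl0 h0 ht'.2 hx]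
    simp only [mul_assoc] at h1 h2 ⊢
    rw [h1, h2]
  clear hX X hx x
  intro X hX x hx
  have hbody : ∀ x ∈ W, H.body t₀ x.1 x.2 ∈ E.dom (P'.patch l) ∧
      H.body t₀ x.1 x.2 ∈ E.dom (P.patch k) := fun x hx =>
    ⟨(hP' hx).2 l hl t₀ (hs' hm0), (hP hx).2 k hk t₀ (hs hm0)⟩
  -- At a breakpoint of `P` the cocycle condition merges its transition matrix with the one between
  -- the two subdivisions.
  by_cases hck : ∃ k', k = k' + 1 ∧ t₀ = P.τ k
  · obtain ⟨k', rfl, htk⟩ := hck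
    have h1 := ih (k' + l) (by omega) k' l t₀ rfl (by omega) hl
      ⟨htk ▸ P.mono k' (by omega), htk.le⟩ (hs' hm0) X hX x hx
    rw [← h1, htk, lineTo_succ, ← mul_assoc (H.Om E (P'.patch l) _ _ _ _), H.Om_mul_Om]
    rw [← htk]
    exact ⟨⟨(hbody x hx).1, (hbody x hx).2⟩,
      (hP hx).2 k' (by omega) t₀ ⟨htk ▸ P.mono k' (by omega), htk.le⟩⟩
  -- At a breakpoint of `P'` its transition matrix is absorbed into X, and the cocycle condition is
  -- used in the other direction.
  by_cases hcl : ∃ l', l = l' + 1 ∧ t₀ = P'.τ l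
  · obtain ⟨l', rfl, htl⟩ := hcl
    have hm' : t₀ ∈ Icc (P'.τ l') (P'.τ (l' + 1)) := ⟨htl ▸ P'.mono l' (by omega), htl.le⟩
    have hb' : ∀ x ∈ W, H.body t₀ x.1 x.2 ∈ E.dom (P'.patch l') := fun x hx =>
      (hP' hx).2 l' (by omega) t₀ hm'
    have h1 := ih (k + l') (by omega) k l' t₀ rfl hk (by omega) (hs hm0) hm' _
      (hX.mul hW (IsTransport.Om hW (hIs hm0) fun x hx => ⟨(hbody x hx).1, hb' x hx⟩)) x hx
    have h2 : H.lineTo P' (l' + 1) t₀ x.1 x.2 = _ := htl ▸ lineTo_succ l' x.1 x.2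
    have h3 := H.Om_mul_Om (i := P'.patch (l' + 1)) (j := P'.patch l') (k := P.patch k)
      ⟨⟨(hbody x hx).1, hb' x hx⟩, (hbody x hx).2⟩
    rw [h2, ← h3]
    simp only [mul_assoc] at h1 ⊢
    exact h1
  -- the starting point
  have hk1 := P.τ_nonneg hk.le
  have hl1 := P'.τ_nonneg hl.le
  have hkl : k = 0 ∧ l = 0 := by
    rcases le_total (P.τ k) (P'.τ l) with h | h
    · have htl : t₀ = P'.τ l := max_eq_right h
      rcases l with - | l
      · refine ⟨?_, rfl⟩
        rcases k with - | k
        · rfl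
        · refine absurd ⟨k, rfl, ?_⟩ hck
          rw [P'.start] at h htl
          exact htl.trans (le_antisymm hk1 h)
      · exact absurd ⟨l, rfl, htl⟩ hcl
    · have htk : t₀ = P.τ k := max_eq_left h
      rcases k with - | k
      · refine ⟨rfl, ?_⟩
        rcases l with - | l
        · rfl
        · refine absurd ⟨l, rfl, ?_⟩ hcl
          rw [P.start] at h htk
          exact htk.trans (le_antisymm hl1 h)
      · exact absurd ⟨k, rfl, htk⟩ hck
  obtain ⟨rfl, rfl⟩ := hkl
  have ht00 : t₀ = 0 := by rw [ht₀, P.start, P'.start, max_self]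
  rw [ht00, lineTo_zero hP hx, lineTo_zero hP' hx, mul_one, one_mul]
  rfl

end Homotopy

/-! ### Homotopy invariance of Wilson loops -/

namespace Homotopy

variable {𝕜 : Type} [RCLike 𝕜] {L M : NQManifold 𝕜} {H : Homotopy L M univ}
  {E : QBundle M} {W : Set (ℝ × L.Body)} {P P' : Subdivision E} {x : ℝ × L.Body}

/-- The Wilson loop of the members of a homotopy. -/
def loop (H : Homotopy L M univ) (P : Subdivision E) (s : ℝ) (y : L.Body) : OddExt 𝕜 L.Alg :=
  wilsonLoop P (fun t => H.body t s y) (fun t => H.pull t s y)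

theorem loop_eq (s : ℝ) (y : L.Body) :
    H.loop P s y = str E.lev (H.Om E P.first P.last 1 s y * H.line P s y) := rfl

theorem body_one (hH : H.IsPeriodic) (s : ℝ) (y : L.Body) : H.body 1 s y = H.body 0 s y := by
  rw [← hH.1 0 s y, zero_add]

theorem pull_one (hH : H.IsPeriodic) (s : ℝ) (y : L.Body) : H.pull 1 s y = H.pull 0 s y := by
  rw [← hH.2 0 s y, zero_add]

theorem B_one (hH : H.IsPeriodic) (i : E.Patch) : H.B E i 1 = H.B E i 0 := by
  funext s y
  simp only [B, T0, body_one hH, pull_one hH]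

theorem Om_one (hH : H.IsPeriodic) (i j : E.Patch) : H.Om E i j 1 = H.Om E i j 0 := by
  funext s y
  simp only [Om, Ω0, body_one hH, pull_one hH]

theorem mem_first_one (hH : H.IsPeriodic) (hx : x ∈ H.adaptedSet P) :
    H.body 1 x.1 x.2 ∈ E.dom P.first := by
  rw [body_one hH]; exact P.mem_first hx.2

/-- After closing with Ω the final patch is the first one, and periodicity identifies B(1) with
B(0). Both boundary terms now contain the same matrix, as the supertrace argument requires. -/
theorem isTransport_loop (hH : H.IsPeriodic) (hW : RelOpen W) (hP : W ⊆ H.adaptedSet P) :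
    IsTransport H E W P.first 0 P.first 0
      fun s y => H.Om E P.first P.last 1 s y * H.line P s y := by
  have h := (IsTransport.Om (H := H) (i := P.first) (j := P.last) hW (mem_univ 1)
    fun x hx => ⟨mem_first_one hH (hP hx), P.mem_last (hP hx).2⟩).mul hW
      (IsTransport.line hW (subset_univ _) hP)
  exact ⟨h.fnM, fun x hx => by rw [h.dM_eq x hx, B_one hH]⟩

theorem fn_str {F : ℝ → L.Body → Matrix (Fin E.rank) (Fin E.rank) (OddExt 𝕜 L.Alg)}
    (hF : FnM W E.lev E.lev F) : Fn W 0 fun s y => str E.lev (F s y) :=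
  Fn.sum fun α _ => ((hF α α).congr_deg (by ring)).sgn _

theorem dys_str (hW : RelOpen W)
    {F : ℝ → L.Body → Matrix (Fin E.rank) (Fin E.rank) (OddExt 𝕜 L.Alg)}
    (hF : FnM W E.lev E.lev F) (hx : x ∈ W) :
    dys L (fun s y => str E.lev (F s y)) x.1 x.2 = str E.lev (dM L F x.1 x.2) := by
  have h : ∀ α, Fn W 0 fun s y => F s y α α := fun α => (hF α α).congr_deg (by ring)
  refine (dys_sum hW (fun α _ => (h α).sgn _) hx).trans (Finset.sum_congr rfl fun α _ => ?_)
  exact dys_sg hW _ (h α) hx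

/-- Wilson loops are infinitesimally homotopy invariant. -/
theorem hasDWithin_loop (hH : H.IsPeriodic) (hx : x ∈ H.adaptedSet P) :
    HasDWithin 𝕜 (fun s' => (H.loop P s' x.2).fst) 0 (Icc 0 1) x.1 := by
  have hW := H.relOpen_adaptedSet P (subset_univ _)
  have hT := isTransport_loop hH hW subset_rfl
  have hf := fn_str hT.fnM
  refine (hf.hasDWithin_fst hW hx).congr_deriv ?_
  have hd : dys L (fun s y => str E.lev (H.Om E P.first P.last 1 s y * H.line P s y)) x.1 x.2 = 0 := by
    rw [dys_str hW hT.fnM hx, hT.dM_eq x hx, str_add, str_neg,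
      str_parM_mul (𝕜 := 𝕜) (fun α β => (hT.fnM α β).homog x hx)
        (H.B_homog (mem_univ 0) hx.1 (P.mem_first hx.2)), neg_add_cancel]
  -- The ϑ-coefficient of the loop has degree -1 because the supertrace has degree zero, so the
  -- exact term d^y ι U_O vanishes too.
  have hQ := congrArg OddExt.fst (dys_eq_zero_of_neg hW (fn_snd hf) (by norm_num) hx)
  simp only [dys] at hQ
  rw [hd, hQ]
  simp

/-- Wilson loops do not depend on the subdivision and the patches. -/
theorem loop_eq_loop (hH : H.IsPeriodic) (hx : x ∈ H.adaptedSet P) (hx' : x ∈ H.adaptedSet P') :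
    H.loop P x.1 x.2 = H.loop P' x.1 x.2 := by
  have hI : Icc (0 : ℝ) 1 ⊆ univ := subset_univ _
  have hW := (H.relOpen_adaptedSet P hI).inter (H.relOpen_adaptedSet P' hI)
  have hP : H.adaptedSet P ∩ H.adaptedSet P' ⊆ H.adaptedSet P := inter_subset_left
  have hP' : H.adaptedSet P ∩ H.adaptedSet P' ⊆ H.adaptedSet P' := inter_subset_right
  have hxW : x ∈ H.adaptedSet P ∩ H.adaptedSet P' := ⟨hx, hx'⟩
  have hn : P.n - 1 + 1 = P.n := Nat.sub_add_cancel P.n_pos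
  have hn' : P'.n - 1 + 1 = P'.n := Nat.sub_add_cancel P'.n_pos
  have hf1 : ∀ x ∈ H.adaptedSet P ∩ H.adaptedSet P', H.body 1 x.1 x.2 ∈ E.dom P.first ∩ E.dom P'.last :=
    fun x hx => ⟨mem_first_one hH (hP hx), P'.mem_last (hP' hx).2⟩
  have hX := IsTransport.Om (H := H) hW (mem_univ 1) hf1
  have hX0 : IsTransport H E (H.adaptedSet P ∩ H.adaptedSet P') P.first 0 P'.last 1
      (H.Om E P.first P'.last 1) := ⟨hX.fnM, fun x hx => by rw [hX.dM_eq x hx, B_one hH]⟩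
  -- The comparison is made at t = 1, in the last pieces, with X the transition matrix that closes
  -- the loop from the last patch of `P'` to the first patch of `P`.
  have h := str_lineTo hW hI hP hP' _ (P.n - 1) (P'.n - 1) 1 rfl (by have := P.n_pos; omega)
    (by have := P'.n_pos; omega)
    ⟨P.τ_le_one (Nat.sub_le _ _), by rw [hn, P.finish]⟩
    ⟨P'.τ_le_one (Nat.sub_le _ _), by rw [hn', P'.finish]⟩ _ hX0 x hxW
  have hl : H.lineTo P (P.n - 1) 1 x.1 x.2 = H.line P x.1 x.2 := by
    have := lineUpTo_succ (H := H) (P := P) (P.n - 1) x.1 x.2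
    rw [hn, P.finish] at this
    exact this.symm
  have hl' : H.lineTo P' (P'.n - 1) 1 x.1 x.2 = H.line P' x.1 x.2 := by
    have := lineUpTo_succ (H := H) (P := P') (P'.n - 1) x.1 x.2
    rw [hn', P'.finish] at this
    exact this.symm
  rw [hl, hl', ← mul_assoc, ← mul_assoc] at h
  have ho : H.Om E P.first P'.last 1 x.1 x.2 * H.Om E P'.last P.last 1 x.1 x.2 =
      H.Om E P.first P.last 1 x.1 x.2 := H.Om_mul_Om ⟨hf1 x hxW, P.mem_last hx.2⟩
  have ho' : H.Om E P'.first P.first 0 x.1 x.2 * H.Om E P.first P'.last 1 x.1 x.2 =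
      H.Om E P'.first P'.last 1 x.1 x.2 := by
    rw [← Om_one hH]
    exact H.Om_mul_Om ⟨⟨mem_first_one hH hx', mem_first_one hH hx⟩, P'.mem_last hx'.2⟩
  have hT' := IsTransport.line hW hI hP'
  have hO0 := H.fnM_Om (i := P'.first) (j := P.first) (mem_univ 0) (fun _ => hW.mem_Icc)
    fun x hx => ⟨P'.mem_first (hP' hx).2, P.mem_first (hP hx).2⟩
  -- The cocycle condition produces the closing matrix of `P`. For `P'` the transition matrix at
  -- time 0 stands on the other side of the product, and cyclicity of the supertrace brings it to
  -- the front.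
  rw [loop_eq, loop_eq, ← ho, ← ho', mul_assoc (H.Om E P'.first P.first 0 x.1 x.2)]
  refine h.trans (str_mul_comm (𝕜 := 𝕜) (fun α β => ((hX.fnM.mul hT'.fnM) α β).homog x hxW)
    fun α β => (hO0 α β).homog x hxW)

end Homotopy

/-- Every curve has an adapted subdivision. -/
theorem exists_adapted {𝕜 : Type} [RCLike 𝕜] {M : NQManifold 𝕜} (E : QBundle M) {γ : ℝ → M.Body}
    (hγ : ContinuousOn γ (Icc 0 1)) : ∃ P : Subdivision E, P.Adapted γ := by
  have hc : Continuous fun t : Icc (0 : ℝ) 1 => γ t := continuousOn_iff_continuous_domRestrict.1 hγ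
  -- The Lebesgue number argument on [0, 1] for the preimages of the patches.
  obtain ⟨u, h0, hmono, ⟨m, hm⟩, hu⟩ := exists_monotone_Icc_subset_open_cover_Icc zero_le_one
    (c := fun i : E.Patch => (fun t : Icc (0 : ℝ) 1 => γ t) ⁻¹' E.dom i)
    (fun i => (E.dom_open i).preimage hc) fun t _ => mem_iUnion.2 (E.dom_cover (γ t))
  choose p hp using hu
  refine ⟨{ n := m, τ := fun k => u k, patch := p, mono := fun k _ => hmono (Nat.le_succ k),
            start := h0, finish := hm m le_rfl }, fun k _ t ht => ?_⟩
  exact hp k (show (⟨t, (u k).2.1.trans ht.1, ht.2.trans (u (k + 1)).2.2⟩ : Icc (0 : ℝ) 1) ∈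
    Icc (u k) (u (k + 1)) from ht)

/-! ### From infinitesimal to finite homotopy invariance -/

namespace Homotopy

variable {𝕜 : Type} [RCLike 𝕜] {L M : NQManifold 𝕜} {H : Homotopy L M univ} {E : QBundle M}

/-- The Wilson loops at the two ends of a homotopy agree. -/
theorem loop_zero_eq_loop_one (hH : H.IsPeriodic) (y : L.Body) {P₀ P₁ : Subdivision E}
    (h₀ : ((0 : ℝ), y) ∈ H.adaptedSet P₀) (h₁ : ((1 : ℝ), y) ∈ H.adaptedSet P₁) :
    (H.loop P₀ 0 y).fst = (H.loop P₁ 1 y).fst := by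
  have hex : ∀ s : ℝ, ∃ P : Subdivision E, s ∈ Icc (0 : ℝ) 1 → (s, y) ∈ H.adaptedSet P := by
    intro s
    by_cases hs : s ∈ Icc (0 : ℝ) 1
    · obtain ⟨P, hP⟩ := exists_adapted E
        ((continuousOn_body_time (H := H) hs y).mono (subset_univ _))
      exact ⟨P, fun _ => ⟨hs, hP⟩⟩
    · exact ⟨P₀, fun h => absurd h hs⟩
  choose P hP using hex
  -- The subdivision chosen at `s` stays adapted nearby, and the loop does not depend on the
  -- subdivision. Near `s` the function may therefore be computed with this fixed subdivision, for
  -- which the derivative is zero.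
  have hd : ∀ s ∈ Icc (0 : ℝ) 1, HasDWithin 𝕜 (fun s' => (H.loop (P s') s' y).fst) 0 (Icc 0 1) s := by
    intro s hs i
    have h1 := hasDWithin_loop hH (hP s hs) i
    refine h1.congr_of_eventuallyEq ?_ rfl
    obtain ⟨O, hO, hOe⟩ := H.relOpen_adaptedSet (P s) (subset_univ _)
    have h2 : ∀ᶠ s' in 𝓝 s, (s', y) ∈ O :=
      (hO.preimage (f := fun s' : ℝ => (s', y)) (by fun_prop)).mem_nhds (hOe ▸ hP s hs).1
    filter_upwards [nhdsWithin_le_nhds h2, self_mem_nhdsWithin] with s' hs' hI'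
    have h3 : (s', y) ∈ H.adaptedSet (P s) := by rw [hOe]; exact ⟨hs', hI', trivial⟩
    rw [show H.loop (P s') s' y = H.loop (P s) s' y from
      loop_eq_loop (x := (s', y)) hH (hP s' hI') h3]
  have h01 := zero_le_one (α := ℝ)
  rw [show H.loop P₀ 0 y = H.loop (P 0) 0 y from
      loop_eq_loop (x := ((0 : ℝ), y)) hH h₀ (hP 0 (left_mem_Icc.2 h01)),
    show H.loop P₁ 1 y = H.loop (P 1) 1 y from
      loop_eq_loop (x := ((1 : ℝ), y)) hH h₁ (hP 1 (right_mem_Icc.2 h01))]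
  refine cf_ext (𝕜 := 𝕜) fun i => ?_
  refine (constant_of_derivWithin_zero (f := fun s => cf 𝕜 (H.loop (P s) s y).fst i)
    (fun s hs => (hd s hs i).differentiableWithinAt) (fun s hs => ?_) 1
    (right_mem_Icc.2 h01)).symm
  have h4 := (hd s (Ico_subset_Icc_self hs) i).derivWithin
    (uniqueDiffOn_Icc zero_lt_one s (Ico_subset_Icc_self hs))
  exact h4.trans (cf_zero i)

/-- The Wilson loop of a restriction. -/
theorem loop_fst_of_restrictsTo {s : ℝ} {φ : SuperLoop L M} (h : H.RestrictsTo s φ) {y : L.Body}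
    {P : Subdivision E} (hP : P.Adapted fun t => φ.body t y) :
    (H.loop P s y).fst = wilsonLoop P (fun t => φ.body t y) (fun t => φ.pull t y) := by
  have hb : (fun t => H.body t s y) = fun t => φ.body t y := funext fun t => h.1 t y
  -- The restriction condition compares pull-backs of homogeneous elements only, and entries of T
  -- and Ω are homogeneous only over their patches. Adaptedness supplies this at every point that is
  -- used.
  have hA : ∀ i t, φ.body t y ∈ E.dom i →
      T1 E i (fun t => φ.body t y) (fun t => φ.pull t y) t = (H.A E i t s y).map OddExt.fst := by
    intro i t ht
    ext1 α β
    simp only [T1, Homotopy.A, Matrix.of_apply, Matrix.map_apply, h.1 t y,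
      ← h.2 t y _ _ ((E.T_fn i α β).1 _ ht)]
  have hO : ∀ i j t, φ.body t y ∈ E.dom i ∩ E.dom j →
      Ω0 E i j (fun t => φ.body t y) (fun t => φ.pull t y) t =
        (H.Om E i j t s y).map OddExt.fst := by
    intro i j t ht
    ext1 α β
    simp only [Ω0, Homotopy.Om, Matrix.of_apply, Matrix.map_apply, h.1 t y,
      ← h.2 t y _ _ ((E.Ω_fn i j α β).1 _ ht)]
  have hl : ∀ k ≤ P.n, wilsonUpTo P (fun t => φ.body t y) (fun t => φ.pull t y) k =
      (H.lineUpTo P k s y).map OddExt.fst := by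
    intro k
    induction k with
    | zero => exact fun _ => map_fst_one.symm
    | succ k ih =>
      intro hk
      rw [lineUpTo_succ, lineTo, map_fst_mul, map_fst_mul, ← ih (by omega), U, map_fst_pexp,
        ← hO _ _ _ (P.mem_prev hP hk), wilsonUpTo, mul_assoc,
        pexp_congr (P.mono k hk) fun t ht => hA _ t (hP k hk t ht)]
  -- The end point lies in the first patch by periodicity, so the closing transition matrix is also
  -- covered.
  have hlast : φ.body 1 y ∈ E.dom P.first ∩ E.dom P.last := by
    refine ⟨?_, P.mem_last hP⟩
    have h1 := P.mem_first hP
    rwa [← φ.periodic_body 0 y, zero_add] at h1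
  have hline : (H.line P s y).map OddExt.fst =
      wilsonLine P (fun t => φ.body t y) (fun t => φ.pull t y) := (hl P.n le_rfl).symm
  rw [loop_eq, str, fst_sum, wilsonLoop]
  refine Finset.sum_congr rfl fun α _ => ?_
  rw [OddExt.fst_sg, hO _ _ _ hlast, ← hline, ← map_fst_mul]
  rfl

end Homotopy

theorem SuperLoop.Homotopic.wilsonLoop_eq {𝕜 : Type} [RCLike 𝕜] {L M : NQManifold 𝕜} {E : QBundle M}
    {φ₀ φ₁ : SuperLoop L M} (h : φ₀.Homotopic φ₁) (y : L.Body) {P₀ P₁ : Subdivision E}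
    (h₀ : P₀.Adapted fun t => φ₀.body t y) (h₁ : P₁.Adapted fun t => φ₁.body t y) :
    wilsonLoop P₀ (fun t => φ₀.body t y) (fun t => φ₀.pull t y) =
      wilsonLoop P₁ (fun t => φ₁.body t y) (fun t => φ₁.pull t y) := by
  obtain ⟨H, hH, hr₀, hr₁⟩ := h
  rw [← H.loop_fst_of_restrictsTo hr₀ h₀, ← H.loop_fst_of_restrictsTo hr₁ h₁]
  refine H.loop_zero_eq_loop_one hH y ⟨left_mem_Icc.2 zero_le_one, ?_⟩
    ⟨right_mem_Icc.2 zero_le_one, ?_⟩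
  · intro k hk t ht
    dsimp only
    rw [hr₀.1 t y]
    exact h₀ k hk t ht
  · intro k hk t ht
    dsimp only
    rw [hr₁.1 t y]
    exact h₁ k hk t ht

end NQ

end

theorem mainTheorem4 {𝕜 : Type} [RCLike 𝕜] (L M : NQ.NQManifold 𝕜) (E : NQ.QBundle M) :
    -- the change of the Wilson line under a homotopy
    (∀ (H : NQ.Homotopy L M (Set.Icc 0 1)) (s : ℝ) (y : L.Body) (P : NQ.Subdivision E),
      s ∈ Set.Icc (0 : ℝ) 1 → P.Adapted (fun t => H.body t s y) →
      (∃ V : Set L.Body, IsOpen V ∧ y ∈ V ∧ ∀ α β,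
        L.IsFn V (E.lev β - E.lev α) (fun y' => NQ.bot (H.line P s y') α β) ∧
        L.IsFn V (E.lev β - E.lev α - 1) (fun y' => NQ.iot (H.line P s y') α β)) ∧
      (∀ α β, NQ.HasDWithin 𝕜 (fun s' => NQ.bot (H.line P s' y) α β)
        (L.Q (fun y' => NQ.iot (H.line P s y') α β) y +
          NQ.iot (Matrix.of fun α β => -∑ δ, H.Tfin P s y α δ * H.line P s y δ β +
            ∑ γ, NQ.sg (E.lev α + E.lev γ) (H.line P s y α γ * H.Tinit P s y γ β)) α β)
        (Set.Icc 0 1) s) ∧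
      NQ.HasDsEnd (NQ.iot (H.Tfin P s y)) (NQ.iot (H.Tinit P s y))
        (fun s' => NQ.bot (H.line P s' y))
        (NQ.dEnd (NQ.bot (H.Tfin P s y)) (NQ.bot (H.Tinit P s y))
          (fun y' => Matrix.of fun α β => NQ.sg (E.lev α) (NQ.iot (H.line P s y') α β)) y) s) ∧
    -- infinitesimal homotopy invariance of Wilson loops
    (∀ (H : NQ.Homotopy L M Set.univ) (s : ℝ) (y : L.Body) (P : NQ.Subdivision E),
      H.IsPeriodic → s ∈ Set.Icc (0 : ℝ) 1 → P.Adapted (fun t => H.body t s y) →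
      NQ.HasDWithin 𝕜
        (fun s' => (NQ.wilsonLoop P (fun t => H.body t s' y) (fun t => H.pull t s' y)).fst)
        0 (Set.Icc 0 1) s) ∧
    -- homotopy invariance of Wilson loops
    (∀ φ₀ φ₁ : NQ.SuperLoop L M, φ₀.Homotopic φ₁ → ∀ (y : L.Body) (P₀ P₁ : NQ.Subdivision E),
      P₀.Adapted (fun t => φ₀.body t y) → P₁.Adapted (fun t => φ₁.body t y) →
      NQ.wilsonLoop P₀ (fun t => φ₀.body t y) (fun t => φ₀.pull t y) =
        NQ.wilsonLoop P₁ (fun t => φ₁.body t y) (fun t => φ₁.pull t y)) := by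
  exact ⟨fun H s y P hs hP => NQ.Homotopy.line_variation H s y P hs hP,
    fun _ s y _ hH hs hP => NQ.Homotopy.hasDWithin_loop (x := (s, y)) hH ⟨hs, hP⟩,
    fun _ _ h y _ _ h₀ h₁ => h.wilsonLoop_eq y h₀ h₁⟩
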